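/- **Setting.** Let $S(T^*\mathbb R^3,0)$ be the set of symplectic diffeomorphism germs of $(T^*\mathbb R^3,0)$, with coordinates $(q,p)$ and $\pi(q,p)=q$. Let $S^l(3)$ be the smooth manifold of their $l$-jets at $0$. For $\sigma\subset I_2=\{1,2\}$ put $$L^0_\sigma=\{(q,p)\in (T^*\mathbb R^3,0)\mid q_\sigma=p_{I_2-\sigma}=q_3=0,\ q_{I_2-\sigma}\ge 0\},$$ and let $\mathbb L$ be the union of the $L^0_\sigma$. A *reticular Lagrangian map* is a germ $\pi\circ i$, where $i=S|_{\mathbb L}$ for some $S\in S(T^*\mathbb R^3,0)$; such an $S$ is called an *extension* of $i$. A smooth function germ $F(x,y,q)$ on $(\mathbb R_{\ge0}^2\times\mathbb R^k\times\mathbb R^3,0)$ with $F(0)=0$, $dF(0)=0$ is a *generating family* of $\pi\circ i$ if the differentials at $0$ of $x_1,x_2,\partial F/\partial x_1,\partial F/\partial x_2,\partial F/\partial y_1,\dots,\partial F/\partial y_k$ are linearly independent and, for every $\sigma\subset I_2$, as set germs at $0$, $$i(L^0_\sigma)=\Big\{\big(q,\tfrac{\partial F}{\partial q}(x,y,q)\big)\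 \Big|\ x_\sigma=\tfrac{\partial F}{\partial x_{I_2-\sigma}}=\tfrac{\partial F}{\partial y}=0,\ x_{I_2-\sigma}\ge0\Big\}.$$ Two such germs $F,G$ (with the same $k$) are *reticular $\mathcal P$-$\mathcal C$-equivalent* if $G(x,y,q)=a(q)\,F(\Phi(x,y,q))+b(q)$ for smooth germs $a,b$ with $a(0)\neq0$ and a diffeomorphism germ $\Phi$ of $(\mathbb R_{\ge0}^2\times\mathbb R^k\times\mathbb R^3,0)$ of the form $\Phi(x,y,q)=(x_1\phi_1(x,y,q),x_2\phi_2(x,y,q),\phi_3(x,y,q),\phi_4(q))$. For $S\in S(T^*\mathbb R^3,0)$, the *Lagrangian equivalence class* $[S]_L$ is the set of all germs $\Theta\circ S\circ\varphi^{-1}$, where $\varphi,\Theta\in S(T^*\mathbb R^3,0)$, $\varphi(L_\sigma^0)=L_\sigma^0$ for all $\sigma\subset I_2$, and $\Theta$ maps fibres of $\pi$ to fibres of $\pi$. The *caustic-equivalence class* $[S]_c$ is the union of the classes $[R]_L$ over all $R\in S(T^*\mathbb R^3,0)$ such that, for some $k$, the reticular Lagrangian maps $\pi\circ S|_{\mathbb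 L}$ and $\pi\circ R|_{\mathbb L}$ have generating families that are reticular $\mathcal P$-$\mathcal C$-equivalent. Let $[j^lS(0)]_c\subset S^l(3)$ be the set of $l$-jets at $0$ of the elements of $[S]_c$. **Corollary 4.2.** For each $a>\frac14$ let $S'_a\in S(T^*\mathbb R^3,0)$ be an extension of a reticular Lagrangian embedding $i_a$ such that $\pi\circ i_a:(\mathbb L,0)\to(T^*\mathbb R^3,0)\to(\mathbb R^3,0)$ has the generating family $$F'_a(x_1,x_2,q_1,q_2,q_3)=x_1^2+x_1x_2+a x_2^2+q_1x_1+q_2x_2+q_3x_2^2 .$$ Then, for every $l\ge1$, the weak caustic-equivalence class $$[j^lS'_1(0)]_w:=\bigcup_{a>\frac14}[j^lS'_a(0)]_c$$ is an immersed manifold in $S^l(3)$, that is, a subset of $S^l(3)$ that is the image of an injective immersion of a (Hausdorff, second countable, finite-dimensional) smooth manifold. -/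

import Mathlib

open scoped ContDiff Manifold Topology

noncomputable section

namespace RetLag

/-! Symplectic diffeomorphism germs on `(T*ℝ³, 0)`. A germ is represented by a function that is
defined everywhere; only its behaviour near `0` is ever used. -/

/-- The cotangent bundle `T*ℝ³`, with points `(q, p)`. -/
abbrev Cot : Type := (Fin 3 → ℝ) × (Fin 3 → ℝ)

/-- `F` is a smooth germ at `0`: it is `C^∞` on a neighbourhood of `0`. -/
def SmoothGerm {E E' : Type*} [NormedAddCommGroup E] [NormedSpace ℝ E]
    [NormedAddCommGroup E'] [NormedSpace ℝ E'] (F : E → E') : Prop :=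
  ∀ᶠ z in 𝓝 (0 : E), ContDiffAt ℝ ∞ F z

/-- The canonical symplectic form `∑ dpᵢ ∧ dqᵢ` on `T*ℝ³`. -/
def omega (u v : Cot) : ℝ := ∑ i, (u.2 i * v.1 i - v.2 i * u.1 i)

/-- `S ∈ S(T*ℝ³, 0)`: `S` is a symplectic diffeomorphism germ on `(T*ℝ³, 0)`. (A smooth germ that
preserves `omega` has invertible differentials, so it is a local diffeomorphism.) -/
def IsSymplecticGerm (S : Cot → Cot) : Prop :=
  S 0 = 0 ∧ SmoothGerm S ∧
    ∀ᶠ z in 𝓝 (0 : Cot), ∀ u v, omega (fderiv ℝ S z u) (fderiv ℝ S z v) = omega u v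

/-- For `σ ⊆ I₂`, the set `L_σ⁰ = {q_σ = 0, p_{I₂ - σ} = 0, q_{I₂ - σ} ≥ 0, q₃ = 0}`.
The coordinates with indices in `I₂ = {1, 2}` are the first two, `i.castSucc` for `i : Fin 2`. -/
def L0 (σ : Finset (Fin 2)) : Set Cot :=
  {z | (∀ i ∈ σ, z.1 i.castSucc = 0) ∧
       (∀ i ∉ σ, z.2 i.castSucc = 0 ∧ 0 ≤ z.1 i.castSucc) ∧ z.1 2 = 0}

/-! Generating families on the corner `ℍ² × ℝᵏ × ℝ³`. A smooth germ on the corner is the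
restriction of a smooth germ on `ℝ² × ℝᵏ × ℝ³`. -/

/-- The space of `(x, y, q)`, `x ∈ ℝ²`, `y ∈ ℝᵏ`, `q ∈ ℝ³`. -/
abbrev Par (k : ℕ) : Type := (Fin 2 → ℝ) × (Fin k → ℝ) × (Fin 3 → ℝ)

/-- `∂F/∂xᵢ`. -/
def dx {k : ℕ} (F : Par k → ℝ) (i : Fin 2) (z : Par k) : ℝ := fderiv ℝ F z (Pi.single i 1, 0, 0)

/-- `∂F/∂yⱼ`. -/
def dy {k : ℕ} (F : Par k → ℝ) (j : Fin k) (z : Par k) : ℝ := fderiv ℝ F z (0, Pi.single j 1, 0)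

/-- `∂F/∂qₘ`. -/
def dq {k : ℕ} (F : Par k → ℝ) (m : Fin 3) (z : Par k) : ℝ := fderiv ℝ F z (0, 0, Pi.single m 1)

/-- The part over `U` of the Lagrangian set generated by `F` restricted to `x_σ = 0`:
`{(q, ∂F/∂q(x,y,q)) | (x,y,q) ∈ U, x_σ = 0, ∂F/∂x_{I₂ - σ} = 0, x_{I₂ - σ} ≥ 0, ∂F/∂y = 0}`. -/
def lagSet {k : ℕ} (F : Par k → ℝ) (σ : Finset (Fin 2)) (U : Set (Par k)) : Set Cot :=
  (fun z : Par k => ((z.2.2, fun m => dq F m z) : Cot)) ''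
    {z | z ∈ U ∧ (∀ i ∈ σ, z.1 i = 0) ∧ (∀ i ∉ σ, dx F i z = 0 ∧ 0 ≤ z.1 i) ∧
      ∀ j, dy F j z = 0}

/-- `F ∈ 𝔐(2; k+3)²` is non-degenerate: `x₁, x₂, ∂F/∂x₁, ∂F/∂x₂, ∂F/∂y₁, …, ∂F/∂yₖ` have
linearly independent differentials at `0`. -/
def Nondegenerate {k : ℕ} (F : Par k → ℝ) : Prop :=
  Function.Surjective (fderiv ℝ (fun z : Par k =>
    (((z.1, fun i => dx F i z, fun j => dy F j z)) :
      (Fin 2 → ℝ) × (Fin 2 → ℝ) × (Fin k → ℝ))) 0)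

/-- `F` is a generating family of the reticular Lagrangian map `π ∘ S|_𝕃`, that is, `S` is an
extension of a reticular Lagrangian embedding `i` such that `F` generates `π ∘ i`: `F` is a
non-degenerate germ in `𝔐(2; k+3)²` and, for every `σ ⊆ I₂`, the set germ `S(L_σ⁰)` at `0` is the
germ of the Lagrangian set generated by `F` restricted to `x_σ = 0`. -/
def IsGeneratingFamily {k : ℕ} (F : Par k → ℝ) (S : Cot → Cot) : Prop :=
  SmoothGerm F ∧ F 0 = 0 ∧ fderiv ℝ F 0 = 0 ∧ Nondegenerate F ∧
    ∀ σ : Finset (Fin 2), ∃ U₀ ∈ 𝓝 (0 : Par k), ∀ U ∈ 𝓝 (0 : Par k), U ⊆ U₀ →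
      ∀ᶠ z in 𝓝 (0 : Cot), (S z ∈ lagSet F σ U ↔ z ∈ L0 σ)

/-- Reticular 𝒫-𝒞-equivalence: `G = a · F ∘ Φ + b` on the corner, where
`Φ(x,y,q) = (x₁φ₁¹(x,y,q), x₂φ₁²(x,y,q), φ₂(x,y,q), φ₃(q))` is a diffeomorphism germ of the
corner, `a` is a unit of `ℰ(3)` and `b ∈ ℰ(3)`. -/
def PCEquiv {k : ℕ} (F G : Par k → ℝ) : Prop :=
  ∃ (φ₁ : Par k → Fin 2 → ℝ) (φ₂ : Par k → Fin k → ℝ) (φ₃ : (Fin 3 → ℝ) → Fin 3 → ℝ)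
    (a b : (Fin 3 → ℝ) → ℝ) (Φ : Par k → Par k),
    SmoothGerm φ₁ ∧ SmoothGerm φ₂ ∧ SmoothGerm φ₃ ∧ SmoothGerm a ∧ SmoothGerm b ∧
    (∀ i, 0 < φ₁ 0 i) ∧ φ₂ 0 = 0 ∧ φ₃ 0 = 0 ∧ a 0 ≠ 0 ∧
    (∀ z, Φ z = (fun i => z.1 i * φ₁ z i, φ₂ z, φ₃ z.2.2)) ∧
    Function.Bijective (fderiv ℝ Φ 0) ∧
    ∀ᶠ z in 𝓝 (0 : Par k), (∀ i, 0 ≤ z.1 i) → G z = a z.2.2 * F (Φ z) + b z.2.2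

/-! Equivalence classes of symplectic diffeomorphism germs. -/

/-- A reticular diffeomorphism: a symplectic diffeomorphism germ that maps each set germ `L_σ⁰`
to itself. -/
def IsReticularDiffeo (φ : Cot → Cot) : Prop :=
  IsSymplecticGerm φ ∧ ∀ σ, ∀ᶠ z in 𝓝 (0 : Cot), (φ z ∈ L0 σ ↔ z ∈ L0 σ)

/-- A Lagrangian equivalence of `π : T*ℝ³ → ℝ³`, `π(q, p) = q`: a symplectic diffeomorphism germ
that maps fibres of `π` to fibres of `π`. -/
def IsLagrangianDiffeo (Θ : Cot → Cot) : Prop :=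
  IsSymplecticGerm Θ ∧ ∃ g : (Fin 3 → ℝ) → (Fin 3 → ℝ), ∀ᶠ z in 𝓝 (0 : Cot), (Θ z).1 = g z.1

/-- The reticular Lagrangian maps of `S` and `T` are Lagrangian equivalent: `T ∘ φ = Θ ∘ S` for
a reticular diffeomorphism `φ` and a Lagrangian equivalence `Θ`. (Asking for this equality only on
`𝕃` gives the same relation, with `φ` replaced by `T⁻¹ ∘ Θ ∘ S`.) -/
def LagrangianEquiv (S T : Cot → Cot) : Prop :=
  ∃ φ Θ, IsReticularDiffeo φ ∧ IsLagrangianDiffeo Θ ∧ ∀ᶠ z in 𝓝 (0 : Cot), T (φ z) = Θ (S z)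

/-- The Lagrangian equivalence class `[S]_L ⊆ S(T*ℝ³, 0)`. -/
def lagrangianClass (S : Cot → Cot) : Set (Cot → Cot) :=
  {T | IsSymplecticGerm T ∧ LagrangianEquiv S T}

/-- The caustic-equivalence class `[S]_c ⊆ S(T*ℝ³, 0)`: the union of the classes `[R]_L` over all
`R` such that the reticular Lagrangian maps of `S` and `R` have (stably) reticular
𝒫-𝒞-equivalent generating families. (Stabilisation is built in: `k` is arbitrary, and adding a
non-degenerate quadratic form in new variables `y` to a generating family gives another generating
family of the same map.) -/
def causticClass (S : Cot → Cot) : Set (Cot → Cot) :=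
  {T | ∃ R, IsSymplecticGerm R ∧
    (∃ (k : ℕ) (F G : Par k → ℝ),
      IsGeneratingFamily F S ∧ IsGeneratingFamily G R ∧ PCEquiv F G) ∧
    T ∈ lagrangianClass R}

/-! Jets and immersed manifolds. -/

/-- Taylor data of order `≤ l` at `0` of maps `T*ℝ³ → T*ℝ³`, a finite-dimensional vector space. -/
abbrev JetSpace (l : ℕ) : Type :=
  ∀ m : Fin (l + 1), ContinuousMultilinearMap ℝ (fun _ : Fin (m : ℕ) => Cot) Cot

/-- The `l`-jet `j^l S(0)`, given by the derivatives of order `≤ l` at `0`. -/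
def jet (l : ℕ) (S : Cot → Cot) : JetSpace l := fun m => iteratedFDeriv ℝ (m : ℕ) S 0

/-- `S^l(3)`, the set of `l`-jets of elements of `S(T*ℝ³, 0)`; it is an embedded smooth submanifold
of the vector space `JetSpace l`, and carries that manifold structure. -/
def symplecticJets (l : ℕ) : Set (JetSpace l) := jet l '' {S | IsSymplecticGerm S}

/-- `W` is an immersed manifold in `N`, where `N` is an embedded submanifold of the vector space
`V`: `W ⊆ N`, and `W` is the image of an injective immersion of a smooth (Hausdorff, second
countable, finite-dimensional) manifold. As `N` is embedded in `V`, smoothness and the immersion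
property of a map into `N` can be tested in `V`. -/
def IsImmersedManifoldIn {V : Type} [NormedAddCommGroup V] [NormedSpace ℝ V] (W N : Set V) :
    Prop :=
  W ⊆ N ∧
    ∃ (d : ℕ) (M : Type) (_ : TopologicalSpace M)
      (_ : ChartedSpace (EuclideanSpace ℝ (Fin d)) M) (f : M → V),
      T2Space M ∧ SecondCountableTopology M ∧ IsManifold (𝓡 d) ∞ M ∧
      ContMDiff (𝓡 d) 𝓘(ℝ, V) ∞ f ∧ Function.Injective f ∧
      (∀ x : M, Function.Injective (mfderiv (𝓡 d) 𝓘(ℝ, V) f x)) ∧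
      Set.range f = W

/-- `F'_a(x, q) = x₁² + x₁x₂ + a x₂² + q₁x₁ + q₂x₂ + q₃x₂²` (no variables `y`). -/
def Fa (a : ℝ) (z : Par 0) : ℝ :=
  z.1 0 ^ 2 + z.1 0 * z.1 1 + a * z.1 1 ^ 2 +
    z.2.2 0 * z.1 0 + z.2.2 1 * z.1 1 + z.2.2 2 * z.1 1 ^ 2

/-- The weak caustic-equivalence class `⋃_{a > 1/4} [j^l S'_a(0)]_c` of a family `S'`, where
`[j^l S(0)]_c` is the set of `l`-jets of the elements of `[S]_c`. -/
def weakCausticClass (l : ℕ) (S' : ℝ → Cot → Cot) : Set (JetSpace l) :=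
  ⋃ a ∈ Set.Ioi (1 / 4 : ℝ), jet l '' causticClass (S' a)

end RetLag

end

/-!
A symplectic germ `S : (q, p) ↦ (Q, P)` for which `(q, Q)` are coordinates on its graph is given by
a generating function `A(q, Q)` with `p = -∂A/∂q`, `P = ∂A/∂Q`. This identifies `l`-jets of such
germs with `(l + 1)`-jets of potentials `A`, by a smooth map with smooth local left inverses. The
restriction of `A` to `q₃ = 0` is a generating family in `x = (q₁, q₂)` with parameters `Q`.

A generating family determines its critical value through the Lagrangian set it generates, so
𝒫-𝒞-equivalences of generating families transport Lagrangian sets. Hence every germ in the weak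
class has a potential, and up to Lagrangian equivalence this potential is a normal form
`c(Q) (F'ₐ(q₁, q₂, g(Q)) + q₃ g₃(Q)) + b(Q)`.

The unfolding term `q₃ x₂²` of `F'ₐ` moves the modulus `a`, and the discriminant `4a - 1` of the
quadratic part does not vanish. The family of all normal forms with `a > 1/4` is therefore versal:
together they fill an open set of jets of potentials. So the weak class is the injective immersive
image of an open subset of a finite-dimensional vector space.
-/

noncomputable section

namespace RetLag

open Filter

/-! ### Smooth germs -/

section Smooth

universe u

variable {E F G : Type*} [NormedAddCommGroup E] [NormedSpace ℝ E]
  [NormedAddCommGroup F] [NormedSpace ℝ F] [NormedAddCommGroup G] [NormedSpace ℝ G] {x : E}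

/-- `f` defines a smooth germ at `x`. This asks for more than `ContDiffAt ℝ ∞ f x`, which lets the
neighbourhood shrink with the order of differentiation. -/
@[fun_prop]
def SmoothNear (f : E → F) (x : E) : Prop := ∀ᶠ z in 𝓝 x, ContDiffAt ℝ ∞ f z

theorem smoothNear_of_contDiff {f : E → F} (h : ContDiff ℝ ∞ f) (x : E) :
    SmoothNear f x :=
  Eventually.of_forall fun _ => h.contDiffAt

@[fun_prop]
theorem smoothNear_const (c : F) : SmoothNear (fun _ : E => c) x :=
  smoothNear_of_contDiff contDiff_const x

@[fun_prop]
theorem smoothNear_id : SmoothNear (fun z : E => z) x := smoothNear_of_contDiff contDiff_id x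

theorem smoothNear_pi {ι : Type*} [Fintype ι] {f : E → ι → F} :
    SmoothNear f x ↔ ∀ i, SmoothNear (fun z => f z i) x := by
  simp only [SmoothNear, contDiffAt_pi, eventually_all]

@[fun_prop]
theorem smoothNear_apply {ι : Type*} [Fintype ι] (i : ι) {x : ι → F} :
    SmoothNear (fun f : ι → F => f i) x :=
  smoothNear_of_contDiff (contDiff_apply ℝ F i) x

namespace SmoothNear

theorem contDiffAt {f : E → F} (h : SmoothNear f x) : ContDiffAt ℝ ∞ f x := h.self_of_nhds

theorem contDiffAt_natCast {f : E → F} (h : SmoothNear f x) (m : ℕ) : ContDiffAt ℝ m f x :=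
  contDiffAt_infty.1 h.contDiffAt m

theorem differentiableAt {f : E → F} (h : SmoothNear f x) : DifferentiableAt ℝ f x :=
  h.contDiffAt.differentiableAt (by simp)

theorem continuousAt {f : E → F} (h : SmoothNear f x) : ContinuousAt f x :=
  h.contDiffAt.continuousAt

theorem tendsto {f : E → F} (h : SmoothNear f x) {y : F} (hy : f x = y) :
    Tendsto f (𝓝 x) (𝓝 y) :=
  hy ▸ h.continuousAt

protected theorem eventually {f : E → F} (h : SmoothNear f x) : ∀ᶠ z in 𝓝 x, SmoothNear f z :=
  eventually_eventually_nhds.2 h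

theorem eventually_differentiableAt {f : E → F} (h : SmoothNear f x) :
    ∀ᶠ z in 𝓝 x, DifferentiableAt ℝ f z :=
  h.mono fun _ hz => hz.differentiableAt (by simp)

theorem congr {f g : E → F} (h : SmoothNear f x) (hfg : g =ᶠ[𝓝 x] f) : SmoothNear g x := by
  filter_upwards [h, eventually_eventually_nhds.2 hfg] with z hz hz'
  exact hz.congr_of_eventuallyEq hz'

@[fun_prop]
theorem comp {g : F → G} {f : E → F} (hg : SmoothNear g (f x)) (hf : SmoothNear f x) :
    SmoothNear (fun z => g (f z)) x := by
  filter_upwards [hf, hf.continuousAt.eventually hg] with z hfz hgz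
  exact hgz.comp z hfz

theorem comp_of_eq {g : F → G} {f : E → F} {y : F} (hg : SmoothNear g y) (hf : SmoothNear f x)
    (hy : f x = y) : SmoothNear (fun z => g (f z)) x := by
  subst hy
  exact hg.comp hf

@[fun_prop]
theorem prodMk {f : E → F} {g : E → G} (hf : SmoothNear f x) (hg : SmoothNear g x) :
    SmoothNear (fun z => (f z, g z)) x := by
  filter_upwards [hf, hg] with z hfz hgz using hfz.prodMk hgz

@[fun_prop]
theorem fst {f : E → F × G} (hf : SmoothNear f x) : SmoothNear (fun z => (f z).1) x :=
  hf.mono fun _ h => h.fst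

@[fun_prop]
theorem snd {f : E → F × G} (hf : SmoothNear f x) : SmoothNear (fun z => (f z).2) x :=
  hf.mono fun _ h => h.snd

@[fun_prop]
theorem add {f g : E → F} (hf : SmoothNear f x) (hg : SmoothNear g x) :
    SmoothNear (fun z => f z + g z) x := by
  filter_upwards [hf, hg] with z hfz hgz using hfz.add hgz

@[fun_prop]
theorem sub {f g : E → F} (hf : SmoothNear f x) (hg : SmoothNear g x) :
    SmoothNear (fun z => f z - g z) x := by
  filter_upwards [hf, hg] with z hfz hgz using hfz.sub hgz

@[fun_prop]
theorem neg {f : E → F} (hf : SmoothNear f x) : SmoothNear (fun z => -f z) x :=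
  hf.mono fun _ h => h.neg

@[fun_prop]
theorem mul {f g : E → ℝ} (hf : SmoothNear f x) (hg : SmoothNear g x) :
    SmoothNear (fun z => f z * g z) x := by
  filter_upwards [hf, hg] with z hfz hgz using hfz.mul hgz

@[fun_prop]
theorem smul {c : E → ℝ} {f : E → F} (hc : SmoothNear c x) (hf : SmoothNear f x) :
    SmoothNear (fun z => c z • f z) x := by
  filter_upwards [hc, hf] with z hcz hfz using hcz.smul hfz

@[fun_prop]
theorem pow {f : E → ℝ} (hf : SmoothNear f x) (n : ℕ) : SmoothNear (fun z => f z ^ n) x :=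
  hf.mono fun _ h => h.pow n

theorem inv {f : E → ℝ} (hf : SmoothNear f x) (h : f x ≠ 0) :
    SmoothNear (fun z => (f z)⁻¹) x := by
  filter_upwards [hf, hf.continuousAt.eventually_ne h] with z hfz hz using hfz.inv hz

@[fun_prop]
theorem sum {ι : Type*} {s : Finset ι} {f : ι → E → F} (hf : ∀ i ∈ s, SmoothNear (f i) x) :
    SmoothNear (fun z => ∑ i ∈ s, f i z) x := by
  filter_upwards [(Finset.eventually_all s).2 hf] with z hz using ContDiffAt.sum hz

theorem clm (L : F →L[ℝ] G) {f : E → F} (hf : SmoothNear f x) : SmoothNear (fun z => L (f z)) x :=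
  (smoothNear_of_contDiff L.contDiff _).comp hf

protected theorem fderiv {f : E → F} (hf : SmoothNear f x) :
    SmoothNear (fun z => fderiv ℝ f z) x :=
  hf.mono fun _ h => h.fderiv_right (by simp)

section Parameters

variable {f : E → F → G} {y : F} (h : SmoothNear (Function.uncurry f) (x, y))
include h

theorem uncurry_fderiv : SmoothNear (Function.uncurry fun t z => fderiv ℝ (f t) z) (x, y) := by
  refine h.mono fun p hp => ?_
  refine ContDiffAt.fderiv (f := fun (q : E × F) (z : F) => f q.1 z) (g := fun q => q.2)
    (x₀ := p) (n := ∞) ?_ contDiffAt_snd (by simp)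
  exact ContDiffAt.comp (f := fun q : (E × F) × F => (q.1.1, q.2))
    (g := Function.uncurry f) (p, p.2) (by simpa using hp) (by fun_prop)

theorem eventually_apply_left : ∀ᶠ t in 𝓝 x, SmoothNear (f t) y := by
  filter_upwards [Eventually.curry_nhds h] with t ht
  filter_upwards [ht] with z hz
  exact ContDiffAt.comp (f := fun z : F => (t, z)) (g := Function.uncurry f) z hz (by fun_prop)

theorem apply_right : SmoothNear (fun t => f t y) x :=
  SmoothNear.comp (g := Function.uncurry f) (f := fun t => (t, y)) h (by fun_prop)

end Parameters

theorem iteratedFDeriv_apply {F G : Type u} [NormedAddCommGroup F] [NormedSpace ℝ F]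
    [NormedAddCommGroup G] [NormedSpace ℝ G] {f : E → F → G} {y : F}
    (h : SmoothNear (Function.uncurry f) (x, y)) (m : ℕ) :
    SmoothNear (fun t => iteratedFDeriv ℝ m (f t) y) x := by
  induction m generalizing G with
  | zero =>
    simp only [iteratedFDeriv_zero_eq_comp, Function.comp_apply]
    exact h.apply_right.clm
      (continuousMultilinearCurryFin0 ℝ F G).symm.toContinuousLinearEquiv.toContinuousLinearMap
  | succ m ih =>
    simp only [iteratedFDeriv_succ_eq_comp_right, Function.comp_apply]
    let uncurry := (continuousMultilinearCurryRightEquiv' ℝ m F G).symm.toContinuousLinearEquiv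
    exact (ih h.uncurry_fderiv).clm uncurry.toContinuousLinearMap

theorem isSymmSndFDerivAt {f : E → F} (hf : SmoothNear f x) : IsSymmSndFDerivAt ℝ f x :=
  (hf.contDiffAt_natCast 2).isSymmSndFDerivAt (by simp)

section Symmetry

variable {E F : Type u} [NormedAddCommGroup E] [NormedSpace ℝ E] [NormedAddCommGroup F]
  [NormedSpace ℝ F] {x : E}

/-- Flipping the second derivative, which is symmetric, swaps the last two arguments. -/
theorem iteratedFDeriv_comp_swap_last {f : E → F} (hf : SmoothNear f x) {m : ℕ}
    (v : Fin (m + 2) → E) :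
    iteratedFDeriv ℝ (m + 2) f x (v ∘ Equiv.swap (Fin.last m).castSucc (Fin.last (m + 1))) =
      iteratedFDeriv ℝ (m + 2) f x v := by
  let D := fderiv ℝ (fderiv ℝ f)
  let flip : (E →L[ℝ] E →L[ℝ] F) ≃L[ℝ] (E →L[ℝ] E →L[ℝ] F) :=
    (ContinuousLinearMap.flipₗᵢ ℝ E E F).toContinuousLinearEquiv
  have hflip : (fun z => flip (D z)) =ᶠ[𝓝 x] D := by
    filter_upwards [hf.eventually] with z hz
    ext u w
    exact hz.isSymmSndFDerivAt w u
  have hD : ∀ u w w', iteratedFDeriv ℝ m D x u w w' = iteratedFDeriv ℝ m D x u w' w := by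
    intro u w w'
    conv_lhs => rw [← (hflip.iteratedFDeriv ℝ m).eq_of_nhds]
    have hcomp := ContinuousLinearEquiv.iteratedFDeriv_comp_left (𝕜 := ℝ) (E := E)
      (F := E →L[ℝ] E →L[ℝ] F) (G := E →L[ℝ] E →L[ℝ] F) (f := D) (x := x) (i := m) flip
    exact DFunLike.congr_fun (DFunLike.congr_fun (DFunLike.congr_fun hcomp u) w) w'
  have happly : ∀ w : Fin (m + 2) → E, iteratedFDeriv ℝ (m + 2) f x w =
      iteratedFDeriv ℝ m D x (Fin.init (Fin.init w)) (w (Fin.last m).castSucc)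
        (w (Fin.last (m + 1))) := by
    intro w
    rw [iteratedFDeriv_succ_apply_right, iteratedFDeriv_succ_apply_right]
    rfl
  rw [happly, happly, hD]
  congr 2
  · congr 1
    ext i
    simp only [Fin.init, Function.comp_apply]
    rw [Equiv.swap_apply_of_ne_of_ne] <;> simp [Fin.ext_iff] <;> omega
  all_goals simp

theorem iteratedFDeriv_comp_swap {f : E → F} (hf : SmoothNear f x) {m : ℕ} (i : Fin m)
    (v : Fin (m + 1) → E) :
    iteratedFDeriv ℝ (m + 1) f x (v ∘ Equiv.swap i.castSucc i.succ) =
      iteratedFDeriv ℝ (m + 1) f x v := by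
  induction m generalizing F with
  | zero => exact i.elim0
  | succ m ih =>
    induction i using Fin.lastCases with
    | last => exact hf.iteratedFDeriv_comp_swap_last v
    | cast i =>
      have hlast : Equiv.swap i.castSucc.castSucc i.castSucc.succ (Fin.last (m + 1)) =
          Fin.last (m + 1) :=
        Equiv.swap_apply_of_ne_of_ne (by simp [Fin.ext_iff]; omega) (by simp [Fin.ext_iff]; omega)
      have hinit : Fin.init (v ∘ Equiv.swap i.castSucc.castSucc i.castSucc.succ) =
          Fin.init v ∘ Equiv.swap i.castSucc i.succ := by
        ext k
        rw [Fin.succ_castSucc]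
        exact congrArg v ((Fin.castSucc_injective _).map_swap ..).symm
      rw [iteratedFDeriv_succ_apply_right (v ∘ _), iteratedFDeriv_succ_apply_right v, hinit,
        ih hf.fderiv i, Function.comp_apply, hlast]

theorem iteratedFDeriv_comp_perm {f : E → F} (hf : SmoothNear f x) {m : ℕ}
    (σ : Equiv.Perm (Fin m)) (v : Fin m → E) :
    iteratedFDeriv ℝ m f x (v ∘ σ) = iteratedFDeriv ℝ m f x v := by
  obtain _ | m := m
  · rw [Subsingleton.elim (v ∘ σ) v]
  have hσ : σ ∈ Submonoid.closure
      (Set.range fun i : Fin m => Equiv.swap i.castSucc i.succ) := by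
    rw [Equiv.Perm.mclosure_swap_castSucc_succ]
    trivial
  induction hσ using Submonoid.closure_induction generalizing v with
  | one => rfl
  | mul σ τ _ _ hσ hτ => rw [Equiv.Perm.coe_mul, ← Function.comp_assoc, hτ, hσ]
  | mem σ hσ =>
    obtain ⟨i, rfl⟩ := hσ
    exact hf.iteratedFDeriv_comp_swap i v

end Symmetry

end SmoothNear

end Smooth

/-! ### Jets -/

section Jets

variable {E F G : Type*} [NormedAddCommGroup E] [NormedSpace ℝ E]
  [NormedAddCommGroup F] [NormedSpace ℝ F] [NormedAddCommGroup G] [NormedSpace ℝ G]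
  {l : ℕ} {x : E}

/-- `f` and `g` have the same `l`-jet at `x`: their derivatives of order `≤ l` at `x` agree. -/
def JetEq (l : ℕ) (f g : E → F) (x : E) : Prop :=
  ∀ m ≤ l, iteratedFDeriv ℝ m f x = iteratedFDeriv ℝ m g x

namespace JetEq

protected theorem refl (l : ℕ) (f : E → F) (x : E) : JetEq l f f x := fun _ _ => rfl

protected theorem symm {f g : E → F} (h : JetEq l f g x) : JetEq l g f x :=
  fun m hm => (h m hm).symm

protected theorem trans {f g h : E → F} (hfg : JetEq l f g x) (hgh : JetEq l g h x) :
    JetEq l f h x :=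
  fun m hm => (hfg m hm).trans (hgh m hm)

theorem mono {l' : ℕ} {f g : E → F} (h : JetEq l f g x) (hl : l' ≤ l) : JetEq l' f g x :=
  fun m hm => h m (hm.trans hl)

theorem of_eventuallyEq {f g : E → F} (h : f =ᶠ[𝓝 x] g) : JetEq l f g x :=
  fun m _ => (h.iteratedFDeriv ℝ m).eq_of_nhds

theorem eq {f g : E → F} (h : JetEq l f g x) : f x = g x := by
  simpa using DFunLike.congr_fun (h 0 (Nat.zero_le l)) 0

protected theorem fderiv {f g : E → F} (h : JetEq (l + 1) f g x) :
    JetEq l (fderiv ℝ f) (fderiv ℝ g) x := by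
  intro m hm
  have hsucc := h (m + 1) (Nat.succ_le_succ hm)
  simp only [iteratedFDeriv_succ_eq_comp_right, Function.comp_apply] at hsucc
  exact (continuousMultilinearCurryRightEquiv' ℝ m E F).symm.injective hsucc

theorem fderiv_eq {f g : E → F} (h : JetEq (l + 1) f g x) : fderiv ℝ f x = fderiv ℝ g x :=
  h.fderiv.eq

/-- By Faà di Bruno's formula, the jet of a composition depends only on the jets of its factors. -/
theorem comp {g g' : F → G} {f f' : E → F} {y : F} (hgg' : JetEq l g g' y)
    (hff' : JetEq l f f' x) (hg : SmoothNear g y) (hg' : SmoothNear g' y) (hf : SmoothNear f x)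
    (hf' : SmoothNear f' x) (hy : f x = y) :
    JetEq l (fun z => g (f z)) (fun z => g' (f' z)) x := by
  subst hy
  intro m hm
  have faaDiBruno := iteratedFDeriv_comp (hg.contDiffAt_natCast m) (hf.contDiffAt_natCast m) le_rfl
  have faaDiBruno' := iteratedFDeriv_comp (by simpa only [← hff'.eq] using hg'.contDiffAt_natCast m)
    (hf'.contDiffAt_natCast m) le_rfl
  refine faaDiBruno.trans (Eq.trans ?_ faaDiBruno'.symm)
  refine Finset.sum_congr rfl fun c _ => ?_
  ext v
  simp only [FormalMultilinearSeries.compAlongOrderedFinpartition_apply, ftaylorSeries,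
    ← hff'.eq, hgg' c.length (c.length_le.trans hm)]
  congr 1
  ext i
  simp only [OrderedFinpartition.applyOrderedFinpartition_apply,
    hff' (c.partSize i) ((c.partSize_le i).trans hm)]

theorem clm {f f' : E → F} (L : F →L[ℝ] G) (h : JetEq l f f' x)
    (hf : SmoothNear f x) (hf' : SmoothNear f' x) :
    JetEq l (fun z => L (f z)) (fun z => L (f' z)) x :=
  (JetEq.refl l L _).comp h (smoothNear_of_contDiff L.contDiff _)
    (smoothNear_of_contDiff L.contDiff _) hf hf' rfl

theorem prodMk {f f' : E → F} {g g' : E → G} (hff' : JetEq l f f' x)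
    (hgg' : JetEq l g g' x) (hf : SmoothNear f x) (hf' : SmoothNear f' x) (hg : SmoothNear g x)
    (hg' : SmoothNear g' x) : JetEq l (fun z => (f z, g z)) (fun z => (f' z, g' z)) x := by
  intro m hm
  rw [iteratedFDeriv_prodMk (hf.contDiffAt_natCast m) (hg.contDiffAt_natCast m) le_rfl,
    iteratedFDeriv_prodMk (hf'.contDiffAt_natCast m) (hg'.contDiffAt_natCast m) le_rfl,
    hff' m hm, hgg' m hm]

/-- Replacing `K` by `K'` in `g' = g ∘ K ∘ g'` turns `g'` into `g`. -/
theorem inverse {K K' : E → F} {g g' : F → E} {y : F} (h : JetEq l K K' x)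
    (hK : SmoothNear K x) (hK' : SmoothNear K' x) (hg : SmoothNear g y) (hg' : SmoothNear g' y)
    (hKx : K x = y) (hgy' : g' y = x) (hgK : ∀ᶠ z in 𝓝 x, g (K z) = z)
    (hKg' : ∀ᶠ w in 𝓝 y, K' (g' w) = w) : JetEq l g g' y := by
  have hcomp : JetEq l (fun w => g (K (g' w))) (fun w => g (K' (g' w))) y := by
    refine ((JetEq.refl l g _).comp h hg hg hK hK' hKx).comp (JetEq.refl l g' y)
      (hg.comp_of_eq hK hKx) (hg.comp_of_eq hK' (h.eq.symm.trans hKx)) hg' hg' hgy'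
  have hleft : (fun w => g (K (g' w))) =ᶠ[𝓝 y] g' := (hg'.tendsto hgy').eventually hgK
  have hright : (fun w => g (K' (g' w))) =ᶠ[𝓝 y] g := hKg'.mono fun w hw => congrArg g hw
  exact ((of_eventuallyEq hleft).symm.trans (hcomp.trans (of_eventuallyEq hright))).symm

end JetEq

end Jets

/-! ### Inverse functions -/

section Inverse

variable {E F Θ : Type*} [NormedAddCommGroup E] [NormedSpace ℝ E]
  [NormedAddCommGroup F] [NormedSpace ℝ F] [NormedAddCommGroup Θ] [NormedSpace ℝ Θ]

theorem fderiv_apply_fderiv_of_rightInverse {K : E → F} {g : F → E} {y : F}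
    (hK : DifferentiableAt ℝ K (g y)) (hg : DifferentiableAt ℝ g y)
    (h : ∀ᶠ w in 𝓝 y, K (g w) = w) (u : F) : fderiv ℝ K (g y) (fderiv ℝ g y u) = u := by
  have hcomp : fderiv ℝ (K ∘ g) y = fderiv ℝ id y := EventuallyEq.fderiv_eq h
  rw [fderiv_comp y hK hg, fderiv_id] at hcomp
  exact DFunLike.congr_fun hcomp u

theorem bijective_fst_prod {L : Θ × E →L[ℝ] F}
    (h : Function.Bijective (L ∘L ContinuousLinearMap.inr ℝ Θ E)) :
    Function.Bijective ((ContinuousLinearMap.fst ℝ Θ E).prod L) := by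
  constructor
  · rw [injective_iff_map_eq_zero]
    rintro ⟨a, b⟩ hab
    obtain ⟨rfl, hb⟩ : a = 0 ∧ L (a, b) = 0 := Prod.mk.inj hab
    rw [(injective_iff_map_eq_zero _).1 h.1 b hb, Prod.mk_zero_zero]
  · rintro ⟨a, c⟩
    obtain ⟨b, hb⟩ := h.2 (c - L (a, 0))
    refine ⟨(a, b), Prod.ext rfl ?_⟩
    calc L (a, b) = L (a, 0) + L (0, b) := by rw [← map_add, Prod.mk_add_mk, add_zero, zero_add]
      _ = c := by rw [show L (0, b) = c - L (a, 0) from hb, add_sub_cancel]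

variable [CompleteSpace E] [CompleteSpace F]

theorem exists_equiv_of_bijective {L : E →L[ℝ] F} (h : Function.Bijective L) :
    ∃ e : E ≃L[ℝ] F, (e : E →L[ℝ] F) = L :=
  ⟨ContinuousLinearEquiv.ofBijective L (LinearMap.ker_eq_bot.2 h.1) (LinearMap.range_eq_top.2 h.2),
    ContinuousLinearEquiv.coe_ofBijective _ _ _⟩

theorem eventually_bijective {X : Type*} [TopologicalSpace X] {L : X → E →L[ℝ] F} {x : X}
    (hL : ContinuousAt L x) (h : Function.Bijective (L x)) :
    ∀ᶠ y in 𝓝 x, Function.Bijective (L y) := by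
  obtain ⟨e, he⟩ := exists_equiv_of_bijective h
  filter_upwards [hL.eventually (he ▸ ContinuousLinearEquiv.nhds e)] with y ⟨e', he'⟩
  exact he' ▸ e'.bijective

theorem SmoothNear.exists_inverse {K : E → F} {x : E} {y : F} (hK : SmoothNear K x)
    (hKx : K x = y) (h : Function.Bijective (fderiv ℝ K x)) :
    ∃ g : F → E, SmoothNear g y ∧ g y = x ∧ (∀ᶠ z in 𝓝 x, g (K z) = z) ∧
      ∀ᶠ w in 𝓝 y, K (g w) = w := by
  subst hKx
  obtain ⟨e, he⟩ := exists_equiv_of_bijective h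
  have hd : HasFDerivAt K (e : E →L[ℝ] F) x := he ▸ hK.differentiableAt.hasFDerivAt
  let P := hK.contDiffAt.toOpenPartialHomeomorph K hd (by simp)
  have hx : x ∈ P.source := hK.contDiffAt.mem_toOpenPartialHomeomorph_source hd (by simp)
  have hy : K x ∈ P.target := P.map_source hx
  have hgx : P.symm (K x) = x := P.left_inv hx
  have hsymm : Tendsto P.symm (𝓝 (K x)) (𝓝 x) := by
    simpa only [ContinuousAt, hgx] using P.continuousAt_symm hy
  refine ⟨P.symm, ?_, hgx, ?_, ?_⟩
  · filter_upwards [P.open_target.mem_nhds hy, hsymm.eventually hK,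
      hsymm.eventually (eventually_bijective hK.fderiv.continuousAt h)] with y hy hsmooth hbij
    obtain ⟨e', he'⟩ := exists_equiv_of_bijective hbij
    refine P.contDiffAt_symm (f₀' := e') hy ?_ hsmooth
    rw [he']
    exact (hsmooth.differentiableAt (by simp)).hasFDerivAt
  · filter_upwards [P.open_source.mem_nhds hx] with z hz using P.left_inv hz
  · filter_upwards [P.open_target.mem_nhds hy] with y hy using P.right_inv hy

theorem SmoothNear.exists_inverse_param [CompleteSpace Θ] {K : Θ → E → F} {t : Θ} {x : E} {y : F}
    (hK : SmoothNear (Function.uncurry K) (t, x)) (hy : K t x = y)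
    (h : Function.Bijective (fderiv ℝ (K t) x)) :
    ∃ g : Θ → F → E, SmoothNear (Function.uncurry g) (t, y) ∧ g t y = x ∧
      (∀ᶠ p in 𝓝 (t, x), g p.1 (K p.1 p.2) = p.2) ∧
      ∀ᶠ p in 𝓝 (t, y), K p.1 (g p.1 p.2) = p.2 := by
  let X : Θ × E → Θ × F := fun p => (p.1, Function.uncurry K p)
  have hX' : fderiv ℝ X (t, x) = (ContinuousLinearMap.fst ℝ Θ E).prod
      (fderiv ℝ (Function.uncurry K) (t, x)) :=
    (hasFDerivAt_fst.prodMk hK.differentiableAt.hasFDerivAt).fderiv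
  have hpartial : fderiv ℝ (K t) x =
      fderiv ℝ (Function.uncurry K) (t, x) ∘L ContinuousLinearMap.inr ℝ Θ E :=
    (hK.differentiableAt.hasFDerivAt.comp x (hasFDerivAt_prodMk_right t x)).fderiv
  have hbij : Function.Bijective (fderiv ℝ X (t, x)) := by
    rw [hX']
    exact bijective_fst_prod (hpartial ▸ h)
  obtain ⟨g, hg, hgx, hgX, hXg⟩ := SmoothNear.exists_inverse (K := X) (smoothNear_id.fst.prodMk hK)
    (show X (t, x) = (t, y) from congrArg (Prod.mk t) hy) hbij
  refine ⟨fun s w => (g (s, w)).2, hg.snd, congrArg Prod.snd hgx, ?_, ?_⟩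
  · exact hgX.mono fun p hp => congrArg Prod.snd hp
  · filter_upwards [hXg] with p hp
    have hfst : (g p).1 = p.1 := congrArg Prod.fst hp
    have hsnd : K (g p).1 (g p).2 = p.2 := congrArg Prod.snd hp
    rwa [hfst] at hsnd

end Inverse

/-! ### Spaces of jets and Taylor polynomials -/

section Taylor

variable {E F Θ : Type*} [NormedAddCommGroup E] [NormedSpace ℝ E]
  [NormedAddCommGroup F] [NormedSpace ℝ F] [NormedAddCommGroup Θ] [NormedSpace ℝ Θ] {n : ℕ}

/-- The space of `n`-jets at `0` of maps `E → F`; `JetSpace` is the case `E = F = T*ℝ³`. -/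
abbrev Jets (n : ℕ) (E F : Type*) [NormedAddCommGroup E] [NormedSpace ℝ E]
    [NormedAddCommGroup F] [NormedSpace ℝ F] : Type _ :=
  ∀ m : Fin (n + 1), ContinuousMultilinearMap ℝ (fun _ : Fin (m : ℕ) => E) F

/-- The `n`-jet of `f` at `0`, given by the derivatives of order `≤ n`. -/
def jets (n : ℕ) (f : E → F) : Jets n E F := fun m => iteratedFDeriv ℝ (m : ℕ) f 0

theorem jets_eq_iff {f g : E → F} : jets n f = jets n g ↔ JetEq n f g 0 :=
  ⟨fun h m hm => congrFun h ⟨m, Nat.lt_succ_of_le hm⟩,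
    fun h => funext fun m => h m (Nat.le_of_lt_succ m.2)⟩

theorem jets_add {f g : E → F} (hf : SmoothNear f 0) (hg : SmoothNear g 0) :
    jets n (fun z => f z + g z) = jets n f + jets n g :=
  funext fun m =>
    iteratedFDeriv_add_apply (hf.contDiffAt_natCast m) (hg.contDiffAt_natCast m)

theorem jets_smul {f : E → F} (c : ℝ) (hf : SmoothNear f 0) :
    jets n (fun z => c • f z) = c • jets n f :=
  funext fun m => iteratedFDeriv_const_smul_apply (hf.contDiffAt_natCast m)

/-- The Taylor polynomial at `0` with the given derivatives at `0`. -/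
def taylorPoly (p : Jets n E F) (z : E) : F :=
  ∑ m : Fin (n + 1), ((m : ℕ).factorial : ℝ)⁻¹ • p m fun _ => z

theorem contDiff_taylorPoly :
    ContDiff ℝ ∞ (Function.uncurry (taylorPoly : Jets n E F → E → F)) := by
  unfold Function.uncurry taylorPoly
  refine ContDiff.sum fun m _ => contDiff_const.smul ?_
  have heval : ContDiff ℝ ∞ fun q : (E [×m]→L[ℝ] F) × (Fin m → E) => q.1 q.2 :=
    contDiffOn_univ.1 <| ((ContinuousLinearMap.id ℝ
      (E [×m]→L[ℝ] F)).analyticOnNhd_uncurry_of_multilinear).contDiffOn uniqueDiffOn_univ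
  have hcoord : ContDiff ℝ ∞ fun p : Jets n E F => p m := contDiff_pi.1 contDiff_id m
  exact heval.comp (f := fun q : Jets n E F × E => (q.1 m, fun _ : Fin m => q.2))
    ((hcoord.comp contDiff_fst).prodMk (by fun_prop))

theorem smoothNear_taylorPoly (p : Jets n E F) (z : E) : SmoothNear (taylorPoly p) z :=
  smoothNear_of_contDiff (contDiff_taylorPoly.comp (contDiff_const.prodMk contDiff_id)) z

section TaylorJet

universe u

variable {E F : Type u} [NormedAddCommGroup E] [NormedSpace ℝ E] [NormedAddCommGroup F]
  [NormedSpace ℝ F]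

theorem jetEq_taylorPoly [CompleteSpace F] {f : E → F} (hf : SmoothNear f 0) :
    JetEq n (taylorPoly (jets n f)) f 0 := by
  intro k hk
  let P : FormalMultilinearSeries ℝ E F := fun m =>
    if m < n + 1 then ((m : ℕ).factorial : ℝ)⁻¹ • iteratedFDeriv ℝ m f 0 else 0
  have hP : HasFiniteFPowerSeriesOnBall (taylorPoly (jets n f)) P 0 (n + 1) ⊤ := by
    refine HasFiniteFPowerSeriesOnBall.mk' (fun m hm => if_neg (by omega)) ENNReal.zero_lt_top ?_
    intro y _
    rw [zero_add, taylorPoly, Finset.sum_range]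
    refine Finset.sum_congr rfl fun m _ => ?_
    simp only [P, m.2, if_true]
    rfl
  have hanalytic : AnalyticOn ℝ (taylorPoly (jets n f)) Set.univ := fun z _ =>
    (hP.toHasFPowerSeriesOnBall.analyticOnNhd z (by simp)).analyticWithinAt
  ext v
  have hperm : ∀ σ : Equiv.Perm (Fin k), P k (fun i => v (σ i)) =
      (k.factorial : ℝ)⁻¹ • iteratedFDeriv ℝ k f 0 v := by
    intro σ
    rw [← hf.iteratedFDeriv_comp_perm σ v]
    simp only [P, if_pos (Nat.lt_succ_of_le hk)]
    rfl
  calc iteratedFDeriv ℝ k (taylorPoly (jets n f)) 0 v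
      = ∑ σ : Equiv.Perm (Fin k), P k fun i => v (σ i) :=
        hP.toHasFPowerSeriesOnBall.iteratedFDeriv_eq_sum hanalytic v
    _ = iteratedFDeriv ℝ k f 0 v := by
        rw [Finset.sum_congr rfl fun σ _ => hperm σ, Finset.sum_const, Finset.card_univ,
          Fintype.card_perm, Fintype.card_fin, ← Nat.cast_smul_eq_nsmul ℝ, smul_smul,
          mul_inv_cancel₀ (by positivity), one_smul]

end TaylorJet

theorem smoothNear_jets {E F : Type u} [NormedAddCommGroup E] [NormedSpace ℝ E]
    [NormedAddCommGroup F] [NormedSpace ℝ F] {G : Θ → E → F} {t : Θ}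
    (h : SmoothNear (Function.uncurry G) (t, 0)) : SmoothNear (fun s => jets n (G s)) t := by
  have hjet (m : Fin (n + 1)) :
      ∀ᶠ s in 𝓝 t, ContDiffAt ℝ ∞ (fun s => iteratedFDeriv ℝ (m : ℕ) (G s) 0) s :=
    h.iteratedFDeriv_apply m
  filter_upwards [eventually_all.2 hjet] with s hs
  exact contDiffAt_pi.2 hs

end Taylor

/-! ### Spaces of jets of potentials -/

section Potential

variable {n : ℕ}

/-- The space of `n`-jets of functions on `T*ℝ³` that vanish to second order at `0`. -/
def potentialJets (n : ℕ) : Submodule ℝ (Jets n Cot ℝ) where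
  carrier := {p | ∃ A : Cot → ℝ, SmoothNear A 0 ∧ A 0 = 0 ∧ fderiv ℝ A 0 = 0 ∧ jets n A = p}
  zero_mem' := by
    refine ⟨fun _ => 0, smoothNear_const 0, rfl, by simp, ?_⟩
    simpa using jets_smul (n := n) (0 : ℝ) (smoothNear_const (0 : ℝ) (x := (0 : Cot)))
  add_mem' := by
    rintro _ _ ⟨A, hA, hA0, hA1, rfl⟩ ⟨B, hB, hB0, hB1, rfl⟩
    refine ⟨fun z => A z + B z, hA.add hB, by simp [hA0, hB0], ?_, jets_add hA hB⟩
    rw [fderiv_fun_add hA.differentiableAt hB.differentiableAt, hA1, hB1, add_zero]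
  smul_mem' := by
    rintro c _ ⟨A, hA, hA0, hA1, rfl⟩
    refine ⟨fun z => c • A z, (smoothNear_const c).mul hA, by simp [hA0], ?_, jets_smul c hA⟩
    rw [fderiv_fun_const_smul hA.differentiableAt, hA1, smul_zero]

/-- The polynomial with given Taylor data in `potentialJets`. -/
def potential (θ : potentialJets n) : Cot → ℝ := taylorPoly (θ : Jets n Cot ℝ)

instance finiteDimensional_jets {E F : Type*} [NormedAddCommGroup E] [NormedSpace ℝ E]
    [FiniteDimensional ℝ E] [NormedAddCommGroup F] [NormedSpace ℝ F] [FiniteDimensional ℝ F] :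
    FiniteDimensional ℝ (Jets n E F) :=
  haveI (m : Fin (n + 1)) :
      Module.Finite ℝ (ContinuousMultilinearMap ℝ (fun _ : Fin (m : ℕ) => E) F) :=
    Module.Finite.of_injective ContinuousMultilinearMap.toMultilinearMapLinear
      ContinuousMultilinearMap.toMultilinearMap_injective
  Module.Finite.pi

instance completeSpace_jetSpace : CompleteSpace (JetSpace n) :=
  haveI : FiniteDimensional ℝ (JetSpace n) := finiteDimensional_jets (E := Cot) (F := Cot)
  FiniteDimensional.complete ℝ _

instance finiteDimensional_potentialJets : FiniteDimensional ℝ (potentialJets n) :=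
  FiniteDimensional.finiteDimensional_submodule _

instance completeSpace_potentialJets : CompleteSpace (potentialJets n) :=
  FiniteDimensional.complete ℝ _

theorem jets_potential (θ : potentialJets n) : jets n (potential θ) = θ := by
  obtain ⟨A, hA, _, _, hAθ⟩ := θ.2
  rw [potential, ← hAθ]
  exact jets_eq_iff.2 (jetEq_taylorPoly hA)

theorem smoothNear_uncurry_potential (p : potentialJets n × Cot) :
    SmoothNear (Function.uncurry (potential : potentialJets n → Cot → ℝ)) p := by
  have hsubtype : ContDiff ℝ ∞ (fun θ : potentialJets n => (θ : Jets n Cot ℝ)) :=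
    ContinuousLinearMap.contDiff (𝕜 := ℝ) (E := potentialJets n) (F := Jets n Cot ℝ)
      (potentialJets n).subtypeL
  exact smoothNear_of_contDiff
    (contDiff_taylorPoly.comp ((hsubtype.comp contDiff_fst).prodMk contDiff_snd)) p

theorem smoothNear_potential (θ : potentialJets n) (z : Cot) : SmoothNear (potential θ) z :=
  smoothNear_taylorPoly _ z

theorem potential_zero (θ : potentialJets n) : potential θ 0 = 0 := by
  obtain ⟨A, hA, hA0, _, hAθ⟩ := θ.2
  rw [potential, ← hAθ, (jetEq_taylorPoly hA).eq, hA0]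

theorem fderiv_potential_zero (hn : 1 ≤ n) (θ : potentialJets n) :
    fderiv ℝ (potential θ) 0 = 0 := by
  obtain ⟨A, hA, _, hA1, hAθ⟩ := θ.2
  rw [potential, ← hAθ, ((jetEq_taylorPoly hA).mono hn).fderiv_eq (l := 0), hA1]

end Potential

/-! ### Symplectic germs -/

section Symplectic

theorem omega_nondegenerate {u : Cot} (h : ∀ v, omega u v = 0) : u = 0 := by
  refine Prod.ext (funext fun i => ?_) (funext fun i => ?_)
  · simpa [omega, Pi.single_apply] using h (0, Pi.single i 1)
  · simpa [omega, Pi.single_apply] using h (Pi.single i 1, 0)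

theorem bijective_of_omega_eq {L : Cot →L[ℝ] Cot} (h : ∀ u v, omega (L u) (L v) = omega u v) :
    Function.Bijective L := by
  have hinj : Function.Injective L := by
    rw [injective_iff_map_eq_zero]
    intro u hu
    refine omega_nondegenerate fun v => ?_
    rw [← h, hu]
    simp [omega]
  exact ⟨hinj, (LinearMap.injective_iff_surjective (f := (L : Cot →ₗ[ℝ] Cot))).1 hinj⟩

namespace IsSymplecticGerm

variable {S T : Cot → Cot}

theorem smooth (hS : IsSymplecticGerm S) : SmoothNear S 0 := hS.2.1

theorem zero (hS : IsSymplecticGerm S) : S 0 = 0 := hS.1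

theorem tendsto (hS : IsSymplecticGerm S) : Tendsto S (𝓝 0) (𝓝 0) := hS.smooth.tendsto hS.zero

theorem bijective (hS : IsSymplecticGerm S) : Function.Bijective (fderiv ℝ S 0) :=
  bijective_of_omega_eq hS.2.2.self_of_nhds

theorem comp (hS : IsSymplecticGerm S) (hT : IsSymplecticGerm T) :
    IsSymplecticGerm (fun z => S (T z)) := by
  refine ⟨by simp only [hT.zero, hS.zero], hS.smooth.comp_of_eq hT.smooth hT.zero, ?_⟩
  filter_upwards [hT.2.2, hT.tendsto.eventually hS.2.2, hT.smooth.eventually_differentiableAt,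
    hT.tendsto.eventually hS.smooth.eventually_differentiableAt] with z hTz hSz hdT hdS u v
  rw [show fderiv ℝ (fun z => S (T z)) z = fderiv ℝ S (T z) ∘L fderiv ℝ T z from
    fderiv_comp z hdS hdT]
  simp only [ContinuousLinearMap.comp_apply, hTz, hSz]

theorem exists_inverse (hS : IsSymplecticGerm S) :
    ∃ T, IsSymplecticGerm T ∧ (∀ᶠ z in 𝓝 0, T (S z) = z) ∧ ∀ᶠ z in 𝓝 0, S (T z) = z := by
  obtain ⟨T, hT, hT0, hTS, hST⟩ := hS.smooth.exists_inverse hS.zero hS.bijective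
  refine ⟨T, ⟨hT0, hT, ?_⟩, hTS, hST⟩
  filter_upwards [hST.eventually_nhds, hT.eventually_differentiableAt,
    (hT.tendsto hT0).eventually hS.smooth.eventually_differentiableAt,
    (hT.tendsto hT0).eventually hS.2.2] with z hSTz hdT hdS homega u v
  rw [← homega, fderiv_apply_fderiv_of_rightInverse hdS hdT hSTz,
    fderiv_apply_fderiv_of_rightInverse hdS hdT hSTz]

end IsSymplecticGerm

end Symplectic

/-! ### Generating functions -/

section Generating

/-- The components of a linear functional on `T*ℝ³`. -/
def grad : (Cot →L[ℝ] ℝ) →L[ℝ] Cot :=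
  (ContinuousLinearMap.pi fun i : Fin 3 =>
      ContinuousLinearMap.apply ℝ ℝ ((Pi.single i 1, 0) : Cot)).prod
    (ContinuousLinearMap.pi fun i : Fin 3 =>
      ContinuousLinearMap.apply ℝ ℝ ((0, Pi.single i 1) : Cot))

theorem grad_fst (ℓ : Cot →L[ℝ] ℝ) (i : Fin 3) : (grad ℓ).1 i = ℓ (Pi.single i 1, 0) := rfl

theorem grad_snd (ℓ : Cot →L[ℝ] ℝ) (i : Fin 3) : (grad ℓ).2 i = ℓ (0, Pi.single i 1) := rfl

theorem apply_eq_grad (ℓ : Cot →L[ℝ] ℝ) (v : Cot) :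
    ℓ v = ∑ i, ((grad ℓ).1 i * v.1 i + (grad ℓ).2 i * v.2 i) := by
  have hv : v = ∑ i : Fin 3, (v.1 i • ((Pi.single i 1, 0) : Cot) +
      v.2 i • ((0, Pi.single i 1) : Cot)) := by
    refine Prod.ext (funext fun j => ?_) (funext fun j => ?_) <;>
      fin_cases j <;> simp [Fin.sum_univ_three]
  conv_lhs => rw [hv]
  simp only [map_sum, map_add, map_smul, smul_eq_mul, grad_fst, grad_snd]
  exact Finset.sum_congr rfl fun i _ => by ring

theorem grad_injective : Function.Injective grad := fun a b h =>
  ContinuousLinearMap.ext fun v => by rw [apply_eq_grad a, apply_eq_grad b, h]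

theorem grad_surjective : Function.Surjective grad := by
  have hfinrank : Module.finrank ℝ (Cot →L[ℝ] ℝ) = Module.finrank ℝ Cot := by
    rw [← (LinearMap.toContinuousLinearMap (𝕜 := ℝ) (E := Cot) (F' := ℝ)).finrank_eq]
    exact Subspace.dual_finrank_eq
  exact (LinearMap.injective_iff_surjective_of_finrank_eq_finrank hfinrank
    (f := (grad : (Cot →L[ℝ] ℝ) →ₗ[ℝ] Cot))).1 grad_injective

/-- The identification of linear functionals on `T*ℝ³` with their components. -/
def gradEquiv : (Cot →L[ℝ] ℝ) ≃L[ℝ] Cot :=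
  ContinuousLinearEquiv.ofBijective grad (LinearMap.ker_eq_bot.2 grad_injective)
    (LinearMap.range_eq_top.2 grad_surjective)

theorem grad_symm (c : Cot) : grad (gradEquiv.symm c) = c := gradEquiv.apply_symm_apply c

/-- The map `(q, Q) ↦ (q, -∂A/∂q)`. -/
def initialPoint (A : Cot → ℝ) (w : Cot) : Cot := (w.1, -(grad (fderiv ℝ A w)).1)

/-- The map `(q, Q) ↦ (Q, ∂A/∂Q)`. -/
def finalPoint (A : Cot → ℝ) (w : Cot) : Cot := (w.2, (grad (fderiv ℝ A w)).2)

/-- `A(q, Q)` vanishes to second order at `0` and its mixed Hessian `∂²A/∂q∂Q` at `0` is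
invertible, so that `A` generates a symplectic germ. -/
structure IsPotential (A : Cot → ℝ) : Prop where
  smooth : SmoothNear A 0
  zero : A 0 = 0
  fderiv_zero : fderiv ℝ A 0 = 0
  bijective : Function.Bijective (fderiv ℝ (initialPoint A) 0)

/-- `A(q, Q)` is a generating function of `S : (q, p) ↦ (Q, P)`: `p = -∂A/∂q`, `P = ∂A/∂Q`. -/
def IsGen (A : Cot → ℝ) (S : Cot → Cot) : Prop :=
  ∀ᶠ w in 𝓝 0, S (initialPoint A w) = finalPoint A w

/-- The map `(q, p) ↦ (q, Q)`. It is a local diffeomorphism exactly when `S` has a generating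
function `A(q, Q)`. -/
def mixedPoint (S : Cot → Cot) (z : Cot) : Cot := (z.1, (S z).1)

variable {A : Cot → ℝ} {S ψ : Cot → Cot} {w : Cot}

@[fun_prop]
theorem smoothNear_initialPoint (hA : SmoothNear A w) : SmoothNear (initialPoint A) w :=
  smoothNear_id.fst.prodMk (hA.fderiv.clm grad).fst.neg

@[fun_prop]
theorem smoothNear_finalPoint (hA : SmoothNear A w) : SmoothNear (finalPoint A) w :=
  smoothNear_id.snd.prodMk (hA.fderiv.clm grad).snd

@[fun_prop]
theorem smoothNear_mixedPoint (hS : SmoothNear S w) : SmoothNear (mixedPoint S) w :=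
  smoothNear_id.fst.prodMk hS.fst

theorem initialPoint_zero (h : fderiv ℝ A 0 = 0) : initialPoint A 0 = 0 := by
  simp [initialPoint, h]

theorem finalPoint_zero (h : fderiv ℝ A 0 = 0) : finalPoint A 0 = 0 := by
  simp [finalPoint, h]

theorem mixedPoint_zero (h : S 0 = 0) : mixedPoint S 0 = 0 := by
  simp [mixedPoint, h]

theorem hasFDerivAt_grad_fderiv (hA : SmoothNear A w) :
    HasFDerivAt (fun w => grad (fderiv ℝ A w)) (grad ∘L fderiv ℝ (fderiv ℝ A) w) w :=
  grad.hasFDerivAt.comp w hA.fderiv.differentiableAt.hasFDerivAt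

theorem fderiv_initialPoint (hA : SmoothNear A w) (u : Cot) :
    fderiv ℝ (initialPoint A) w u = (u.1, -(grad (fderiv ℝ (fderiv ℝ A) w u)).1) := by
  have h := (hasFDerivAt_fst (𝕜 := ℝ) (p := w)).prodMk (hasFDerivAt_grad_fderiv hA).fst.neg
  rw [show fderiv ℝ (initialPoint A) w = _ from h.fderiv]
  rfl

theorem fderiv_finalPoint (hA : SmoothNear A w) (u : Cot) :
    fderiv ℝ (finalPoint A) w u = (u.2, (grad (fderiv ℝ (fderiv ℝ A) w u)).2) := by
  have h := (hasFDerivAt_snd (𝕜 := ℝ) (p := w)).prodMk (hasFDerivAt_grad_fderiv hA).snd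
  rw [show fderiv ℝ (finalPoint A) w = _ from h.fderiv]
  rfl

/-- The two pullbacks of `omega` differ by the antisymmetrised second derivative of `A`. -/
theorem omega_fderiv_finalPoint (hA : SmoothNear A w) (u v : Cot) :
    omega (fderiv ℝ (finalPoint A) w u) (fderiv ℝ (finalPoint A) w v) =
      omega (fderiv ℝ (initialPoint A) w u) (fderiv ℝ (initialPoint A) w v) := by
  have hsymm := hA.isSymmSndFDerivAt u v
  rw [apply_eq_grad _ v, apply_eq_grad _ u] at hsymm
  simp only [fderiv_initialPoint hA, fderiv_finalPoint hA, omega, Fin.sum_univ_three,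
    Pi.neg_apply] at hsymm ⊢
  linarith

namespace IsPotential

theorem tendsto_initialPoint (hA : IsPotential A) : Tendsto (initialPoint A) (𝓝 0) (𝓝 0) :=
  (smoothNear_initialPoint hA.smooth).tendsto (initialPoint_zero hA.fderiv_zero)

theorem exists_inverse (hA : IsPotential A) :
    ∃ κ : Cot → Cot, SmoothNear κ 0 ∧ κ 0 = 0 ∧ (∀ᶠ w in 𝓝 0, κ (initialPoint A w) = w) ∧
      ∀ᶠ z in 𝓝 0, initialPoint A (κ z) = z :=
  (smoothNear_initialPoint hA.smooth).exists_inverse (initialPoint_zero hA.fderiv_zero)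
    hA.bijective

theorem exists_isGen (hA : IsPotential A) : ∃ S, SmoothNear S 0 ∧ S 0 = 0 ∧ IsGen A S := by
  obtain ⟨κ, hκ, hκ0, hκA, -⟩ := hA.exists_inverse
  refine ⟨fun z => finalPoint A (κ z), (smoothNear_finalPoint hA.smooth).comp_of_eq hκ hκ0, ?_,
    hκA.mono fun w hw => congrArg (finalPoint A) hw⟩
  simp only [hκ0, finalPoint_zero hA.fderiv_zero]

end IsPotential

theorem IsGen.omega_fderiv_initialPoint (h : IsGen A S) (hA : IsPotential A)
    (hS : SmoothNear S 0) : ∀ᶠ w in 𝓝 0, ∀ u v, omega (fderiv ℝ S (initialPoint A w) u)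
      (fderiv ℝ S (initialPoint A w) v) = omega u v := by
  filter_upwards [hA.smooth.eventually, eventually_bijective
      (smoothNear_initialPoint hA.smooth).fderiv.continuousAt hA.bijective,
    hA.tendsto_initialPoint.eventually hS.eventually_differentiableAt,
    Eventually.eventually_nhds h] with w hAw hbij hdS hgen u v
  have hchain (u : Cot) : fderiv ℝ S (initialPoint A w) (fderiv ℝ (initialPoint A) w u) =
      fderiv ℝ (finalPoint A) w u := by
    rw [← ContinuousLinearMap.comp_apply,
      ← fderiv_comp w hdS (smoothNear_initialPoint hAw).differentiableAt]
    exact DFunLike.congr_fun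
      (show S ∘ initialPoint A =ᶠ[𝓝 w] finalPoint A from hgen).fderiv_eq u
  obtain ⟨u, rfl⟩ := hbij.2 u
  obtain ⟨v, rfl⟩ := hbij.2 v
  rw [hchain, hchain, omega_fderiv_finalPoint hAw]

theorem IsGen.isSymplecticGerm (h : IsGen A S) (hA : IsPotential A) (hS : SmoothNear S 0)
    (hS0 : S 0 = 0) : IsSymplecticGerm S := by
  obtain ⟨κ, hκ, hκ0, -, hAκ⟩ := hA.exists_inverse
  refine ⟨hS0, hS, ?_⟩
  filter_upwards [(hκ.tendsto hκ0).eventually (h.omega_fderiv_initialPoint hA hS), hAκ]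
    with z homega hz
  rwa [hz] at homega

theorem IsGen.mixedPoint_initialPoint (h : IsGen A S) :
    ∀ᶠ w in 𝓝 0, mixedPoint S (initialPoint A w) = w := by
  filter_upwards [h] with w hw
  simp only [mixedPoint, hw]
  rfl

/-- The one-form with components `(-p, P)` at `(q, Q)`, for a local inverse `ψ` of
`mixedPoint S`; it is the differential of the generating function of `S`. -/
def primitiveForm (S ψ : Cot → Cot) (w : Cot) : Cot →L[ℝ] ℝ :=
  gradEquiv.symm (-(ψ w).2, (S (ψ w)).2)

theorem smoothNear_primitiveForm (hS : SmoothNear S 0) (hψ : SmoothNear ψ 0) (hψ0 : ψ 0 = 0) :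
    SmoothNear (primitiveForm S ψ) 0 :=
  SmoothNear.clm gradEquiv.symm.toContinuousLinearMap
    (hψ.snd.neg.prodMk (hS.comp_of_eq hψ hψ0).snd)

theorem fderiv_primitiveForm_symm (hψ : DifferentiableAt ℝ ψ w)
    (hS : DifferentiableAt ℝ S (ψ w))
    (homega : ∀ u v, omega (fderiv ℝ S (ψ w) u) (fderiv ℝ S (ψ w) v) = omega u v)
    (hSψ : ∀ᶠ w in 𝓝 w, mixedPoint S (ψ w) = w) (u v : Cot) :
    fderiv ℝ (primitiveForm S ψ) w u v = fderiv ℝ (primitiveForm S ψ) w v u := by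
  have hT := hS.hasFDerivAt.comp w hψ.hasFDerivAt
  have hq (u : Cot) : (fderiv ℝ ψ w u).1 = u.1 := DFunLike.congr_fun
    ((hψ.hasFDerivAt.fst.congr_of_eventuallyEq
      (hSψ.mono fun w hw => (congrArg Prod.fst hw).symm)).unique hasFDerivAt_fst) u
  have hQ (u : Cot) : (fderiv ℝ S (ψ w) (fderiv ℝ ψ w u)).1 = u.2 := DFunLike.congr_fun
    ((hT.fst.congr_of_eventuallyEq
      (hSψ.mono fun w hw => (congrArg Prod.snd hw).symm)).unique hasFDerivAt_snd) u
  have hgrad (u : Cot) : grad (fderiv ℝ (primitiveForm S ψ) w u) =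
      (-(fderiv ℝ ψ w u).2, (fderiv ℝ S (ψ w) (fderiv ℝ ψ w u)).2) := by
    have h := (gradEquiv.symm.toContinuousLinearMap.hasFDerivAt).comp w
      (hψ.hasFDerivAt.snd.neg.prodMk hT.snd)
    rw [show fderiv ℝ (primitiveForm S ψ) w = _ from h.fderiv]
    exact grad_symm _
  have homega := homega (fderiv ℝ ψ w u) (fderiv ℝ ψ w v)
  rw [apply_eq_grad _ v, apply_eq_grad _ u, hgrad, hgrad]
  simp only [omega, hq, hQ, Fin.sum_univ_three, Pi.neg_apply] at homega ⊢
  linarith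

theorem SmoothNear.exists_primitive {E F : Type*} [NormedAddCommGroup E] [NormedSpace ℝ E]
    [NormedAddCommGroup F] [NormedSpace ℝ F] [CompleteSpace F] {α : E → E →L[ℝ] F} {x : E}
    (hα : SmoothNear α x) (hclosed : ∀ᶠ z in 𝓝 x, ∀ u v, fderiv ℝ α z u v = fderiv ℝ α z v u) :
    ∃ A : E → F, SmoothNear A x ∧ A x = 0 ∧ fderiv ℝ A =ᶠ[𝓝 x] α := by
  obtain ⟨ε, hε, hball⟩ := Metric.eventually_nhds_iff_ball.1 (hα.and hclosed)
  obtain ⟨f, hf⟩ := (convex_ball x ε).exists_forall_hasFDerivAt_of_fderiv_symmetric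
    Metric.isOpen_ball
    (fun z hz => ((hball z hz).1.differentiableAt (by simp)).differentiableWithinAt)
    fun z hz => (hball z hz).2
  have hA : ∀ z ∈ Metric.ball x ε, HasFDerivAt (fun z => f z - f x) (α z) z :=
    fun z hz => (hf z hz).sub_const _
  refine ⟨fun z => f z - f x, ?_, sub_self _, ?_⟩
  · filter_upwards [Metric.ball_mem_nhds x hε] with z hz
    refine contDiffAt_infty.2 fun n => ContDiffAt.of_le (n := ((n : ℕ) : ℕ∞ω) + 1) ?_ le_self_add
    rw [contDiffAt_succ_iff_hasFDerivAt]
    exact ⟨α, ⟨Metric.ball x ε, Metric.isOpen_ball.mem_nhds hz, hA⟩,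
      contDiffAt_infty.1 (hball z hz).1 n⟩
  · filter_upwards [Metric.ball_mem_nhds x hε] with z hz using (hA z hz).fderiv

theorem IsSymplecticGerm.exists_isGen (hS : IsSymplecticGerm S)
    (hb : Function.Bijective (fderiv ℝ (mixedPoint S) 0)) : ∃ A, IsPotential A ∧ IsGen A S := by
  obtain ⟨ψ, hψ, hψ0, -, hSψ⟩ :=
    (smoothNear_mixedPoint hS.smooth).exists_inverse (mixedPoint_zero hS.zero) hb
  have hclosed : ∀ᶠ w in 𝓝 0, ∀ u v, fderiv ℝ (primitiveForm S ψ) w u v =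
      fderiv ℝ (primitiveForm S ψ) w v u := by
    filter_upwards [hSψ.eventually_nhds, hψ.eventually_differentiableAt,
      (hψ.tendsto hψ0).eventually hS.2.2,
      (hψ.tendsto hψ0).eventually hS.smooth.eventually_differentiableAt] with w hinv hdψ homega hdS
    exact fderiv_primitiveForm_symm hdψ hdS homega hinv
  obtain ⟨A, hA, hA0, hdA⟩ :=
    (smoothNear_primitiveForm hS.smooth hψ hψ0).exists_primitive hclosed
  have hAψ : initialPoint A =ᶠ[𝓝 0] ψ := by
    filter_upwards [hdA, hSψ] with w hdAw hw
    rw [initialPoint, hdAw, primitiveForm, grad_symm, neg_neg]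
    exact Prod.ext (congrArg Prod.fst hw).symm rfl
  refine ⟨A, ⟨hA, hA0, ?_, ?_⟩, ?_⟩
  · rw [hdA.self_of_nhds, primitiveForm, hψ0, hS.zero, Prod.snd_zero, neg_zero,
      Prod.mk_zero_zero, map_zero]
  · have hinj : Function.Injective (fderiv ℝ ψ 0) :=
      Function.LeftInverse.injective (g := fderiv ℝ (mixedPoint S) (ψ 0)) fun u =>
        fderiv_apply_fderiv_of_rightInverse
          (by rw [hψ0]; exact (smoothNear_mixedPoint hS.smooth).differentiableAt)
          hψ.differentiableAt hSψ u
    rw [hAψ.fderiv_eq]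
    exact ⟨hinj, (LinearMap.injective_iff_surjective
      (f := (fderiv ℝ ψ 0 : Cot →ₗ[ℝ] Cot))).1 hinj⟩
  · filter_upwards [hdA, hSψ, hAψ] with w hdAw hw hAw
    rw [hAw, finalPoint, hdAw, primitiveForm, grad_symm]
    exact Prod.ext (congrArg Prod.snd hw) rfl

end Generating

/-! ### Jets of generating functions -/

section GeneratingJets

variable {l n : ℕ} {A A' : Cot → ℝ} {S S' : Cot → Cot}

namespace JetEq

protected theorem initialPoint (h : JetEq (l + 1) A A' 0) (hA : SmoothNear A 0)
    (hA' : SmoothNear A' 0) : JetEq l (initialPoint A) (initialPoint A') 0 :=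
  (JetEq.refl l (fun w : Cot => w.1) 0).prodMk
    (h.fderiv.clm (-(ContinuousLinearMap.fst ℝ _ _).comp grad) hA.fderiv hA'.fderiv)
    smoothNear_id.fst smoothNear_id.fst (hA.fderiv.clm grad).fst.neg (hA'.fderiv.clm grad).fst.neg

protected theorem finalPoint (h : JetEq (l + 1) A A' 0) (hA : SmoothNear A 0)
    (hA' : SmoothNear A' 0) : JetEq l (finalPoint A) (finalPoint A') 0 :=
  (JetEq.refl l (fun w : Cot => w.2) 0).prodMk
    (h.fderiv.clm ((ContinuousLinearMap.snd ℝ _ _).comp grad) hA.fderiv hA'.fderiv)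
    smoothNear_id.snd smoothNear_id.snd (hA.fderiv.clm grad).snd (hA'.fderiv.clm grad).snd

protected theorem mixedPoint (h : JetEq l S S' 0) (hS : SmoothNear S 0) (hS' : SmoothNear S' 0) :
    JetEq l (mixedPoint S) (mixedPoint S') 0 :=
  (JetEq.refl l (fun w : Cot => w.1) 0).prodMk (h.clm (ContinuousLinearMap.fst ℝ _ _) hS hS')
    smoothNear_id.fst smoothNear_id.fst hS.fst hS'.fst

end JetEq

namespace IsPotential

theorem of_jetEq (hA : IsPotential A) (h : JetEq 2 A A' 0) (hA' : SmoothNear A' 0) :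
    IsPotential A' := by
  refine ⟨hA', h.eq.symm.trans hA.zero, ?_, ?_⟩
  · rw [← (h.mono one_le_two).fderiv_eq (l := 0), hA.fderiv_zero]
  · rw [← (h.initialPoint hA.smooth hA').fderiv_eq (l := 0)]
    exact hA.bijective

/-- The `n`-jet of a potential. -/
def toJet (hA : IsPotential A) (n : ℕ) : potentialJets n :=
  ⟨jets n A, A, hA.smooth, hA.zero, hA.fderiv_zero, rfl⟩

theorem jetEq_potential (hA : IsPotential A) (n : ℕ) : JetEq n A (potential (hA.toJet n)) 0 :=
  jets_eq_iff.1 (jets_potential (hA.toJet n)).symm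

theorem isPotential_potential (hA : IsPotential A) (hn : 2 ≤ n) :
    IsPotential (potential (hA.toJet n)) :=
  hA.of_jetEq ((hA.jetEq_potential n).mono hn) (smoothNear_potential _ _)

end IsPotential

theorem IsGen.jetEq (hS : IsGen A S) (hS' : IsGen A' S') (hA : IsPotential A)
    (hA' : IsPotential A') (h : JetEq (l + 1) A A' 0) : JetEq l S S' 0 := by
  obtain ⟨κ, hκ, hκ0, hκA, hAκ⟩ := hA.exists_inverse
  obtain ⟨κ', hκ', hκ0', -, hAκ'⟩ := hA'.exists_inverse
  have hκκ' : JetEq l κ κ' 0 := (h.initialPoint hA.smooth hA'.smooth).inverse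
    (smoothNear_initialPoint hA.smooth) (smoothNear_initialPoint hA'.smooth) hκ hκ'
    (initialPoint_zero hA.fderiv_zero) hκ0' hκA hAκ'
  have hSκ : S =ᶠ[𝓝 0] fun z => finalPoint A (κ z) := by
    filter_upwards [(hκ.tendsto hκ0).eventually hS, hAκ] with z hz hz'
    rw [← hz, hz']
  have hSκ' : S' =ᶠ[𝓝 0] fun z => finalPoint A' (κ' z) := by
    filter_upwards [(hκ'.tendsto hκ0').eventually hS', hAκ'] with z hz hz'
    rw [← hz, hz']
  exact (JetEq.of_eventuallyEq hSκ).trans (((h.finalPoint hA.smooth hA'.smooth).comp hκκ'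
    (smoothNear_finalPoint hA.smooth) (smoothNear_finalPoint hA'.smooth) hκ hκ' hκ0).trans
    (JetEq.of_eventuallyEq hSκ').symm)

open Classical in
/-- The `l`-jet of the symplectic germ generated by a polynomial potential; the value at jets that
are not jets of potentials is irrelevant. -/
def genJet (l : ℕ) (θ : potentialJets (l + 1)) : JetSpace l :=
  if h : IsPotential (potential θ) then jet l h.exists_isGen.choose else 0

theorem genJet_eq {θ : potentialJets (l + 1)} (hθ : IsPotential (potential θ))
    (hA : IsPotential A) (hAθ : jets (l + 1) A = θ) (h : IsGen A S) : genJet l θ = jet l S := by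
  rw [genJet, dif_pos hθ]
  refine jets_eq_iff.2 (hθ.exists_isGen.choose_spec.2.2.jetEq h hθ hA (jets_eq_iff.1 ?_))
  rw [jets_potential, hAθ]

theorem genJet_toJet (hl : 1 ≤ l) (hA : IsPotential A) (h : IsGen A S) :
    genJet l (hA.toJet (l + 1)) = jet l S :=
  genJet_eq (hA.isPotential_potential (by omega)) hA rfl h

theorem smoothNear_uncurry_initialPoint (θ : potentialJets n) :
    SmoothNear (Function.uncurry fun (θ : potentialJets n) w => initialPoint (potential θ) w)
      (θ, 0) :=
  smoothNear_id.snd.fst.prodMk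
    ((smoothNear_uncurry_potential (θ, 0)).uncurry_fderiv.clm grad).fst.neg

theorem smoothNear_uncurry_finalPoint (θ : potentialJets n) :
    SmoothNear (Function.uncurry fun (θ : potentialJets n) w => finalPoint (potential θ) w)
      (θ, 0) :=
  smoothNear_id.snd.snd.prodMk
    ((smoothNear_uncurry_potential (θ, 0)).uncurry_fderiv.clm grad).snd

theorem eventually_isPotential {θ : potentialJets n}
    (hθ : IsPotential (potential θ)) (hn : 1 ≤ n) : ∀ᶠ s in 𝓝 θ, IsPotential (potential s) := by
  have hcont := (smoothNear_uncurry_initialPoint θ).uncurry_fderiv.apply_right.continuousAt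
  filter_upwards [eventually_bijective hcont hθ.bijective] with s hs
  exact ⟨smoothNear_potential s 0, potential_zero s, fderiv_potential_zero hn s, hs⟩

theorem exists_smooth_family {θ : potentialJets n}
    (hθ : IsPotential (potential θ)) (hn : 1 ≤ n) : ∃ S : potentialJets n → Cot → Cot,
      SmoothNear (Function.uncurry S) (θ, 0) ∧ ∀ᶠ s in 𝓝 θ,
        IsPotential (potential s) ∧ IsGen (potential s) (S s) ∧ IsSymplecticGerm (S s) := by
  have hzero (s : potentialJets n) : initialPoint (potential s) 0 = 0 :=
    initialPoint_zero (fderiv_potential_zero hn s)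
  obtain ⟨κ, hκ, hκ0, hκA, -⟩ :=
    (smoothNear_uncurry_initialPoint θ).exists_inverse_param (hzero θ) hθ.bijective
  have hS : SmoothNear (Function.uncurry fun s z => finalPoint (potential s) (κ s z)) (θ, 0) :=
    (smoothNear_uncurry_finalPoint θ).comp_of_eq (f := fun p : potentialJets n × Cot =>
      (p.1, Function.uncurry κ p)) (smoothNear_id.fst.prodMk hκ) (congrArg (Prod.mk θ) hκ0)
  refine ⟨fun s z => finalPoint (potential s) (κ s z), hS, ?_⟩
  filter_upwards [eventually_isPotential hθ hn, hκA.curry_nhds, hS.eventually_apply_left]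
    with s hs hκs hSs
  have hgen : IsGen (potential s) (fun z => finalPoint (potential s) (κ s z)) :=
    hκs.mono fun w hw => congrArg (finalPoint (potential s)) hw
  have hκs0 : κ s 0 = 0 := by simpa only [hzero] using hκs.self_of_nhds
  refine ⟨hs, hgen, hgen.isSymplecticGerm hs hSs ?_⟩
  simp only [hκs0, finalPoint_zero hs.fderiv_zero]

theorem smoothNear_genJet {θ : potentialJets (l + 1)} (hθ : IsPotential (potential θ)) :
    SmoothNear (genJet l) θ := by
  obtain ⟨S, hS, hfamily⟩ := exists_smooth_family hθ (by omega)
  refine (smoothNear_jets (n := l) hS).congr ?_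
  filter_upwards [hfamily] with s ⟨hs, hgen, _⟩
  exact genJet_eq hs hs (jets_potential s) hgen

section PrimitiveJets

universe u

variable {E F : Type u} [NormedAddCommGroup E] [NormedSpace ℝ E] [NormedAddCommGroup F]
  [NormedSpace ℝ F]

/-- The Taylor data of order `≤ l + 1` of a primitive of the one-form `α` that vanishes at `0`. -/
def primitiveJets (l : ℕ) (α : E → E →L[ℝ] F) : Jets (l + 1) E F
  | ⟨0, _⟩ => 0
  | ⟨k + 1, _⟩ => (continuousMultilinearCurryRightEquiv' ℝ k E F).symm (iteratedFDeriv ℝ k α 0)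

theorem primitiveJets_eq_jets {α : E → E →L[ℝ] F} {A : E → F} (h : JetEq l α (fderiv ℝ A) 0)
    (hA : A 0 = 0) : primitiveJets l α = jets (l + 1) A := by
  funext ⟨m, hm⟩
  cases m with
  | zero =>
    ext
    exact hA.symm
  | succ k =>
    simp only [primitiveJets, jets, iteratedFDeriv_succ_eq_comp_right, Function.comp_apply]
    rw [h k (by omega)]

theorem smoothNear_primitiveJets {Θ : Type*} [NormedAddCommGroup Θ] [NormedSpace ℝ Θ]
    {α : Θ → E → E →L[ℝ] F} {t : Θ} (hα : SmoothNear (Function.uncurry α) (t, 0)) :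
    SmoothNear (fun s => primitiveJets l (α s)) t := by
  have hcomponent (m : Fin (l + 1 + 1)) :
      ∀ᶠ s in 𝓝 t, ContDiffAt ℝ ∞ (fun s => primitiveJets l (α s) m) s := by
    rcases m with ⟨_ | k, hk⟩
    · exact smoothNear_const _
    · let uncurry := (continuousMultilinearCurryRightEquiv' ℝ k E F).symm.toContinuousLinearEquiv
      exact (hα.iteratedFDeriv_apply k).clm uncurry.toContinuousLinearMap
  filter_upwards [eventually_all.2 hcomponent] with s hs
  exact contDiffAt_pi.2 hs

end PrimitiveJets

theorem IsGen.jetEq_primitiveForm {T ψ : Cot → Cot} (h : IsGen A S) (hA : IsPotential A)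
    (hS : SmoothNear S 0) (hT : SmoothNear T 0) (hT0 : T 0 = 0) (hψ : SmoothNear ψ 0)
    (hψT : ∀ᶠ z in 𝓝 0, ψ (mixedPoint T z) = z) (hTS : JetEq l T S 0) :
    JetEq l (primitiveForm T ψ) (fderiv ℝ A) 0 := by
  have hψ0 : ψ 0 = 0 := by simpa only [mixedPoint_zero hT0] using hψT.self_of_nhds
  have hinit := smoothNear_initialPoint hA.smooth
  have hfin := smoothNear_finalPoint hA.smooth
  have hTψ : SmoothNear (fun w => T (ψ w)) 0 := hT.comp_of_eq hψ hψ0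
  have hψA : JetEq l ψ (initialPoint A) 0 :=
    (hTS.mixedPoint hT hS).inverse (smoothNear_mixedPoint hT) (smoothNear_mixedPoint hS) hψ hinit
      (mixedPoint_zero hT0) (initialPoint_zero hA.fderiv_zero) hψT h.mixedPoint_initialPoint
  have hTψA : JetEq l (fun w => T (ψ w)) (finalPoint A) 0 :=
    (hTS.comp hψA hT hS hψ hinit hψ0).trans (JetEq.of_eventuallyEq h)
  have hcomponents := (hψA.clm (-ContinuousLinearMap.snd ℝ _ _) hψ hinit).prodMk
    (hTψA.clm (ContinuousLinearMap.snd ℝ _ _) hTψ hfin) (hψ.clm _) (hinit.clm _) (hTψ.clm _)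
    (hfin.clm _)
  refine (hcomponents.clm gradEquiv.symm.toContinuousLinearMap ((hψ.clm _).prodMk (hTψ.clm _))
    ((hinit.clm _).prodMk (hfin.clm _))).trans
    (JetEq.of_eventuallyEq (Eventually.of_forall fun w => gradEquiv.injective ?_))
  exact (gradEquiv.apply_symm_apply _).trans (Prod.ext (neg_neg _) rfl)

theorem exists_smooth_potentialJet (hl : 1 ≤ l) {S₀ : Cot → Cot} (hS₀ : IsSymplecticGerm S₀)
    (hb : Function.Bijective (fderiv ℝ (mixedPoint S₀) 0)) :
    ∃ ρ : JetSpace l → Jets (l + 1) Cot ℝ, SmoothNear ρ (jet l S₀) ∧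
      ∀ᶠ j in 𝓝 (jet l S₀), ∀ A S, IsPotential A → IsSymplecticGerm S → IsGen A S →
        jet l S = j → ρ j = jets (l + 1) A := by
  let T : JetSpace l → Cot → Cot := taylorPoly
  have hT (p) : SmoothNear (Function.uncurry T) p := smoothNear_of_contDiff contDiff_taylorPoly p
  have hTj (j) : SmoothNear (T j) 0 := smoothNear_taylorPoly j 0
  have hTS {S} (hS : IsSymplecticGerm S) : JetEq l (T (jet l S)) S 0 := jetEq_taylorPoly hS.smooth
  have hT0 {S} (hS : IsSymplecticGerm S) : T (jet l S) 0 = 0 := (hTS hS).eq.trans hS.zero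
  have hb' : Function.Bijective (fderiv ℝ (mixedPoint (T (jet l S₀))) 0) := by
    rwa [(((hTS hS₀).mono hl).mixedPoint (hTj _) hS₀.smooth).fderiv_eq (l := 0)]
  have hmixed : SmoothNear (Function.uncurry fun j z => mixedPoint (T j) z) (jet l S₀, 0) :=
    smoothNear_id.snd.fst.prodMk (hT _).fst
  obtain ⟨ψ, hψ, -, hψT, -⟩ :=
    hmixed.exists_inverse_param (mixedPoint_zero (hT0 hS₀)) hb'
  have hTψ : SmoothNear (fun p : JetSpace l × Cot => T p.1 (ψ p.1 p.2)) (jet l S₀, 0) :=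
    (hT _).comp (f := fun p : JetSpace l × Cot => (p.1, Function.uncurry ψ p))
      (smoothNear_id.fst.prodMk hψ)
  have hα : SmoothNear (Function.uncurry fun j => primitiveForm (T j) (ψ j)) (jet l S₀, 0) :=
    SmoothNear.clm gradEquiv.symm.toContinuousLinearMap (hψ.snd.neg.prodMk hTψ.snd)
  refine ⟨fun j => primitiveJets l (primitiveForm (T j) (ψ j)), smoothNear_primitiveJets hα, ?_⟩
  filter_upwards [hψT.curry_nhds, hψ.eventually_apply_left] with j hψTj hψj
  rintro A S hA hS hgen rfl
  exact primitiveJets_eq_jets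
    (hgen.jetEq_primitiveForm hA hS.smooth (hTj _) (hT0 hS) hψj hψTj (hTS hS)) hA.zero

end GeneratingJets

/-! ### Versality of the family `Fa` -/

section Versality

/-- The base `ℝ³` of the fibration `π : T*ℝ³ → ℝ³`. -/
abbrev Base : Type := Fin 3 → ℝ

theorem SmoothNear.comp_snd {f : Base → ℝ} (hf : SmoothNear f 0) :
    SmoothNear (fun w : Cot => f w.2) 0 :=
  hf.comp_of_eq smoothNear_id.snd rfl

@[fun_prop]
theorem smoothNear_coord (i : Fin 3) (w : Cot) : SmoothNear (fun w : Cot => w.1 i) w :=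
  smoothNear_pi.1 smoothNear_id.fst i

theorem eventually_snd {p : Base → Prop} (h : ∀ᶠ Q in 𝓝 0, p Q) : ∀ᶠ w : Cot in 𝓝 0, p w.2 :=
  (continuous_snd.tendsto (0 : Cot)).eventually h

/-- The coefficients of an infinitesimal deformation of the function
`c · (x₁² + x₁x₂ + e x₂² + g₁x₁ + g₂x₂) + b + x₃ B` on pairs `(x, Q)`, where `c, e, g₁, g₂, b`
depend on `Q` only: `ξ₁` and `ξ₂` rescale `x₁` and `x₂`, and `η₁, η₂, η₃` deform `g₁, g₂, e`. -/
structure TangentData where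
  ξ₁ : Cot → ℝ := fun _ => 0
  ξ₂ : Cot → ℝ := fun _ => 0
  B : Cot → ℝ := fun _ => 0
  η₁ : Base → ℝ := fun _ => 0
  η₂ : Base → ℝ := fun _ => 0
  η₃ : Base → ℝ := fun _ => 0
  b : Base → ℝ := fun _ => 0

namespace TangentData

/-- The coefficients are smooth germs. -/
structure Smooth (X : TangentData) : Prop where
  ξ₁ : SmoothNear X.ξ₁ 0 := by exact smoothNear_const 0
  ξ₂ : SmoothNear X.ξ₂ 0 := by exact smoothNear_const 0
  B : SmoothNear X.B 0 := by exact smoothNear_const 0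
  η₁ : SmoothNear X.η₁ 0 := by exact smoothNear_const 0
  η₂ : SmoothNear X.η₂ 0 := by exact smoothNear_const 0
  η₃ : SmoothNear X.η₃ 0 := by exact smoothNear_const 0
  b : SmoothNear X.b 0 := by exact smoothNear_const 0

/-- The derivative of the function `c · (x₁² + x₁x₂ + e x₂² + g₁x₁ + g₂x₂) + b + x₃ B` in the
direction of the tangent data. -/
def fn (c g₁ g₂ e : Base → ℝ) (X : TangentData) (w : Cot) : ℝ :=
  c w.2 * (w.1 0 * X.ξ₁ w * (2 * w.1 0 + w.1 1 + g₁ w.2) +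
    w.1 1 * X.ξ₂ w * (w.1 0 + 2 * e w.2 * w.1 1 + g₂ w.2) +
    (X.η₁ w.2 * w.1 0 + X.η₂ w.2 * w.1 1 + X.η₃ w.2 * w.1 1 ^ 2)) + X.b w.2 + w.1 2 * X.B w

end TangentData

/-- `H` is, as a germ, a tangent vector to the class of functions equivalent to the family `Fa`. -/
def InTangent (c g₁ g₂ e : Base → ℝ) (H : Cot → ℝ) : Prop :=
  ∃ X : TangentData, X.Smooth ∧ H =ᶠ[𝓝 0] X.fn c g₁ g₂ e

variable {c g₁ g₂ e : Base → ℝ} {H H' : Cot → ℝ}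

namespace InTangent

protected theorem congr (h : InTangent c g₁ g₂ e H) (hH : H' =ᶠ[𝓝 0] H) :
    InTangent c g₁ g₂ e H' := by
  obtain ⟨X, hX, he⟩ := h
  exact ⟨X, hX, hH.trans he⟩

protected theorem add (h : InTangent c g₁ g₂ e H) (h' : InTangent c g₁ g₂ e H') :
    InTangent c g₁ g₂ e (fun w => H w + H' w) := by
  obtain ⟨X, hX, he⟩ := h
  obtain ⟨Y, hY, he'⟩ := h'
  refine ⟨⟨_, _, _, _, _, _, _⟩, ⟨hX.ξ₁.add hY.ξ₁, hX.ξ₂.add hY.ξ₂, hX.B.add hY.B,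
    hX.η₁.add hY.η₁, hX.η₂.add hY.η₂, hX.η₃.add hY.η₃, hX.b.add hY.b⟩, ?_⟩
  filter_upwards [he, he'] with w h h'
  simp only [h, h', TangentData.fn]
  ring

protected theorem mul (h : InTangent c g₁ g₂ e H) {W : Base → ℝ} (hW : SmoothNear W 0) :
    InTangent c g₁ g₂ e (fun w => W w.2 * H w) := by
  obtain ⟨X, hX, he⟩ := h
  refine ⟨⟨_, _, _, _, _, _, _⟩, ⟨hW.comp_snd.mul hX.ξ₁, hW.comp_snd.mul hX.ξ₂,
    hW.comp_snd.mul hX.B, hW.mul hX.η₁, hW.mul hX.η₂, hW.mul hX.η₃, hW.mul hX.b⟩, ?_⟩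
  filter_upwards [he] with w h
  simp only [h, TangentData.fn]
  ring

protected theorem sum {ι : Type*} (s : Finset ι) {f : ι → Cot → ℝ}
    (h : ∀ i ∈ s, InTangent c g₁ g₂ e (f i)) :
    InTangent c g₁ g₂ e (fun w => ∑ i ∈ s, f i w) := by
  classical
  induction s using Finset.induction_on with
  | empty => exact ⟨{}, {}, .of_forall fun w => by simp [TangentData.fn]⟩
  | insert a s ha ih =>
    simp only [Finset.sum_insert ha]
    exact (h a (by simp)).add (ih fun i hi => h i (by simp [hi]))

end InTangent

theorem inTangent_x₃ {B : Cot → ℝ} (hB : SmoothNear B 0) :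
    InTangent c g₁ g₂ e (fun w => w.1 2 * B w) :=
  ⟨{ B := B }, { B := hB }, .of_forall fun w => by simp [TangentData.fn]⟩

theorem inTangent_base {b : Base → ℝ} (hb : SmoothNear b 0) :
    InTangent c g₁ g₂ e (fun w => b w.2) :=
  ⟨{ b := b }, { b := hb }, .of_forall fun w => by simp [TangentData.fn]⟩

section Unit

variable (hc : SmoothNear c 0) (hc0 : c 0 ≠ 0)
include hc hc0

theorem inTangent_of_mul (h : InTangent c g₁ g₂ e (fun w => c w.2 * H w)) :
    InTangent c g₁ g₂ e H := by
  refine (h.mul (hc.inv hc0)).congr ?_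
  filter_upwards [eventually_snd (hc.continuousAt.eventually_ne hc0)] with w hw
  field_simp

theorem inTangent_x₁ {ξ : Cot → ℝ} (hξ : SmoothNear ξ 0) :
    InTangent c g₁ g₂ e (fun w => w.1 0 * ξ w * (2 * w.1 0 + w.1 1 + g₁ w.2)) :=
  inTangent_of_mul hc hc0 ⟨{ ξ₁ := ξ }, { ξ₁ := hξ }, .of_forall fun w => by
    simp [TangentData.fn]⟩

theorem inTangent_x₂ {ξ : Cot → ℝ} (hξ : SmoothNear ξ 0) :
    InTangent c g₁ g₂ e (fun w => w.1 1 * ξ w * (w.1 0 + 2 * e w.2 * w.1 1 + g₂ w.2)) :=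
  inTangent_of_mul hc hc0 ⟨{ ξ₂ := ξ }, { ξ₂ := hξ }, .of_forall fun w => by
    simp [TangentData.fn]⟩

theorem inTangent_quadratic (r₁ r₂ r₃ : ℝ) :
    InTangent c g₁ g₂ e (fun w => r₁ * w.1 0 + r₂ * w.1 1 + r₃ * w.1 1 ^ 2) :=
  inTangent_of_mul hc hc0 ⟨{ η₁ := fun _ => r₁, η₂ := fun _ => r₂, η₃ := fun _ => r₃ },
    { η₁ := smoothNear_const r₁, η₂ := smoothNear_const r₂, η₃ := smoothNear_const r₃ },
    .of_forall fun w => by simp [TangentData.fn]⟩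

theorem inTangent_x₁_mul_x₂ (hg₂ : SmoothNear g₂ 0) (he : SmoothNear e 0) :
    InTangent c g₁ g₂ e (fun w => w.1 0 * w.1 1) := by
  have h₁ := inTangent_x₂ (g₁ := g₁) (g₂ := g₂) (e := e) hc hc0 (smoothNear_const 1)
  have h₂ := (inTangent_quadratic (g₁ := g₁) (g₂ := g₂) (e := e) hc hc0 0 0 1).mul
    ((smoothNear_const (-2)).mul he)
  have h₃ := (inTangent_quadratic (g₁ := g₁) (g₂ := g₂) (e := e) hc hc0 0 1 0).mul hg₂.neg
  exact ((h₁.add h₂).add h₃).congr (.of_forall fun w => by ring)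

variable (hg₁ : SmoothNear g₁ 0) (hg₂ : SmoothNear g₂ 0) (he : SmoothNear e 0)
  (he0 : 1 / 4 < e 0)
include hg₁ hg₂ he he0

/-! The two relations `x₁ (2x₁ + x₂ + g₁) ≡ 0` and `x₂ (x₁ + 2e x₂ + g₂) ≡ 0`, multiplied by a
monomial, are linear equations for the two monomials of the next degree, of determinant
`4e - 1`. -/

theorem inTangent_raise_x₁ {i j : ℕ}
    (h : InTangent c g₁ g₂ e (fun w => w.1 0 ^ (i + 1) * w.1 1 ^ (j + 1))) :
    InTangent c g₁ g₂ e (fun w => w.1 0 ^ (i + 2) * w.1 1 ^ (j + 1)) := by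
  have hdet : SmoothNear (fun Q => 4 * e Q - 1) 0 := by fun_prop
  have hdet0 : 4 * e 0 - 1 ≠ 0 := by linarith
  have hinv := hdet.inv hdet0
  have h₁ := (inTangent_x₁ (g₁ := g₁) (g₂ := g₂) (e := e) hc hc0
    (ξ := fun w => w.1 0 ^ i * w.1 1 ^ (j + 1)) (by fun_prop)).mul
    (((smoothNear_const 2).mul he).mul hinv)
  have h₂ := (inTangent_x₂ (g₁ := g₁) (g₂ := g₂) (e := e) hc hc0
    (ξ := fun w => w.1 0 ^ (i + 1) * w.1 1 ^ j) (by fun_prop)).mul hinv.neg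
  have h₃ := h.mul ((((smoothNear_const 2).mul he).mul hg₁).sub hg₂ |>.mul hinv).neg
  refine ((h₁.add h₂).add h₃).congr ?_
  filter_upwards [eventually_snd (hdet.continuousAt.eventually_ne hdet0)] with w hw
  linear_combination (-(w.1 0 ^ (i + 2) * w.1 1 ^ (j + 1))) * inv_mul_cancel₀ hw

theorem inTangent_raise_x₂ {i j : ℕ}
    (h : InTangent c g₁ g₂ e (fun w => w.1 0 ^ (i + 1) * w.1 1 ^ (j + 1))) :
    InTangent c g₁ g₂ e (fun w => w.1 0 ^ (i + 1) * w.1 1 ^ (j + 2)) := by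
  have hdet : SmoothNear (fun Q => 4 * e Q - 1) 0 := by fun_prop
  have hdet0 : 4 * e 0 - 1 ≠ 0 := by linarith
  have hinv := hdet.inv hdet0
  have h₁ := (inTangent_x₁ (g₁ := g₁) (g₂ := g₂) (e := e) hc hc0
    (ξ := fun w => w.1 0 ^ i * w.1 1 ^ (j + 1)) (by fun_prop)).mul hinv.neg
  have h₂ := (inTangent_x₂ (g₁ := g₁) (g₂ := g₂) (e := e) hc hc0
    (ξ := fun w => w.1 0 ^ (i + 1) * w.1 1 ^ j) (by fun_prop)).mul ((smoothNear_const 2).mul hinv)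
  have h₃ := h.mul (((smoothNear_const 2).mul hg₂).sub hg₁ |>.mul hinv).neg
  refine ((h₁.add h₂).add h₃).congr ?_
  filter_upwards [eventually_snd (hdet.continuousAt.eventually_ne hdet0)] with w hw
  field_simp
  ring

theorem inTangent_mixed (i j : ℕ) :
    InTangent c g₁ g₂ e (fun w => w.1 0 ^ (i + 1) * w.1 1 ^ (j + 1)) := by
  induction i with
  | zero =>
    induction j with
    | zero => simpa using inTangent_x₁_mul_x₂ hc hc0 hg₂ he
    | succ j ih => exact inTangent_raise_x₂ hc hc0 hg₁ hg₂ he he0 ih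
  | succ i ih => exact inTangent_raise_x₁ hc hc0 hg₁ hg₂ he he0 ih

theorem inTangent_x₁_pow (i : ℕ) : InTangent c g₁ g₂ e (fun w => w.1 0 ^ (i + 1)) := by
  induction i with
  | zero => exact (inTangent_quadratic hc hc0 1 0 0).congr (.of_forall fun w => by ring)
  | succ i ih =>
    have half : SmoothNear (fun _ : Base => (1 / 2 : ℝ)) 0 := smoothNear_const _
    have h₁ := (inTangent_x₁ (g₁ := g₁) (g₂ := g₂) (e := e) hc hc0
      ((smoothNear_coord 0 0).pow i)).mul half
    have h₂ := (inTangent_mixed hc hc0 hg₁ hg₂ he he0 i 0).mul half.neg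
    have h₃ := ih.mul (hg₁.mul half).neg
    exact ((h₁.add h₂).add h₃).congr (.of_forall fun w => by ring)

theorem inTangent_x₂_pow (j : ℕ) : InTangent c g₁ g₂ e (fun w => w.1 1 ^ (j + 1)) := by
  have he' : e 0 ≠ 0 := by linarith
  induction j with
  | zero => exact (inTangent_quadratic hc hc0 0 1 0).congr (.of_forall fun w => by ring)
  | succ j ih =>
    have half := (he.inv he').mul (smoothNear_const (1 / 2 : ℝ))
    have h₁ := (inTangent_x₂ (g₁ := g₁) (g₂ := g₂) (e := e) hc hc0
      ((smoothNear_coord 1 0).pow j)).mul half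
    have h₂ := (inTangent_mixed hc hc0 hg₁ hg₂ he he0 0 j).mul half.neg
    have h₃ := ih.mul (hg₂.mul half).neg
    refine ((h₁.add h₂).add h₃).congr ?_
    filter_upwards [eventually_snd (he.continuousAt.eventually_ne he')] with w hw
    field_simp
    ring

theorem inTangent_monomial (i j : ℕ) :
    InTangent c g₁ g₂ e (fun w => w.1 0 ^ i * w.1 1 ^ j) := by
  obtain _ | i := i
  · obtain _ | j := j
    · simpa using inTangent_base (smoothNear_const 1)
    · simpa using inTangent_x₂_pow hc hc0 hg₁ hg₂ he he0 j
  · obtain _ | j := j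
    · simpa using inTangent_x₁_pow hc hc0 hg₁ hg₂ he he0 i
    · exact inTangent_mixed hc hc0 hg₁ hg₂ he he0 i j

theorem inTangent_monomial_mul_base (i j k : ℕ) {W : Base → ℝ} (hW : SmoothNear W 0) :
    InTangent c g₁ g₂ e (fun w => w.1 0 ^ i * w.1 1 ^ j * w.1 2 ^ k * W w.2) := by
  obtain _ | k := k
  · exact ((inTangent_monomial hc hc0 hg₁ hg₂ he he0 i j).mul hW).congr
      (.of_forall fun w => by ring)
  · have := hW.comp_snd
    exact (inTangent_x₃ (B := fun w => w.1 0 ^ i * w.1 1 ^ j * w.1 2 ^ k * W w.2)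
      (by fun_prop)).congr (.of_forall fun w => by ring)

omit hc hc0 hg₁ hg₂ he he0

/-- The linear coordinates on `T*ℝ³`. -/
def coord : Fin 3 ⊕ Fin 3 → Cot → ℝ := Sum.elim (fun i w => w.1 i) (fun i w => w.2 i)

/-- The basis of `T*ℝ³` dual to `coord`. -/
def coordVec : Fin 3 ⊕ Fin 3 → Cot :=
  Sum.elim (fun i => (Pi.single i 1, 0)) (fun i => (0, Pi.single i 1))

theorem sum_coord_smul_coordVec (w : Cot) : ∑ k, coord k w • coordVec k = w := by
  simp only [coord, coordVec, Fintype.sum_sum_type, Sum.elim_inl, Sum.elim_inr]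
  ext j <;> fin_cases j <;> simp [Fin.sum_univ_three]

theorem multilinear_eq_sum_coord {m : ℕ}
    (p : ContinuousMultilinearMap ℝ (fun _ : Fin m => Cot) ℝ) (w : Cot) :
    (p fun _ => w) = ∑ r : Fin m → Fin 3 ⊕ Fin 3,
      (∏ i, coord (r i) w) * p fun i => coordVec (r i) := by
  conv_lhs => rw [← sum_coord_smul_coordVec w]
  rw [p.map_sum]
  exact Finset.sum_congr rfl fun r _ => p.map_smul_univ _ _

theorem exists_prod_coord_eq {ι : Type*} [Fintype ι] (r : ι → Fin 3 ⊕ Fin 3) :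
    ∃ (i j k : ℕ) (W : Base → ℝ), SmoothNear W 0 ∧
      ∀ w, ∏ m, coord (r m) w = w.1 0 ^ i * w.1 1 ^ j * w.1 2 ^ k * W w.2 := by
  suffices ∃ (i j k : ℕ) (W : Base → ℝ), SmoothNear W 0 ∧
      ∀ w : Cot, (∏ m, coord (r m)) w = w.1 0 ^ i * w.1 1 ^ j * w.1 2 ^ k * W w.2 by
    simpa only [Finset.prod_apply] using this
  refine Finset.prod_induction (fun m => coord (r m)) (fun f : Cot → ℝ =>
    ∃ (i j k : ℕ) (W : Base → ℝ), SmoothNear W 0 ∧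
      ∀ w : Cot, f w = w.1 0 ^ i * w.1 1 ^ j * w.1 2 ^ k * W w.2) ?_ ?_ fun m _ => ?_
  · rintro f f' ⟨i, j, k, W, hW, h⟩ ⟨i', j', k', W', hW', h'⟩
    refine ⟨i + i', j + j', k + k', _, hW.mul hW', fun w => ?_⟩
    rw [Pi.mul_apply, h, h']
    ring
  · exact ⟨0, 0, 0, _, smoothNear_const 1, fun w => by simp⟩
  · rcases r m with k | k
    · fin_cases k
      · exact ⟨1, 0, 0, _, smoothNear_const 1, fun w => by simp [coord]⟩
      · exact ⟨0, 1, 0, _, smoothNear_const 1, fun w => by simp [coord]⟩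
      · exact ⟨0, 0, 1, _, smoothNear_const 1, fun w => by simp [coord]⟩
    · exact ⟨0, 0, 0, _, smoothNear_apply k, fun w => by simp [coord]⟩

include hc hc0 hg₁ hg₂ he he0

theorem inTangent_multilinear {m : ℕ} (p : ContinuousMultilinearMap ℝ (fun _ : Fin m => Cot) ℝ) :
    InTangent c g₁ g₂ e (fun w => p fun _ => w) := by
  simp only [multilinear_eq_sum_coord p]
  refine InTangent.sum _ fun r _ => ?_
  obtain ⟨i, j, k, W, hW, h⟩ := exists_prod_coord_eq r
  simp only [h]
  exact ((inTangent_monomial_mul_base hc hc0 hg₁ hg₂ he he0 i j k hW).mul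
    (smoothNear_const (p fun i => coordVec (r i)))).congr (.of_forall fun w => mul_comm _ _)

theorem inTangent_potential {n : ℕ} (θ : potentialJets n) : InTangent c g₁ g₂ e (potential θ) :=
  InTangent.sum Finset.univ fun m _ => (inTangent_multilinear hc hc0 hg₁ hg₂ he he0
    ((θ : Jets n Cot ℝ) m)).mul (smoothNear_const (((m : ℕ).factorial : ℝ)⁻¹))

end Unit

end Versality

/-! ### Openness of the normal forms -/

section Openness

section Expansion

variable {V : Type*} [NormedAddCommGroup V] [NormedSpace ℝ V]

theorem hasDerivAt_of_expansion {f R : ℝ → V} {v : V} (hR : ContinuousAt R 0)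
    (h : ∀ s, f s = f 0 + s • v + s ^ 2 • R s) : HasDerivAt f v 0 := by
  rw [hasDerivAt_iff_tendsto_slope_zero]
  have hlim : Tendsto (fun s : ℝ => v + s • R s) (𝓝[≠] 0) (𝓝 v) := by
    have hcont : ContinuousAt (fun s : ℝ => v + s • R s) 0 :=
      continuousAt_const.add (continuousAt_id.smul hR)
    simpa using hcont.tendsto.mono_left nhdsWithin_le_nhds
  refine hlim.congr' ?_
  filter_upwards [self_mem_nhdsWithin] with s (hs : s ≠ 0)
  rw [zero_add, h s, add_assoc, add_sub_cancel_left, smul_add, smul_smul, smul_smul,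
    inv_mul_cancel₀ hs, one_smul, pow_two, inv_mul_cancel_left₀ hs]

theorem map_nhds_eq_of_expansion [CompleteSpace V] {d : ℕ} (β : Module.Basis (Fin d) ℝ V)
    {Ψ : (Fin d → ℝ) → V} (hΨ : SmoothNear Ψ 0)
    (h : ∀ j, ∃ R : ℝ → V, ContinuousAt R 0 ∧
      ∀ s, Ψ (s • Pi.single j 1) = Ψ 0 + s • β j + s ^ 2 • R s) :
    map Ψ (𝓝 0) = 𝓝 (Ψ 0) := by
  have hΨ' : HasStrictFDerivAt Ψ (fderiv ℝ Ψ 0) 0 :=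
    hΨ.contDiffAt.hasStrictFDerivAt (by simp)
  refine hΨ'.map_nhds_eq_of_surj ?_
  rw [eq_top_iff, ← β.span_eq, Submodule.span_le]
  rintro _ ⟨j, rfl⟩
  obtain ⟨R, hR, hexp⟩ := h j
  have hline : HasDerivAt (fun s : ℝ => s • (Pi.single j 1 : Fin d → ℝ)) (Pi.single j 1) 0 := by
    simpa using (hasDerivAt_id (0 : ℝ)).smul_const (Pi.single j 1 : Fin d → ℝ)
  have hchain : HasDerivAt (fun s : ℝ => Ψ (s • Pi.single j 1)) (fderiv ℝ Ψ 0 (Pi.single j 1)) 0 :=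
    HasFDerivAt.comp_hasDerivAt (0 : ℝ) (by simpa using hΨ'.hasFDerivAt) hline
  exact ⟨Pi.single j 1, hchain.unique (hasDerivAt_of_expansion hR fun s => by simpa using hexp s)⟩

end Expansion

/-- The function `x₁ α + x₂ β + b(Q) + x₃ B` of `(x, Q)`, the shape in which the derivatives along
`x = 0` can be read off. -/
def coordForm (α β B : Cot → ℝ) (b : Base → ℝ) (w : Cot) : ℝ :=
  w.1 0 * α w + w.1 1 * β w + b w.2 + w.1 2 * B w

section CoordForm

variable {α β B : Cot → ℝ} {b : Base → ℝ}

theorem smoothNear_coordForm (hα : SmoothNear α 0) (hβ : SmoothNear β 0) (hB : SmoothNear B 0)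
    (hb : SmoothNear b 0) : SmoothNear (coordForm α β B b) 0 := by
  have := hb.comp_snd
  unfold coordForm
  fun_prop

theorem fderiv_coordForm {Q : Base} (hα : SmoothNear α (0, Q)) (hβ : SmoothNear β (0, Q))
    (hB : SmoothNear B (0, Q)) (hb : SmoothNear b Q) (v : Cot) :
    fderiv ℝ (coordForm α β B b) (0, Q) v =
      v.1 0 * α (0, Q) + v.1 1 * β (0, Q) + fderiv ℝ b Q v.2 + v.1 2 * B (0, Q) := by
  have hx (i : Fin 3) : HasFDerivAt (fun w : Cot => w.1 i)
      ((ContinuousLinearMap.proj (R := ℝ) (φ := fun _ : Fin 3 => ℝ) i).comp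
        (ContinuousLinearMap.fst ℝ Base Base)) (0, Q) :=
    ((ContinuousLinearMap.proj (R := ℝ) (φ := fun _ : Fin 3 => ℝ) i).comp
      (ContinuousLinearMap.fst ℝ Base Base)).hasFDerivAt
  have hbQ : HasFDerivAt (fun w : Cot => b w.2) ((fderiv ℝ b Q).comp
      (ContinuousLinearMap.snd ℝ Base Base)) (0, Q) :=
    HasFDerivAt.comp ((0, Q) : Cot) (g := b) (f := Prod.snd) hb.differentiableAt.hasFDerivAt
      hasFDerivAt_snd
  have h : HasFDerivAt (coordForm α β B b) _ (0, Q) :=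
    ((((hx 0).mul hα.differentiableAt.hasFDerivAt).add
      ((hx 1).mul hβ.differentiableAt.hasFDerivAt)).add hbQ).add
      ((hx 2).mul hB.differentiableAt.hasFDerivAt)
  rw [h.fderiv]
  simp
  ring

theorem fderiv_coordForm_zero (hα : SmoothNear α 0) (hβ : SmoothNear β 0) (hB : SmoothNear B 0)
    (hb : SmoothNear b 0) (v : Cot) : fderiv ℝ (coordForm α β B b) 0 v =
      v.1 0 * α 0 + v.1 1 * β 0 + fderiv ℝ b 0 v.2 + v.1 2 * B 0 :=
  fderiv_coordForm (Q := 0) hα hβ hB hb v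

theorem eq_zero_of_fderiv_coordForm_eq_zero (hα : SmoothNear α 0) (hβ : SmoothNear β 0)
    (hB : SmoothNear B 0) (hb : SmoothNear b 0) (h0 : coordForm α β B b 0 = 0)
    (h1 : fderiv ℝ (coordForm α β B b) 0 = 0) :
    α 0 = 0 ∧ β 0 = 0 ∧ B 0 = 0 ∧ b 0 = 0 ∧ fderiv ℝ b 0 = 0 := by
  have h (v : Cot) : 0 = v.1 0 * α 0 + v.1 1 * β 0 + fderiv ℝ b 0 v.2 + v.1 2 * B 0 := by
    simpa [h1] using fderiv_coordForm_zero hα hβ hB hb v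
  refine ⟨?_, ?_, ?_, by simpa [coordForm] using h0, ContinuousLinearMap.ext fun v => ?_⟩
  · simpa using (h (Pi.single 0 1, 0)).symm
  · simpa using (h (Pi.single 1 1, 0)).symm
  · simpa using (h (Pi.single 2 1, 0)).symm
  · simpa using (h (0, v)).symm

end CoordForm

/-- The family `f + ∑ⱼ tⱼ vⱼ` of functions with parameters `t`. -/
def affineFamily {E : Type*} {d : ℕ} (f : E → ℝ) (v : Fin d → E → ℝ) (t : Fin d → ℝ) (x : E) : ℝ :=
  f x + ∑ j, t j * v j x

section AffineFamily

variable {E : Type*} {d : ℕ} {f : E → ℝ} {v : Fin d → E → ℝ} {x : E}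

theorem affineFamily_zero : affineFamily f v 0 = f := by
  ext
  simp [affineFamily]

theorem affineFamily_single (s : ℝ) (j : Fin d) (x : E) :
    affineFamily f v (s • Pi.single j 1) x = f x + s * v j x := by
  simp [affineFamily, Pi.single_apply]

theorem affineFamily_eq_zero (hf : f x = 0) (hv : ∀ j, v j x = 0) (t : Fin d → ℝ) :
    affineFamily f v t x = 0 := by
  simp [affineFamily, hf, hv]

variable [NormedAddCommGroup E] [NormedSpace ℝ E] (hf : SmoothNear f x)
  (hv : ∀ j, SmoothNear (v j) x)
include hf hv

theorem smoothNear_uncurry_affineFamily (t : Fin d → ℝ) :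
    SmoothNear (Function.uncurry (affineFamily f v)) (t, x) := by
  have hsnd {g : E → ℝ} (hg : SmoothNear g x) :
      SmoothNear (fun p : (Fin d → ℝ) × E => g p.2) (t, x) :=
    hg.comp_of_eq smoothNear_id.snd rfl
  exact (hsnd hf).add (SmoothNear.sum fun j _ =>
    (smoothNear_pi.1 smoothNear_id.fst j).mul (hsnd (hv j)))

theorem smoothNear_affineFamily (t : Fin d → ℝ) : SmoothNear (affineFamily f v t) x :=
  hf.add (SmoothNear.sum fun j _ => (smoothNear_const (t j)).mul (hv j))

theorem fderiv_affineFamily_eq_zero (hf0 : fderiv ℝ f x = 0) (hv0 : ∀ j, fderiv ℝ (v j) x = 0)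
    (t : Fin d → ℝ) : fderiv ℝ (affineFamily f v t) x = 0 := by
  have h : HasFDerivAt (affineFamily f v t) (fderiv ℝ f x + ∑ j, t j • fderiv ℝ (v j) x) x :=
    hf.differentiableAt.hasFDerivAt.add
      (HasFDerivAt.fun_sum fun j _ => (hv j).differentiableAt.hasFDerivAt.const_mul (t j))
  simp [h.fderiv, hf0, hv0]

end AffineFamily

/-- The coefficients of a function `c(Q) F(x₁φ₁, x₂φ₂, Q) + b(Q) + x₃ B` of `(x, Q)`, where
`F = x₁² + x₁x₂ + e(Q) x₂² + g₁(Q) x₁ + g₂(Q) x₂`: on `x₃ = 0` it is equivalent to a member of the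
family `Fa`, whose modulus `a` is absorbed in `e`. -/
structure NormalData where
  (c b e g₁ g₂ : Base → ℝ)
  (φ₁ φ₂ B : Cot → ℝ)

namespace NormalData

/-- The function determined by the coefficients. -/
def fn (D : NormalData) (w : Cot) : ℝ :=
  D.c w.2 * ((w.1 0 * D.φ₁ w) ^ 2 + (w.1 0 * D.φ₁ w) * (w.1 1 * D.φ₂ w) +
    D.e w.2 * (w.1 1 * D.φ₂ w) ^ 2 + D.g₁ w.2 * (w.1 0 * D.φ₁ w) +
    D.g₂ w.2 * (w.1 1 * D.φ₂ w)) + D.b w.2 + w.1 2 * D.B w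

/-- The unfolding map `Q ↦ (g₁, g₂, e)`. -/
def unfolding (D : NormalData) (Q : Base) : Base := ![D.g₁ Q, D.g₂ Q, D.e Q]

/-- The coefficients are smooth germs. -/
structure Smooth (D : NormalData) : Prop where
  c : SmoothNear D.c 0
  b : SmoothNear D.b 0
  e : SmoothNear D.e 0
  g₁ : SmoothNear D.g₁ 0
  g₂ : SmoothNear D.g₂ 0
  φ₁ : SmoothNear D.φ₁ 0
  φ₂ : SmoothNear D.φ₂ 0
  B : SmoothNear D.B 0

/-- The conditions under which `D.fn` defines a function equivalent to some `Fa a`, `a > 1/4`. -/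
structure Good (D : NormalData) : Prop where
  smooth : D.Smooth
  c_ne : D.c 0 ≠ 0
  e_gt : 1 / 4 < D.e 0
  g₁_zero : D.g₁ 0 = 0
  g₂_zero : D.g₂ 0 = 0
  φ₁_pos : 0 < D.φ₁ 0
  φ₂_pos : 0 < D.φ₂ 0
  bijective : Function.Bijective (fderiv ℝ D.unfolding 0)

variable {D : NormalData}

theorem Smooth.unfolding (h : D.Smooth) : SmoothNear D.unfolding 0 := by
  refine smoothNear_pi.2 fun i => ?_
  fin_cases i
  exacts [h.g₁, h.g₂, h.e]

/-- The coefficient of `x₁` when `D.fn` is written as a `coordForm`. -/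
def coeff₁ (D : NormalData) (w : Cot) : ℝ :=
  D.c w.2 * (w.1 0 * D.φ₁ w ^ 2 + w.1 1 * D.φ₁ w * D.φ₂ w + D.g₁ w.2 * D.φ₁ w)

/-- The coefficient of `x₂` when `D.fn` is written as a `coordForm`. -/
def coeff₂ (D : NormalData) (w : Cot) : ℝ :=
  D.c w.2 * (D.e w.2 * w.1 1 * D.φ₂ w ^ 2 + D.g₂ w.2 * D.φ₂ w)

theorem fn_eq_coordForm (D : NormalData) : D.fn = coordForm D.coeff₁ D.coeff₂ D.B D.b := by
  ext w
  simp only [fn, coordForm, coeff₁, coeff₂]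
  ring

theorem Smooth.coeff₁ (h : D.Smooth) : SmoothNear D.coeff₁ 0 := by
  have hc := h.c.comp_snd
  have hg := h.g₁.comp_snd
  have h₁ := h.φ₁
  have h₂ := h.φ₂
  unfold NormalData.coeff₁
  fun_prop

theorem Smooth.coeff₂ (h : D.Smooth) : SmoothNear D.coeff₂ 0 := by
  have hc := h.c.comp_snd
  have he := h.e.comp_snd
  have hg := h.g₂.comp_snd
  have h₂ := h.φ₂
  unfold NormalData.coeff₂
  fun_prop

theorem Smooth.fn (h : D.Smooth) : SmoothNear D.fn 0 := by
  rw [fn_eq_coordForm]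
  exact smoothNear_coordForm h.coeff₁ h.coeff₂ h.B h.b

theorem Smooth.fderiv_fn_zero (h : D.Smooth) (hg₁ : D.g₁ 0 = 0) (hg₂ : D.g₂ 0 = 0) (hB : D.B 0 = 0)
    (hb : fderiv ℝ D.b 0 = 0) : fderiv ℝ D.fn 0 = 0 := by
  refine ContinuousLinearMap.ext fun v => ?_
  rw [fn_eq_coordForm, fderiv_coordForm_zero h.coeff₁ h.coeff₂ h.B h.b]
  simp [NormalData.coeff₁, NormalData.coeff₂, hg₁, hg₂, hB, hb]

end NormalData

namespace TangentData

variable {X : TangentData} {c g₁ g₂ e : Base → ℝ}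

/-- The coefficients vanish at `0` to the order that makes the deformation vanish there to second
order. -/
structure Vanishing (X : TangentData) : Prop where
  η₁ : X.η₁ 0 = 0
  η₂ : X.η₂ 0 = 0
  B : X.B 0 = 0
  b : X.b 0 = 0
  fderiv_b : fderiv ℝ X.b 0 = 0

theorem fn_eq_coordForm (X : TangentData) : X.fn c g₁ g₂ e = coordForm
    (fun w => c w.2 * (X.ξ₁ w * (2 * w.1 0 + w.1 1 + g₁ w.2) + X.η₁ w.2))
    (fun w => c w.2 * (X.ξ₂ w * (w.1 0 + 2 * e w.2 * w.1 1 + g₂ w.2) + X.η₂ w.2 +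
      X.η₃ w.2 * w.1 1)) X.B X.b := by
  ext w
  simp only [fn, coordForm]
  ring

theorem Smooth.vanishing (hX : X.Smooth) (hc : SmoothNear c 0) (hg₁ : SmoothNear g₁ 0)
    (hg₂ : SmoothNear g₂ 0) (he : SmoothNear e 0) (hc0 : c 0 ≠ 0) (hg₁0 : g₁ 0 = 0)
    (hg₂0 : g₂ 0 = 0) (h0 : X.fn c g₁ g₂ e 0 = 0) (h1 : fderiv ℝ (X.fn c g₁ g₂ e) 0 = 0) :
    X.Vanishing := by
  have := hc.comp_snd
  have := hg₁.comp_snd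
  have := hg₂.comp_snd
  have := he.comp_snd
  have := hX.η₁.comp_snd
  have := hX.η₂.comp_snd
  have := hX.η₃.comp_snd
  have := hX.ξ₁
  have := hX.ξ₂
  rw [fn_eq_coordForm] at h0 h1
  obtain ⟨hα, hβ, hB, hb, hdb⟩ :=
    eq_zero_of_fderiv_coordForm_eq_zero (by fun_prop) (by fun_prop) hX.B hX.b h0 h1
  exact ⟨by simpa [hc0, hg₁0] using hα, by simpa [hc0, hg₂0] using hβ, hB, hb, hdb⟩

end TangentData

theorem exists_tangentData_potential {c g₁ g₂ e : Base → ℝ} (hc : SmoothNear c 0)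
    (hg₁ : SmoothNear g₁ 0) (hg₂ : SmoothNear g₂ 0) (he : SmoothNear e 0) (hc0 : c 0 ≠ 0)
    (hg₁0 : g₁ 0 = 0) (hg₂0 : g₂ 0 = 0) (he0 : 1 / 4 < e 0) {n : ℕ} (hn : 1 ≤ n)
    (θ : potentialJets n) : ∃ X : TangentData, X.Smooth ∧ X.Vanishing ∧
      X.fn c g₁ g₂ e =ᶠ[𝓝 0] potential θ := by
  obtain ⟨X, hX, hθ⟩ := inTangent_potential hc hc0 hg₁ hg₂ he he0 θ
  refine ⟨X, hX, hX.vanishing hc hg₁ hg₂ he hc0 hg₁0 hg₂0 ?_ ?_, hθ.symm⟩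
  · rw [← hθ.self_of_nhds, potential_zero]
  · rw [← hθ.fderiv_eq, fderiv_potential_zero hn]

namespace NormalData

variable {D : NormalData} {d : ℕ} {X : Fin d → TangentData}

/-- The deformation of `D` with parameters `t` in the directions `X`. -/
def perturb (D : NormalData) (X : Fin d → TangentData) (t : Fin d → ℝ) : NormalData where
  c := D.c
  b := affineFamily D.b (fun j => (X j).b) t
  e := affineFamily D.e (fun j => (X j).η₃) t
  g₁ := affineFamily D.g₁ (fun j => (X j).η₁) t
  g₂ := affineFamily D.g₂ (fun j => (X j).η₂) t
  φ₁ := affineFamily D.φ₁ (fun j => (X j).ξ₁) t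
  φ₂ := affineFamily D.φ₂ (fun j => (X j).ξ₂) t
  B := affineFamily D.B (fun j => (X j).B) t

theorem perturb_zero : D.perturb X 0 = D := by
  simp only [perturb, affineFamily_zero]

theorem Smooth.perturb (hD : D.Smooth) (hX : ∀ j, (X j).Smooth) (t : Fin d → ℝ) :
    (D.perturb X t).Smooth where
  c := hD.c
  b := smoothNear_affineFamily hD.b (fun j => (hX j).b) t
  e := smoothNear_affineFamily hD.e (fun j => (hX j).η₃) t
  g₁ := smoothNear_affineFamily hD.g₁ (fun j => (hX j).η₁) t
  g₂ := smoothNear_affineFamily hD.g₂ (fun j => (hX j).η₂) t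
  φ₁ := smoothNear_affineFamily hD.φ₁ (fun j => (hX j).ξ₁) t
  φ₂ := smoothNear_affineFamily hD.φ₂ (fun j => (hX j).ξ₂) t
  B := smoothNear_affineFamily hD.B (fun j => (hX j).B) t

theorem Smooth.uncurry_perturb_fn (hD : D.Smooth) (hX : ∀ j, (X j).Smooth) (t : Fin d → ℝ) :
    SmoothNear (Function.uncurry fun t => (D.perturb X t).fn) (t, 0) := by
  have hbase {f : Base → ℝ} {v : Fin d → Base → ℝ} (hf : SmoothNear f 0)
      (hv : ∀ j, SmoothNear (v j) 0) :
      SmoothNear (fun p : (Fin d → ℝ) × Cot => affineFamily f v p.1 p.2.2) (t, 0) :=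
    (smoothNear_uncurry_affineFamily hf hv t).comp_of_eq
      (f := fun p : (Fin d → ℝ) × Cot => (p.1, p.2.2)) (by fun_prop) rfl
  have hx (i : Fin 3) : SmoothNear (fun p : (Fin d → ℝ) × Cot => p.2.1 i) (t, 0) := by fun_prop
  have hc : SmoothNear (fun p : (Fin d → ℝ) × Cot => D.c p.2.2) (t, 0) :=
    hD.c.comp_of_eq (by fun_prop) rfl
  have hu₁ := (hx 0).mul (smoothNear_uncurry_affineFamily hD.φ₁ (fun j => (hX j).ξ₁) t)
  have hu₂ := (hx 1).mul (smoothNear_uncurry_affineFamily hD.φ₂ (fun j => (hX j).ξ₂) t)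
  have he := hbase hD.e fun j => (hX j).η₃
  have hg₁ := hbase hD.g₁ fun j => (hX j).η₁
  have hg₂ := hbase hD.g₂ fun j => (hX j).η₂
  have hb := hbase hD.b fun j => (hX j).b
  have hB := smoothNear_uncurry_affineFamily hD.B (fun j => (hX j).B) t
  exact ((hc.mul (((((hu₁.pow 2).add (hu₁.mul hu₂)).add (he.mul (hu₂.pow 2))).add
    (hg₁.mul hu₁)).add (hg₂.mul hu₂))).add hb).add ((hx 2).mul hB)

theorem Smooth.uncurry_perturb_unfolding (hD : D.Smooth) (hX : ∀ j, (X j).Smooth)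
    (t : Fin d → ℝ) :
    SmoothNear (Function.uncurry fun t => (D.perturb X t).unfolding) (t, 0) := by
  refine smoothNear_pi.2 fun i => ?_
  fin_cases i
  exacts [smoothNear_uncurry_affineFamily hD.g₁ (fun j => (hX j).η₁) t,
    smoothNear_uncurry_affineFamily hD.g₂ (fun j => (hX j).η₂) t,
    smoothNear_uncurry_affineFamily hD.e (fun j => (hX j).η₃) t]

theorem Good.eventually_perturb (hD : D.Good) (hX : ∀ j, (X j).Smooth)
    (hX0 : ∀ j, (X j).Vanishing) : ∀ᶠ t in 𝓝 0, (D.perturb X t).Good := by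
  have hsD := hD.smooth
  have he := (smoothNear_uncurry_affineFamily hsD.e (fun j => (hX j).η₃) 0).apply_right
  have hφ₁ := (smoothNear_uncurry_affineFamily hsD.φ₁ (fun j => (hX j).ξ₁) 0).apply_right
  have hφ₂ := (smoothNear_uncurry_affineFamily hsD.φ₂ (fun j => (hX j).ξ₂) 0).apply_right
  have hdu := (hsD.uncurry_perturb_unfolding hX 0).uncurry_fderiv.apply_right
  have he0 : 1 / 4 < affineFamily D.e (fun j => (X j).η₃) 0 0 := by
    rw [affineFamily_zero]; exact hD.e_gt
  have hφ₁0 : 0 < affineFamily D.φ₁ (fun j => (X j).ξ₁) 0 0 := by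
    rw [affineFamily_zero]; exact hD.φ₁_pos
  have hφ₂0 : 0 < affineFamily D.φ₂ (fun j => (X j).ξ₂) 0 0 := by
    rw [affineFamily_zero]; exact hD.φ₂_pos
  filter_upwards [he.continuousAt.eventually_const_lt he0,
    hφ₁.continuousAt.eventually_const_lt hφ₁0, hφ₂.continuousAt.eventually_const_lt hφ₂0,
    eventually_bijective hdu.continuousAt (by rw [perturb_zero]; exact hD.bijective)]
    with t he hφ₁ hφ₂ hbij
  exact {
    smooth := hsD.perturb hX t
    c_ne := hD.c_ne
    e_gt := he
    g₁_zero := affineFamily_eq_zero hD.g₁_zero (fun j => (hX0 j).η₁) t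
    g₂_zero := affineFamily_eq_zero hD.g₂_zero (fun j => (hX0 j).η₂) t
    φ₁_pos := hφ₁
    φ₂_pos := hφ₂
    bijective := hbij }

theorem Good.eventually_isPotential_perturb (hD : D.Good) (hP : IsPotential D.fn)
    (hX : ∀ j, (X j).Smooth) (hX0 : ∀ j, (X j).Vanishing) :
    ∀ᶠ t in 𝓝 0, IsPotential (D.perturb X t).fn := by
  have hsD := hD.smooth
  obtain ⟨-, -, hB, hb, hdb⟩ :=
    eq_zero_of_fderiv_coordForm_eq_zero hsD.coeff₁ hsD.coeff₂ hsD.B hsD.b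
      (by rw [← fn_eq_coordForm, hP.zero]) (by rw [← fn_eq_coordForm, hP.fderiv_zero])
  have hinit : SmoothNear (Function.uncurry fun t w => initialPoint (D.perturb X t).fn w) (0, 0) :=
    smoothNear_id.snd.fst.prodMk
      ((hsD.uncurry_perturb_fn hX 0).uncurry_fderiv.clm grad).fst.neg
  filter_upwards [eventually_bijective hinit.uncurry_fderiv.apply_right.continuousAt
    (by rw [perturb_zero]; exact hP.bijective)] with t hbij
  have hbt : (D.perturb X t).b 0 = 0 := affineFamily_eq_zero hb (fun j => (hX0 j).b) t
  refine ⟨(hsD.perturb hX t).fn, by simp [NormalData.fn, hbt], ?_, hbij⟩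
  exact (hsD.perturb hX t).fderiv_fn_zero
    (affineFamily_eq_zero hD.g₁_zero (fun j => (hX0 j).η₁) t)
    (affineFamily_eq_zero hD.g₂_zero (fun j => (hX0 j).η₂) t)
    (affineFamily_eq_zero hB (fun j => (hX0 j).B) t)
    (fderiv_affineFamily_eq_zero hsD.b (fun j => (hX j).b) hdb (fun j => (hX0 j).fderiv_b) t)

/-- The second order remainder of the deformation of `D` in the direction `X`. -/
def remainder (D : NormalData) (X : TangentData) (s : ℝ) (w : Cot) : ℝ :=
  D.c w.2 * ((w.1 0 * X.ξ₁ w) ^ 2 + (w.1 0 * X.ξ₁ w) * (w.1 1 * X.ξ₂ w) +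
    w.1 1 ^ 2 * (D.e w.2 * X.ξ₂ w ^ 2 + 2 * (X.η₃ w.2 * X.ξ₂ w) + s * (X.η₃ w.2 * X.ξ₂ w ^ 2)) +
    w.1 0 * (X.η₁ w.2 * X.ξ₁ w) + w.1 1 * (X.η₂ w.2 * X.ξ₂ w))

theorem perturb_single_fn (hφ₁ : D.φ₁ = fun _ => 1) (hφ₂ : D.φ₂ = fun _ => 1) (s : ℝ) (j : Fin d) :
    (D.perturb X (s • Pi.single j 1)).fn = fun w =>
      (D.fn w + s • (X j).fn D.c D.g₁ D.g₂ D.e w) + s ^ 2 • D.remainder (X j) s w := by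
  ext w
  simp only [fn, perturb, affineFamily_single, hφ₁, hφ₂, TangentData.fn, remainder, smul_eq_mul]
  ring

theorem Smooth.uncurry_remainder (hD : D.Smooth) {X : TangentData} (hX : X.Smooth) (s : ℝ) :
    SmoothNear (Function.uncurry (D.remainder X)) (s, 0) := by
  have hsnd {f : Cot → ℝ} (hf : SmoothNear f 0) :
      SmoothNear (fun p : ℝ × Cot => f p.2) (s, 0) := hf.comp_of_eq smoothNear_id.snd rfl
  have := hsnd hD.c.comp_snd
  have := hsnd hD.e.comp_snd
  have := hsnd hX.η₁.comp_snd
  have := hsnd hX.η₂.comp_snd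
  have := hsnd hX.η₃.comp_snd
  have := hsnd hX.ξ₁
  have := hsnd hX.ξ₂
  unfold NormalData.remainder Function.uncurry
  fun_prop

theorem Good.eventually_exists_good (hD : D.Good) (hφ₁ : D.φ₁ = fun _ => 1)
    (hφ₂ : D.φ₂ = fun _ => 1) (hP : IsPotential D.fn) {n : ℕ} (hn : 1 ≤ n) :
    ∀ᶠ θ : potentialJets n in 𝓝 (hP.toJet n), ∃ D' : NormalData, D'.Good ∧ IsPotential D'.fn ∧
      jets n D'.fn = (θ : Jets n Cot ℝ) := by
  have hsD := hD.smooth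
  let β := Module.finBasis ℝ (potentialJets n)
  choose X hX hX0 hXβ using fun j => exists_tangentData_potential hsD.c hsD.g₁ hsD.g₂ hsD.e
    hD.c_ne hD.g₁_zero hD.g₂_zero hD.e_gt hn (β j)
  obtain ⟨π, hπ⟩ := Submodule.ClosedComplemented.of_finiteDimensional (potentialJets n)
  let Ψ (t : Fin (Module.finrank ℝ (potentialJets n)) → ℝ) : potentialJets n :=
    π (jets n (D.perturb X t).fn)
  have hπs {Θ : Type} [NormedAddCommGroup Θ] [NormedSpace ℝ Θ] {f : Θ → Jets n Cot ℝ} {t : Θ}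
      (hf : SmoothNear f t) : SmoothNear (fun t => π (f t)) t :=
    SmoothNear.clm (F := Jets n Cot ℝ) (G := potentialJets n) π hf
  have hΨ : SmoothNear Ψ 0 :=
    hπs (smoothNear_jets (hsD.uncurry_perturb_fn hX 0))
  have hΨ0 : Ψ 0 = hP.toJet n := by
    simp only [Ψ, perturb_zero]
    exact hπ (hP.toJet n)
  have hmap : map Ψ (𝓝 0) = 𝓝 (Ψ 0) := map_nhds_eq_of_expansion β hΨ fun j => by
    have hR := hsD.uncurry_remainder (hX j)
    have hXj := (smoothNear_potential (β j) 0).congr (hXβ j)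
    have hjet : jets n ((X j).fn D.c D.g₁ D.g₂ D.e) = (β j : Jets n Cot ℝ) :=
      (jets_eq_iff.2 (JetEq.of_eventuallyEq (hXβ j))).trans (jets_potential _)
    refine ⟨fun s => π (jets n (D.remainder (X j) s)), (hπs (smoothNear_jets (hR 0))).continuousAt,
      fun s => ?_⟩
    have hRs : SmoothNear (D.remainder (X j) s) 0 :=
      (hR s).eventually_apply_left.self_of_nhds
    simp only [Ψ]
    rw [perturb_single_fn hφ₁ hφ₂, perturb_zero,
      jets_add (hsD.fn.add ((smoothNear_const s).smul hXj)) ((smoothNear_const (s ^ 2)).smul hRs),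
      jets_add hsD.fn ((smoothNear_const s).smul hXj), jets_smul s hXj, jets_smul (s ^ 2) hRs,
      map_add, map_add, map_smul, map_smul, hjet, hπ]
  rw [← hΨ0, ← hmap, eventually_map]
  filter_upwards [hD.eventually_perturb hX hX0, hD.eventually_isPotential_perturb hP hX hX0]
    with t hgood hpot
  exact ⟨D.perturb X t, hgood, hpot, congrArg Subtype.val (hπ (hpot.toJet n)).symm⟩

end NormalData

end Openness

/-! ### Generating families -/

section CriticalSet

variable {k : ℕ} {F : Par k → ℝ} {S T : Cot → Cot} {σ : Finset (Fin 2)}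

/-- The points `(x, y, q)` with `x_σ = ∂F/∂x_{I₂ - σ} = ∂F/∂y = 0` and `x ≥ 0`, which parametrise
the Lagrangian set generated by `F` restricted to `x_σ = 0`. -/
def critSet (F : Par k → ℝ) (σ : Finset (Fin 2)) : Set (Par k) :=
  {z | (∀ i ∈ σ, z.1 i = 0) ∧ (∀ i ∉ σ, dx F i z = 0 ∧ 0 ≤ z.1 i) ∧ ∀ j, dy F j z = 0}

/-- The map `(x, y, q) ↦ (q, ∂F/∂q)`. -/
def lift (F : Par k → ℝ) (z : Par k) : Cot := (z.2.2, fun m => dq F m z)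

theorem mem_lagSet {U : Set (Par k)} {c : Cot} :
    c ∈ lagSet F σ U ↔ ∃ z, (z ∈ U ∧ z ∈ critSet F σ) ∧ lift F z = c := Iff.rfl

theorem apply_eq_sum_single {n : ℕ} (L : (Fin n → ℝ) →L[ℝ] ℝ) (u : Fin n → ℝ) :
    L u = ∑ i, u i * L (Pi.single i 1) := by
  conv_lhs => rw [← Finset.univ_sum_single u, map_sum]
  exact Finset.sum_congr rfl fun i _ => by
    rw [← smul_eq_mul, ← map_smul, ← Pi.single_smul', smul_eq_mul, mul_one]

theorem fderiv_apply_eq (F : Par k → ℝ) (z v : Par k) :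
    fderiv ℝ F z v = ∑ i, v.1 i * dx F i z + ∑ j, v.2.1 j * dy F j z + ∑ m, v.2.2 m * dq F m z := by
  have hx : fderiv ℝ F z (v.1, 0, 0) = ∑ i, v.1 i * dx F i z :=
    apply_eq_sum_single (fderiv ℝ F z ∘L .inl ℝ _ _) v.1
  have hy : fderiv ℝ F z (0, v.2.1, 0) = ∑ j, v.2.1 j * dy F j z :=
    apply_eq_sum_single (fderiv ℝ F z ∘L .inr ℝ _ _ ∘L .inl ℝ _ _) v.2.1
  have hq : fderiv ℝ F z (0, 0, v.2.2) = ∑ m, v.2.2 m * dq F m z :=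
    apply_eq_sum_single (fderiv ℝ F z ∘L .inr ℝ _ _ ∘L .inr ℝ _ _) v.2.2
  rw [← hx, ← hy, ← hq, ← map_add, ← map_add]
  simp

theorem fderiv_apply_base (F : Par k → ℝ) (z : Par k) (u : Base) :
    fderiv ℝ F z (0, 0, u) = ∑ m, u m * (lift F z).2 m := by
  simp [fderiv_apply_eq, lift]

/-- A tangent vector along the fibres of `(x, y, q) ↦ q` and along the face `x_σ = 0`. -/
def IsVertical (σ : Finset (Fin 2)) (v : Par k) : Prop := (∀ i ∈ σ, v.1 i = 0) ∧ v.2.2 = 0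

theorem mem_critSet_iff {z : Par k} : z ∈ critSet F σ ↔
    (∀ i ∈ σ, z.1 i = 0) ∧ (∀ i, 0 ≤ z.1 i) ∧ ∀ v, IsVertical σ v → fderiv ℝ F z v = 0 := by
  constructor
  · rintro ⟨hσ, hx, hy⟩
    refine ⟨hσ, fun i => ?_, fun v hv => ?_⟩
    · by_cases hi : i ∈ σ
      exacts [(hσ i hi).ge, (hx i hi).2]
    · have hvx : ∀ i, v.1 i * dx F i z = 0 := fun i => by
        by_cases hi : i ∈ σ
        · rw [hv.1 i hi, zero_mul]
        · rw [(hx i hi).1, mul_zero]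
      simp [fderiv_apply_eq, hv.2, hvx, hy]
  · rintro ⟨hσ, hpos, hv⟩
    refine ⟨hσ, fun i hi => ⟨hv _ ⟨fun j hj => ?_, rfl⟩, hpos i⟩,
      fun j => hv _ ⟨fun _ _ => rfl, rfl⟩⟩
    exact Pi.single_eq_of_ne (fun hji => hi (by rwa [← hji])) _

theorem smoothNear_lift {z : Par k} (hF : SmoothNear F z) : SmoothNear (lift F) z :=
  smoothNear_id.snd.snd.prodMk (smoothNear_pi.2 fun _ =>
    hF.fderiv.clm (ContinuousLinearMap.apply ℝ ℝ _))

theorem tendsto_params : Tendsto (fun z : Par k => z.2.2) (𝓝 0) (𝓝 0) :=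
  (continuous_snd.comp continuous_snd).tendsto (0 : Par k)

namespace IsGeneratingFamily

theorem smooth (h : IsGeneratingFamily F S) : SmoothNear F 0 := h.1

theorem tendsto_lift (h : IsGeneratingFamily F S) : Tendsto (lift F) (𝓝 0) (𝓝 0) :=
  (smoothNear_lift h.smooth).tendsto (Prod.ext rfl (funext fun _ => by simp [lift, dq, h.2.2.1]))

theorem mem_of_critSet (h : IsGeneratingFamily F S) (hT : Tendsto T (𝓝 0) (𝓝 0))
    (hST : ∀ᶠ z in 𝓝 0, S (T z) = z) (σ : Finset (Fin 2)) :
    ∀ᶠ z in 𝓝 0, z ∈ critSet F σ → T (lift F z) ∈ L0 σ := by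
  obtain ⟨U, hU, hlagSet⟩ := h.2.2.2.2 σ
  filter_upwards [h.tendsto_lift.eventually (hT.eventually (hlagSet U hU subset_rfl)),
    h.tendsto_lift.eventually hST, hU] with z hmem hSTz hzU hz
  rw [← hmem, hSTz]
  exact mem_lagSet.2 ⟨z, ⟨hzU, hz⟩, rfl⟩

theorem exists_critSet (h : IsGeneratingFamily F S) (σ : Finset (Fin 2)) {U : Set (Par k)}
    (hU : U ∈ 𝓝 0) : ∀ᶠ ζ in 𝓝 0, ζ ∈ L0 σ → ∃ z ∈ U, z ∈ critSet F σ ∧ lift F z = S ζ := by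
  obtain ⟨U₀, hU₀, hlagSet⟩ := h.2.2.2.2 σ
  filter_upwards [hlagSet (U ∩ U₀) (inter_mem hU hU₀) Set.inter_subset_right] with ζ hmem hζ
  obtain ⟨z, ⟨hzU, hz⟩, hlift⟩ := mem_lagSet.1 (hmem.2 hζ)
  exact ⟨z, hzU.1, hz, hlift⟩

theorem exists_critSet_of_critSet {k' : ℕ} {F' : Par k' → ℝ} (hS : IsSymplecticGerm S)
    (h : IsGeneratingFamily F S) (h' : IsGeneratingFamily F' S) (σ : Finset (Fin 2))
    {U : Set (Par k')} (hU : U ∈ 𝓝 0) :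
    ∀ᶠ z in 𝓝 0, z ∈ critSet F σ → ∃ w ∈ U, w ∈ critSet F' σ ∧ lift F' w = lift F z := by
  obtain ⟨T, hT, -, hST⟩ := hS.exists_inverse
  filter_upwards [h.mem_of_critSet hT.tendsto hST σ, h.tendsto_lift.eventually hST,
    h.tendsto_lift.eventually (hT.tendsto.eventually (h'.exists_critSet σ hU))]
    with z hmem hSTz hex hz
  simpa only [hSTz] using hex (hmem hz)

end IsGeneratingFamily

end CriticalSet

section Embed

/-- The inclusion of the parameter space of a family without `y`-variables as `{q₃ = 0}`: a
generating function `A(q, Q)` is a generating family in `x = (q₁, q₂)` with parameters `Q`. -/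
def embed : Par 0 →L[ℝ] Cot :=
  (ContinuousLinearMap.pi ![.proj 0 ∘L .fst ℝ _ _, .proj 1 ∘L .fst ℝ _ _, 0]).prod
    (.snd ℝ _ _ ∘L .snd ℝ _ _)

theorem embed_fst_castSucc (z : Par 0) (i : Fin 2) : (embed z).1 i.castSucc = z.1 i := by
  fin_cases i <;> rfl

theorem embed_fst_two (z : Par 0) : (embed z).1 2 = 0 := rfl

theorem embed_snd (z : Par 0) : (embed z).2 = z.2.2 := rfl

theorem embed_eq {z : Par 0} {w : Cot} (hx : ∀ i : Fin 2, z.1 i = w.1 i.castSucc)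
    (h₂ : w.1 2 = 0) (hq : z.2.2 = w.2) : embed z = w := by
  refine Prod.ext (funext fun i => ?_) hq
  fin_cases i
  exacts [hx 0, hx 1, h₂.symm]

theorem smoothNear_embed {z : Par 0} : SmoothNear embed z := smoothNear_of_contDiff embed.contDiff z

theorem tendsto_embed : Tendsto embed (𝓝 0) (𝓝 0) := smoothNear_embed.tendsto (map_zero _)

variable {A : Cot → ℝ} {S : Cot → Cot} {z : Par 0} {σ : Finset (Fin 2)}

theorem fderiv_comp_embed (hA : DifferentiableAt ℝ A (embed z)) (v : Par 0) :
    fderiv ℝ (fun z => A (embed z)) z v = fderiv ℝ A (embed z) (embed v) :=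
  DFunLike.congr_fun (hA.hasFDerivAt.comp z embed.hasFDerivAt).fderiv v

theorem dx_comp_embed (hA : DifferentiableAt ℝ A (embed z)) (i : Fin 2) :
    dx (fun z => A (embed z)) i z = (grad (fderiv ℝ A (embed z))).1 i.castSucc := by
  have h : embed (Pi.single i 1, 0, 0) = (Pi.single i.castSucc 1, 0) :=
    embed_eq (fun j => by simp [Pi.single_apply]) (by fin_cases i <;> simp) rfl
  rw [dx, fderiv_comp_embed hA, grad_fst, h]

theorem lift_comp_embed (hA : DifferentiableAt ℝ A (embed z)) :
    lift (fun z => A (embed z)) z = finalPoint A (embed z) := by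
  have h (m : Fin 3) : embed (0, 0, Pi.single m 1) = (0, Pi.single m 1) :=
    embed_eq (fun _ => rfl) rfl rfl
  refine Prod.ext rfl (funext fun m => ?_)
  change fderiv ℝ (fun z => A (embed z)) z _ = (grad (fderiv ℝ A (embed z))).2 m
  rw [fderiv_comp_embed hA, grad_snd, h]

theorem initialPoint_embed_mem_L0 (hA : DifferentiableAt ℝ A (embed z)) :
    initialPoint A (embed z) ∈ L0 σ ↔ z ∈ critSet (fun z => A (embed z)) σ := by
  simp only [initialPoint, L0, critSet, Set.mem_ofPred_eq, embed_fst_castSucc, dx_comp_embed hA,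
    embed_fst_two, Pi.neg_apply, neg_eq_zero, and_true, IsEmpty.forall_iff]

/-- The components of a covector that occur in the nondegeneracy condition for families without
`y`-variables. -/
def faceCoords : Cot →L[ℝ] (Fin 2 → ℝ) × (Fin 2 → ℝ) × (Fin 0 → ℝ) :=
  let restrict : (Fin 3 → ℝ) →L[ℝ] Fin 2 → ℝ := .pi fun i => .proj i.castSucc
  (restrict ∘L .fst ℝ _ _).prod ((-restrict ∘L .snd ℝ _ _).prod 0)

theorem IsPotential.nondegenerate (hA : IsPotential A) :
    Nondegenerate (fun z => A (embed z)) := by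
  have hcoords : (fun z : Par 0 => ((z.1, fun i => dx (fun z => A (embed z)) i z,
      fun j => dy (fun z => A (embed z)) j z) : (Fin 2 → ℝ) × (Fin 2 → ℝ) × (Fin 0 → ℝ))) =ᶠ[𝓝 0]
      fun z => faceCoords (initialPoint A (embed z)) := by
    filter_upwards [tendsto_embed.eventually hA.smooth.eventually_differentiableAt] with z hz
    refine Prod.ext (funext fun i => (embed_fst_castSucc z i).symm)
      (Prod.ext (funext fun i => ?_) (Subsingleton.elim _ _))
    exact (dx_comp_embed hz i).trans (neg_neg _).symm
  have hderiv : HasFDerivAt (fun z : Par 0 => faceCoords (initialPoint A (embed z)))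
      (faceCoords ∘L fderiv ℝ (initialPoint A) 0 ∘L embed) 0 := by
    have hinit : HasFDerivAt (initialPoint A) (fderiv ℝ (initialPoint A) 0) (embed 0) := by
      rw [map_zero]
      exact (smoothNear_initialPoint hA.smooth).differentiableAt.hasFDerivAt
    exact faceCoords.hasFDerivAt.comp (0 : Par 0) (hinit.comp (0 : Par 0) embed.hasFDerivAt)
  rw [Nondegenerate, hcoords.fderiv_eq, hderiv.fderiv]
  rintro ⟨r, s, t⟩
  obtain ⟨u, hu⟩ := hA.bijective.2 (![r 0, r 1, 0], ![-s 0, -s 1, 0])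
  have hfst : u.1 = ![r 0, r 1, 0] := by
    rw [fderiv_initialPoint hA.smooth] at hu
    exact congrArg Prod.fst hu
  have hembed : embed (r, 0, u.2) = u :=
    embed_eq (fun i => by rw [hfst]; fin_cases i <;> rfl) (by rw [hfst]; rfl) rfl
  refine ⟨(r, 0, u.2), ?_⟩
  change faceCoords (fderiv ℝ (initialPoint A) 0 (embed (r, 0, u.2))) = _
  rw [hembed, hu]
  refine Prod.ext (funext fun i => ?_) (Prod.ext (funext fun i => ?_) (Subsingleton.elim _ _)) <;>
    fin_cases i <;> simp [faceCoords]

theorem IsPotential.exists_embed_eq (hA : IsPotential A) :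
    ∃ ε : Cot → Par 0, Tendsto ε (𝓝 0) (𝓝 0) ∧
      ∀ᶠ z in 𝓝 0, z ∈ L0 σ → initialPoint A (embed (ε z)) = z := by
  obtain ⟨κ, hκ, hκ0, -, hinv⟩ := hA.exists_inverse
  refine ⟨fun z => (fun i => z.1 i.castSucc, 0, (κ z).2), ?_, hinv.mono fun z hz hzσ => ?_⟩
  · have hε : SmoothNear (fun z : Cot => ((fun i => z.1 i.castSucc, 0, (κ z).2) : Par 0)) 0 :=
      (smoothNear_pi.2 fun i : Fin 2 => smoothNear_coord i.castSucc 0).prodMk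
        ((smoothNear_const (0 : Fin 0 → ℝ)).prodMk hκ.snd)
    exact hε.tendsto (by simp only [hκ0]; rfl)
  · have hfst : (initialPoint A (κ z)).1 = z.1 := congrArg Prod.fst hz
    rw [embed_eq (w := κ z) (fun i => congrFun hfst.symm _)
      ((congrFun hfst 2).trans hzσ.2.2) rfl, hz]

theorem IsGen.isGeneratingFamily (hA : IsPotential A) (hS : IsSymplecticGerm S)
    (h : IsGen A S) : IsGeneratingFamily (fun z => A (embed z)) S := by
  obtain ⟨T, -, hTS, -⟩ := hS.exists_inverse
  refine ⟨hA.smooth.comp_of_eq smoothNear_embed (map_zero _), ?_, ?_, hA.nondegenerate,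
    fun σ => ?_⟩
  · simp only [map_zero, hA.zero]
  · refine ContinuousLinearMap.ext fun v => ?_
    rw [fderiv_comp_embed (by rw [map_zero]; exact hA.smooth.differentiableAt), map_zero,
      hA.fderiv_zero]
    rfl
  refine ⟨{w | DifferentiableAt ℝ A (embed w) ∧
      S (initialPoint A (embed w)) = finalPoint A (embed w) ∧
      T (S (initialPoint A (embed w))) = initialPoint A (embed w)},
    (tendsto_embed.eventually hA.smooth.eventually_differentiableAt).and
      ((tendsto_embed.eventually h).and
        ((hA.tendsto_initialPoint.comp tendsto_embed).eventually hTS)), fun U hU hU₀ => ?_⟩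
  have hlift : ∀ w ∈ U, lift (fun z => A (embed z)) w = S (initialPoint A (embed w)) :=
    fun w hw => (lift_comp_embed (hU₀ hw).1).trans (hU₀ hw).2.1.symm
  obtain ⟨ε, hε, hεA⟩ := hA.exists_embed_eq (σ := σ)
  filter_upwards [hTS, hεA, hε.eventually hU] with z hTz hz hεU
  rw [mem_lagSet]
  constructor
  · rintro ⟨w, ⟨hwU, hw⟩, hwz⟩
    have hzw : initialPoint A (embed w) = z := by
      rw [← (hU₀ hwU).2.2, ← hlift w hwU, hwz, hTz]
    rwa [← hzw, initialPoint_embed_mem_L0 (hU₀ hwU).1]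
  · intro hzσ
    refine ⟨ε z, ⟨hεU, ?_⟩, by rw [hlift _ hεU, hz hzσ]⟩
    rwa [← initialPoint_embed_mem_L0 (hU₀ hεU).1, hz hzσ]

end Embed

section PCEquivalence

variable {k : ℕ} {φ₁ : Par k → Fin 2 → ℝ} {φ₂ : Par k → Fin k → ℝ} {g : Base → Base}
  {a b : Base → ℝ} {F G : Par k → ℝ} {z : Par k}

/-- The map `(x, y, q) ↦ (x₁φ₁₁, x₂φ₁₂, φ₂, g(q))` of the corner. -/
def cornerMap (φ₁ : Par k → Fin 2 → ℝ) (φ₂ : Par k → Fin k → ℝ) (g : Base → Base) (z : Par k) :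
    Par k :=
  (fun i => z.1 i * φ₁ z i, φ₂ z, g z.2.2)

/-- `PCEquiv F G` with given data. -/
structure PCEquivOver (φ₁ : Par k → Fin 2 → ℝ) (φ₂ : Par k → Fin k → ℝ) (g : Base → Base)
    (a b : Base → ℝ) (F G : Par k → ℝ) : Prop where
  smooth_φ₁ : SmoothNear φ₁ 0
  smooth_φ₂ : SmoothNear φ₂ 0
  smooth_g : SmoothNear g 0
  smooth_a : SmoothNear a 0
  smooth_b : SmoothNear b 0
  φ₁_pos : ∀ i, 0 < φ₁ 0 i
  φ₂_zero : φ₂ 0 = 0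
  g_zero : g 0 = 0
  a_ne : a 0 ≠ 0
  bijective : Function.Bijective (fderiv ℝ (cornerMap φ₁ φ₂ g) 0)
  eq_on_corner : ∀ᶠ z in 𝓝 0, (∀ i, 0 ≤ z.1 i) →
    G z = a z.2.2 * F (cornerMap φ₁ φ₂ g z) + b z.2.2

theorem pcEquiv_iff : PCEquiv F G ↔ ∃ φ₁ φ₂ g a b, PCEquivOver φ₁ φ₂ g a b F G := by
  constructor
  · rintro ⟨φ₁, φ₂, g, a, b, Φ, h₁, h₂, hg, ha, hb, hφ₁, hφ₂, hg0, ha0, hΦ, hbij, heq⟩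
    obtain rfl : Φ = cornerMap φ₁ φ₂ g := funext hΦ
    exact ⟨φ₁, φ₂, g, a, b, h₁, h₂, hg, ha, hb, hφ₁, hφ₂, hg0, ha0, hbij, heq⟩
  · rintro ⟨φ₁, φ₂, g, a, b, h₁, h₂, hg, ha, hb, hφ₁, hφ₂, hg0, ha0, hbij, heq⟩
    exact ⟨φ₁, φ₂, g, a, b, cornerMap φ₁ φ₂ g, h₁, h₂, hg, ha, hb, hφ₁, hφ₂, hg0, ha0,
      fun _ => rfl, hbij, heq⟩

theorem smoothNear_cornerMap (h₁ : SmoothNear φ₁ z) (h₂ : SmoothNear φ₂ z)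
    (hg : SmoothNear g z.2.2) : SmoothNear (cornerMap φ₁ φ₂ g) z :=
  (smoothNear_pi.2 fun i => (smoothNear_pi.1 smoothNear_id.fst i).mul (smoothNear_pi.1 h₁ i)).prodMk
    (h₂.prodMk (hg.comp_of_eq smoothNear_id.snd.snd rfl))

theorem hasFDerivAt_params (z : Par k) :
    HasFDerivAt (fun z : Par k => z.2.2) (.snd ℝ _ _ ∘L .snd ℝ _ _) z :=
  hasFDerivAt_snd.comp z hasFDerivAt_snd

theorem fderiv_cornerMap_params (h : DifferentiableAt ℝ (cornerMap φ₁ φ₂ g) z)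
    (hg : DifferentiableAt ℝ g z.2.2) (v : Par k) :
    (fderiv ℝ (cornerMap φ₁ φ₂ g) z v).2.2 = fderiv ℝ g z.2.2 v.2.2 :=
  have hcomp : HasFDerivAt (fun z : Par k => g z.2.2) _ z :=
    hg.hasFDerivAt.comp z (hasFDerivAt_params z)
  DFunLike.congr_fun (h.hasFDerivAt.snd.snd.unique hcomp) v

theorem fderiv_cornerMap_fst (h : DifferentiableAt ℝ (cornerMap φ₁ φ₂ g) z)
    (h₁ : DifferentiableAt ℝ φ₁ z) {i : Fin 2} (hi : z.1 i = 0) (v : Par k) :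
    (fderiv ℝ (cornerMap φ₁ φ₂ g) z v).1 i = v.1 i * φ₁ z i := by
  have hx : HasFDerivAt (fun z : Par k => z.1 i) (.proj i ∘L .fst ℝ _ _) z :=
    hasFDerivAt_pi'.1 hasFDerivAt_fst i
  have hprod := hx.mul (hasFDerivAt_pi'.1 h₁.hasFDerivAt i)
  refine (DFunLike.congr_fun ((hasFDerivAt_pi'.1 h.hasFDerivAt.fst i).unique hprod) v).trans ?_
  simp [hi, mul_comm]

theorem NormalData.Good.pcEquivOver {D : NormalData} (hD : D.Good) :
    PCEquivOver (fun z => ![D.φ₁ (embed z), D.φ₂ (embed z)]) (fun _ => 0)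
      (fun Q => D.unfolding Q - ![0, 0, D.e 0]) D.c D.b (Fa (D.e 0)) fun z => D.fn (embed z) := by
  have sD := hD.smooth
  have hφ : SmoothNear (fun z : Par 0 => ![D.φ₁ (embed z), D.φ₂ (embed z)]) 0 :=
    smoothNear_pi.2 <| Fin.forall_fin_two.2 ⟨sD.φ₁.comp_of_eq smoothNear_embed (map_zero _),
      sD.φ₂.comp_of_eq smoothNear_embed (map_zero _)⟩
  have hg : SmoothNear (fun Q => D.unfolding Q - ![0, 0, D.e 0]) 0 :=
    sD.unfolding.sub (smoothNear_const _)
  have hφpos : ∀ i, 0 < (![D.φ₁ (embed 0), D.φ₂ (embed 0)] : Fin 2 → ℝ) i :=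
    Fin.forall_fin_two.2 ⟨by simpa using hD.φ₁_pos, by simpa using hD.φ₂_pos⟩
  refine ⟨hφ, smoothNear_const _, hg, sD.c, sD.b, hφpos, rfl, ?_, hD.c_ne, ?_, .of_forall ?_⟩
  · ext i
    fin_cases i <;> simp [NormalData.unfolding, hD.g₁_zero, hD.g₂_zero]
  · have hΦ := (smoothNear_cornerMap (z := (0 : Par 0)) (φ₂ := fun _ => 0) hφ (smoothNear_const _)
      hg).differentiableAt
    have hinj : Function.Injective (fderiv ℝ (cornerMap
        (fun z => ![D.φ₁ (embed z), D.φ₂ (embed z)]) (fun _ => 0)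
        fun Q => D.unfolding Q - ![0, 0, D.e 0]) (0 : Par 0)) := by
      refine (injective_iff_map_eq_zero _).2 fun v hv => ?_
      have hbase := fderiv_cornerMap_params hΦ hg.differentiableAt v
      rw [hv, fderiv_sub_const] at hbase
      refine Prod.ext (funext fun i => ?_) (Prod.ext (Subsingleton.elim _ _) ?_)
      · have hface := fderiv_cornerMap_fst hΦ hφ.differentiableAt (i := i) rfl v
        rw [hv] at hface
        exact (mul_eq_zero_iff_right (hφpos i).ne').1 hface.symm
      · exact (map_eq_zero_iff _ hD.bijective.1).1 hbase.symm
    exact ⟨hinj, LinearMap.injective_iff_surjective.1 hinj⟩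
  · intro z _
    simp only [Fa, cornerMap, NormalData.fn, NormalData.unfolding, embed_fst_two, embed_snd,
      show (embed z).1 0 = z.1 0 from rfl, show (embed z).1 1 = z.1 1 from rfl, Pi.sub_apply,
      Matrix.cons_val_zero, Matrix.cons_val_one, Matrix.cons_val]
    ring

end PCEquivalence

/-! ### Critical values -/

section Path

variable {E F : Type*} [NormedAddCommGroup E] [NormedSpace ℝ E] [FiniteDimensional ℝ E]
  [NormedAddCommGroup F] [NormedSpace ℝ F] [FiniteDimensional ℝ F]

-- Complete `N` to a chart by a projection onto the kernel of its differential, and follow a ray.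
theorem SmoothNear.eventually_exists_path {N : E → F} (hN : SmoothNear N 0) (hN0 : N 0 = 0)
    (hsurj : Function.Surjective (fderiv ℝ N 0)) {P : E → Prop} (hP : ∀ᶠ z in 𝓝 0, P z) :
    ∀ᶠ z in 𝓝 0, ∃ γ : ℝ → E, γ 0 = 0 ∧ γ 1 = z ∧
      ∀ t ∈ Set.Icc (0 : ℝ) 1, DifferentiableAt ℝ γ t ∧ N (γ t) = t • N z ∧ P (γ t) := by
  have := FiniteDimensional.complete ℝ E
  have := FiniteDimensional.complete ℝ F
  obtain ⟨π, hπ⟩ := Submodule.ClosedComplemented.of_finiteDimensional (fderiv ℝ N 0).ker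
  let Ξ : E → F × (fderiv ℝ N 0).ker := fun z => (N z, π z)
  have hΞ : SmoothNear Ξ 0 := hN.prodMk (smoothNear_of_contDiff π.contDiff 0)
  have hΞ0 : Ξ 0 = 0 := Prod.ext hN0 (map_zero π)
  have hbij : Function.Bijective (fderiv ℝ Ξ 0) := by
    rw [(hN.differentiableAt.hasFDerivAt.prodMk π.hasFDerivAt).fderiv]
    exact (ContinuousLinearMap.equivProdOfSurjectiveOfIsCompl _ _ (LinearMap.range_eq_top.2 hsurj)
      (LinearMap.range_eq_of_proj hπ) (LinearMap.isCompl_of_proj hπ)).bijective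
  obtain ⟨Λ, hΛ, hΛ0, hΛΞ, hΞΛ⟩ := hΞ.exists_inverse hΞ0 hbij
  obtain ⟨ε, hε, hball⟩ := Metric.eventually_nhds_iff_ball.1
    (hΛ.eventually_differentiableAt.and (hΞΛ.and ((hΛ.tendsto hΛ0).eventually hP)))
  filter_upwards [hΛΞ, (hΞ.tendsto hΞ0).eventually (Metric.ball_mem_nhds 0 hε)] with z hz hzε
  refine ⟨fun t => Λ (t • Ξ z), by simp only [zero_smul, hΛ0], by simp only [one_smul, hz],
    fun t ht => ?_⟩
  have hmem : t • Ξ z ∈ Metric.ball 0 ε := by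
    rw [dist_zero_right] at hzε
    rw [mem_ball_zero_iff, norm_smul, Real.norm_of_nonneg ht.1]
    exact (mul_le_of_le_one_left (norm_nonneg _) ht.2).trans_lt hzε
  obtain ⟨hdiff, hright, hPt⟩ := hball _ hmem
  exact ⟨hdiff.comp t (differentiableAt_id.smul_const (Ξ z)), congrArg Prod.fst hright, hPt⟩

end Path

section CriticalValue

variable {k : ℕ} {F : Par k → ℝ} {S : Cot → Cot} {σ : Finset (Fin 2)} {a t : ℝ}

/-- The map `(x, ∂F/∂x, ∂F/∂y)`, a submersion at `0` when `F` is non-degenerate; the sets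
`critSet F σ` are its preimages of cones. -/
def criticalMap (F : Par k → ℝ) (z : Par k) : (Fin 2 → ℝ) × (Fin 2 → ℝ) × (Fin k → ℝ) :=
  (z.1, fun i => dx F i z, fun j => dy F j z)

theorem smoothNear_criticalMap {z : Par k} (hF : SmoothNear F z) :
    SmoothNear (criticalMap F) z :=
  have hpartial (v : Par k) : SmoothNear (fun z => fderiv ℝ F z v) z :=
    hF.fderiv.clm (ContinuousLinearMap.apply ℝ ℝ v)
  smoothNear_id.fst.prodMk
    ((smoothNear_pi.2 fun _ => hpartial _).prodMk (smoothNear_pi.2 fun _ => hpartial _))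

theorem criticalMap_zero (hF : fderiv ℝ F 0 = 0) : criticalMap F 0 = 0 := by
  refine Prod.ext rfl (Prod.ext (funext fun i => ?_) (funext fun j => ?_)) <;>
    simp [criticalMap, dx, dy, hF]

theorem mem_critSet_of_criticalMap_eq_smul {z w : Par k} (ht : 0 ≤ t)
    (h : criticalMap F w = t • criticalMap F z) (hz : z ∈ critSet F σ) : w ∈ critSet F σ := by
  obtain ⟨hσ, hx, hy⟩ := hz
  have hw : w.1 = t • z.1 := congrArg Prod.fst h
  have hdx (i : Fin 2) : dx F i w = t * dx F i z := congrFun (congrArg (fun p => p.2.1) h) i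
  have hdy (j : Fin k) : dy F j w = t * dy F j z := congrFun (congrArg (fun p => p.2.2) h) j
  refine ⟨fun i hi => ?_, fun i hi => ⟨?_, ?_⟩, fun j => ?_⟩
  · rw [hw, Pi.smul_apply, hσ i hi, smul_zero]
  · rw [hdx, (hx i hi).1, mul_zero]
  · rw [hw]
    exact mul_nonneg ht (hx i hi).2
  · rw [hdy, hy, mul_zero]

theorem hasDerivAt_comp_of_eventually_mem_critSet {γ : ℝ → Par k} {γ' : Par k}
    (hF : DifferentiableAt ℝ F (γ t)) (hγ : HasDerivAt γ γ' t)
    (hcrit : ∀ᶠ s in 𝓝 t, γ s ∈ critSet F σ) :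
    HasDerivAt (fun s => F (γ s)) (∑ m, γ'.2.2 m * (lift F (γ t)).2 m) t := by
  have hface : ∀ i ∈ σ, γ'.1 i = 0 := fun i hi =>
    (hasDerivAt_pi.1 hγ.fst i).unique <| (hasDerivAt_const t (0 : ℝ)).congr_of_eventuallyEq <|
      hcrit.mono fun s hs => hs.1 i hi
  have hvert : fderiv ℝ F (γ t) (γ' - (0, 0, γ'.2.2)) = 0 :=
    (mem_critSet_iff.1 hcrit.self_of_nhds).2.2 _ ⟨fun i hi => by simp [hface i hi], by simp⟩
  rw [map_sub, sub_eq_zero, fderiv_apply_base] at hvert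
  exact hvert ▸ hF.hasFDerivAt.comp_hasDerivAt t hγ

/-- The equations of the Lagrangian set generated by `F_a` restricted to `x_σ = 0`, obtained by
eliminating `x` from `p = (x₁, x₂, x₂²)`. -/
def lagEquations (a : ℝ) (σ : Finset (Fin 2)) : Set Cot :=
  {c | (0 ∈ σ ∧ c.2 0 = 0 ∨ 0 ∉ σ ∧ 2 * c.2 0 + c.2 1 + c.1 0 = 0) ∧
    (1 ∈ σ ∧ c.2 1 = 0 ∨ 1 ∉ σ ∧ c.2 0 + 2 * (a + c.1 2) * c.2 1 + c.1 1 = 0) ∧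
    c.2 2 = c.2 1 ^ 2}

theorem hasFDerivAt_Fa (a : ℝ) (z : Par 0) : ∃ L : Par 0 →L[ℝ] ℝ, HasFDerivAt (Fa a) L z ∧
    ∀ v, L v = (2 * z.1 0 + z.1 1 + z.2.2 0) * v.1 0 +
      (z.1 0 + 2 * (a + z.2.2 2) * z.1 1 + z.2.2 1) * v.1 1 +
      (z.1 0 * v.2.2 0 + z.1 1 * v.2.2 1 + z.1 1 ^ 2 * v.2.2 2) := by
  have hx (i : Fin 2) := ((ContinuousLinearMap.proj (R := ℝ) (φ := fun _ : Fin 2 => ℝ) i) ∘L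
    (.fst ℝ _ ((Fin 0 → ℝ) × (Fin 3 → ℝ)))).hasFDerivAt (x := z)
  have hq (i : Fin 3) := ((ContinuousLinearMap.proj (R := ℝ) (φ := fun _ : Fin 3 => ℝ) i) ∘L
    (.snd ℝ (Fin 0 → ℝ) _) ∘L (.snd ℝ (Fin 2 → ℝ) _)).hasFDerivAt (x := z)
  refine ⟨_, (((((hx 0).pow 2).add ((hx 0).mul (hx 1))).add (((hx 1).pow 2).const_mul a)).add
    ((hq 0).mul (hx 0))).add ((hq 1).mul (hx 1)) |>.add ((hq 2).mul ((hx 1).pow 2)), fun v => ?_⟩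
  simp
  ring

theorem lift_Fa_mem_lagEquations {z : Par 0} (hz : z ∈ critSet (Fa a) σ) :
    lift (Fa a) z ∈ lagEquations a σ := by
  obtain ⟨L, hL, hLv⟩ := hasFDerivAt_Fa a z
  obtain ⟨hσ, hx, -⟩ := hz
  simp only [dx, hL.fderiv, hLv] at hx
  have hlift : lift (Fa a) z = (z.2.2, ![z.1 0, z.1 1, z.1 1 ^ 2]) := by
    refine Prod.ext rfl (funext fun m => ?_)
    fin_cases m <;> simp [lift, dq, hL.fderiv, hLv]
  rw [hlift]
  refine ⟨?_, ?_, rfl⟩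
  · by_cases hi : 0 ∈ σ
    · exact .inl ⟨hi, hσ 0 hi⟩
    · exact .inr ⟨hi, by simpa using (hx 0 hi).1⟩
  · by_cases hi : 1 ∈ σ
    · exact .inl ⟨hi, hσ 1 hi⟩
    · exact .inr ⟨hi, by simpa using (hx 1 hi).1⟩

theorem mul_eq_mul_of_eventually_eq_zero {f g : ℝ → ℝ} {f' g' : ℝ}
    (hf : HasDerivAt f f' t) (hg : HasDerivAt g g' t)
    (h : (∀ᶠ s in 𝓝 t, f s = 0) ∨ ∀ᶠ s in 𝓝 t, g s = 0) : f t * g' = f' * g t := by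
  rcases h with h | h
  · rw [h.self_of_nhds, hf.unique ((hasDerivAt_const t (0 : ℝ)).congr_of_eventuallyEq h)]
    ring
  · rw [h.self_of_nhds, hg.unique ((hasDerivAt_const t (0 : ℝ)).congr_of_eventuallyEq h)]
    ring

theorem hasDerivAt_of_eventually_mem_lagEquations {c : ℝ → Cot} {c' : Cot}
    (hc : HasDerivAt c c' t) (hmem : ∀ᶠ s in 𝓝 t, c s ∈ lagEquations a σ) :
    HasDerivAt (fun s => ((c s).1 0 * (c s).2 0 + (c s).1 1 * (c s).2 1) / 2)
      (∑ m, c'.1 m * (c t).2 m) t := by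
  have hq := hasDerivAt_pi.1 hc.fst
  have hp := hasDerivAt_pi.1 hc.snd
  have hface₀ := mul_eq_mul_of_eventually_eq_zero (hp 0)
    ((((hp 0).const_mul 2).add (hp 1)).add (hq 0)) <| by
      by_cases h : 0 ∈ σ
      exacts [.inl (hmem.mono fun s hs => by simpa [h] using hs.1),
        .inr (hmem.mono fun s hs => by simpa [h] using hs.1)]
  have hface₁ := mul_eq_mul_of_eventually_eq_zero (hp 1)
    (((hp 0).add ((((hq 2).const_add a).const_mul 2).mul (hp 1))).add (hq 1)) <| by
      by_cases h : 1 ∈ σ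
      exacts [.inl (hmem.mono fun s hs => by simpa [h] using hs.2.1),
        .inr (hmem.mono fun s hs => by simpa [h] using hs.2.1)]
  refine ((((hq 0).mul (hp 0)).add ((hq 1).mul (hp 1))).div_const 2).congr_deriv ?_
  have hp₂ : (c t).2 2 = (c t).2 1 ^ 2 := hmem.self_of_nhds.2.2
  simp only [Pi.add_apply, Pi.mul_apply] at hface₀ hface₁
  rw [Fin.sum_univ_three, hp₂]
  linear_combination -(hface₀ + hface₁) / 2

-- Both sides vanish at `0` and have the same derivative along critical paths issuing from `0`.
theorem IsGeneratingFamily.critical_value (hS : IsSymplecticGerm S) (h : IsGeneratingFamily F S)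
    (ha : IsGeneratingFamily (Fa a) S) (σ : Finset (Fin 2)) :
    ∀ᶠ z in 𝓝 0, z ∈ critSet F σ →
      F z = ((lift F z).1 0 * (lift F z).2 0 + (lift F z).1 1 * (lift F z).2 1) / 2 := by
  have hlag : ∀ᶠ z in 𝓝 0, z ∈ critSet F σ → lift F z ∈ lagEquations a σ :=
    (h.exists_critSet_of_critSet hS ha σ univ_mem).mono fun z hz hcrit => by
      obtain ⟨w, -, hw, hlift⟩ := hz hcrit
      exact hlift ▸ lift_Fa_mem_lagEquations hw
  filter_upwards [(smoothNear_criticalMap h.smooth).eventually_exists_path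
    (criticalMap_zero h.2.2.1) h.2.2.2.1 (h.smooth.eventually.and hlag)] with z ⟨γ, hγ0, hγ1, hγ⟩ hz
  let V : Cot → ℝ := fun c => (c.1 0 * c.2 0 + c.1 1 * c.2 1) / 2
  have hcrit : ∀ t ∈ Set.Icc (0 : ℝ) 1, γ t ∈ critSet F σ := fun t ht =>
    mem_critSet_of_criticalMap_eq_smul ht.1 (hγ t ht).2.1 hz
  have hFγ : ∀ t ∈ Set.Icc (0 : ℝ) 1, DifferentiableAt ℝ (fun s => F (γ s)) t := fun t ht =>
    (hγ t ht).2.2.1.differentiableAt.comp t (hγ t ht).1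
  have hliftγ : ∀ t ∈ Set.Icc (0 : ℝ) 1, DifferentiableAt ℝ (fun s => lift F (γ s)) t :=
    fun t ht => (smoothNear_lift (hγ t ht).2.2.1).differentiableAt.comp t (hγ t ht).1
  have hcont : ContinuousOn (fun t => F (γ t) - V (lift F (γ t))) (Set.Icc 0 1) := fun t ht => by
    have hlift := (hliftγ t ht).continuousAt
    exact ((hFγ t ht).continuousAt.sub (by fun_prop)).continuousWithinAt
  have hderiv : ∀ t ∈ Set.Ioo (0 : ℝ) 1, HasDerivAt (fun t => F (γ t) - V (lift F (γ t))) 0 t := by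
    intro t ht
    have hnear : ∀ᶠ s in 𝓝 t, s ∈ Set.Icc (0 : ℝ) 1 := Icc_mem_nhds ht.1 ht.2
    have ht' := hnear.self_of_nhds
    have hγ' := (hγ t ht').1.hasDerivAt
    have hlift' := (hliftγ t ht').hasDerivAt
    have hq' := HasDerivAt.unique hγ'.snd.snd hlift'.fst
    have hFt := hasDerivAt_comp_of_eventually_mem_critSet (hγ t ht').2.2.1.differentiableAt hγ'
      (hnear.mono hcrit)
    rw [hq'] at hFt
    exact (hFt.sub (hasDerivAt_of_eventually_mem_lagEquations hlift'
      (hnear.mono fun s hs => (hγ s hs).2.2.2 (hcrit s hs)))).congr_deriv (sub_self _)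
  obtain ⟨-, -, hslope⟩ := exists_hasDerivAt_eq_slope _ _ zero_lt_one hcont hderiv
  have hlift0 : lift F 0 = 0 := Prod.ext rfl (funext fun _ => by simp [lift, dq, h.2.2.1])
  have hV0 : V 0 = 0 := by simp [V]
  simp only [hγ0, hγ1, h.2.1, hlift0, hV0, sub_self, sub_zero, div_one] at hslope
  exact sub_eq_zero.1 hslope.symm

end CriticalValue

/-! ### Equivalent generating families -/

section Transport

variable {k k' : ℕ} {F G : Par k → ℝ} {φ₁ : Par k → Fin 2 → ℝ} {φ₂ : Par k → Fin k → ℝ}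
  {g : Base → Base} {a b : Base → ℝ} {z : Par k} {σ : Finset (Fin 2)}

/-- The effect of an equivalence `G = a · F ∘ Φ + b` on Lagrangian points: the point over `Q`
generated by `G`, where `t` is the value of `F` and `p` the covector generated by `F`. -/
def transport (g : Base → Base) (a b : Base → ℝ) (Q : Base) (t : ℝ) (p : Base) : Cot :=
  (Q, fun m => fderiv ℝ a Q (Pi.single m 1) * t +
    a Q * ∑ j, fderiv ℝ g Q (Pi.single m 1) j * p j + fderiv ℝ b Q (Pi.single m 1))

theorem uniqueDiffOn_corner : UniqueDiffOn ℝ {z : Par k | ∀ i, 0 ≤ z.1 i} := by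
  have hcorner : {z : Par k | ∀ i, 0 ≤ z.1 i} =
      (Set.pi Set.univ fun _ : Fin 2 => Set.Ici (0 : ℝ)) ×ˢ Set.univ := by
    ext z
    simp [Pi.le_def]
  rw [hcorner]
  exact (UniqueDiffOn.univ_pi fun _ => uniqueDiffOn_Ici 0).prod uniqueDiffOn_univ

theorem fderiv_apply_of_eventually_eq_on_corner {Φ : Par k → Par k}
    (heq : ∀ᶠ w in 𝓝 z, (∀ i, 0 ≤ w.1 i) → G w = a w.2.2 * F (Φ w) + b w.2.2)
    (hG : DifferentiableAt ℝ G z) (ha : DifferentiableAt ℝ a z.2.2)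
    (hF : DifferentiableAt ℝ F (Φ z)) (hΦ : DifferentiableAt ℝ Φ z)
    (hb : DifferentiableAt ℝ b z.2.2) (hz : ∀ i, 0 ≤ z.1 i) (v : Par k) :
    fderiv ℝ G z v = fderiv ℝ a z.2.2 v.2.2 * F (Φ z) +
      a z.2.2 * fderiv ℝ F (Φ z) (fderiv ℝ Φ z v) + fderiv ℝ b z.2.2 v.2.2 := by
  have hparams := hasFDerivAt_params z
  have hright : HasFDerivAt (fun w : Par k => a w.2.2 * F (Φ w) + b w.2.2) _ z :=
    ((HasFDerivAt.comp z (g := a) ha.hasFDerivAt hparams).mul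
      (hF.hasFDerivAt.comp z hΦ.hasFDerivAt)).add
      (HasFDerivAt.comp z (g := b) hb.hasFDerivAt hparams)
  have hunique := uniqueDiffOn_corner (k := k) z hz
  have hwithin : G =ᶠ[𝓝[{w : Par k | ∀ i, 0 ≤ w.1 i}] z]
      fun w => a w.2.2 * F (Φ w) + b w.2.2 := by
    filter_upwards [nhdsWithin_le_nhds heq, self_mem_nhdsWithin] with w hw hmem using hw hmem
  have hderiv := hwithin.fderivWithin_eq (𝕜 := ℝ) (heq.self_of_nhds hz)
  rw [hG.fderivWithin hunique, hright.differentiableAt.fderivWithin hunique, hright.fderiv]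
    at hderiv
  rw [hderiv]
  simp
  ring

namespace PCEquivOver

theorem smooth_cornerMap (h : PCEquivOver φ₁ φ₂ g a b F G) :
    SmoothNear (cornerMap φ₁ φ₂ g) 0 :=
  smoothNear_cornerMap h.smooth_φ₁ h.smooth_φ₂ h.smooth_g

theorem cornerMap_zero (h : PCEquivOver φ₁ φ₂ g a b F G) : cornerMap φ₁ φ₂ g 0 = 0 :=
  Prod.ext (funext fun _ => zero_mul _) (Prod.ext h.φ₂_zero h.g_zero)

theorem tendsto_cornerMap (h : PCEquivOver φ₁ φ₂ g a b F G) :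
    Tendsto (cornerMap φ₁ φ₂ g) (𝓝 0) (𝓝 0) :=
  h.smooth_cornerMap.tendsto h.cornerMap_zero

theorem bijective_g (h : PCEquivOver φ₁ φ₂ g a b F G) : Function.Bijective (fderiv ℝ g 0) := by
  have hsurj : Function.Surjective (fderiv ℝ g 0) := fun y => by
    obtain ⟨v, hv⟩ := h.bijective.2 (0, 0, y)
    have hv' := fderiv_cornerMap_params h.smooth_cornerMap.differentiableAt
      h.smooth_g.differentiableAt v
    exact ⟨v.2.2, by rw [hv] at hv'; exact hv'.symm⟩
  exact ⟨(LinearMap.injective_iff_surjective (f := (fderiv ℝ g 0).toLinearMap)).2 hsurj, hsurj⟩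

theorem eventually_φ₁_pos (h : PCEquivOver φ₁ φ₂ g a b F G) : ∀ᶠ z in 𝓝 0, ∀ i, 0 < φ₁ z i :=
  eventually_all.2 fun i =>
    (smoothNear_pi.1 h.smooth_φ₁ i).continuousAt.eventually_const_lt (h.φ₁_pos i)

theorem eventually_fderiv_apply (h : PCEquivOver φ₁ φ₂ g a b F G) (hF : SmoothNear F 0)
    (hG : SmoothNear G 0) : ∀ᶠ z in 𝓝 0, (∀ i, 0 ≤ z.1 i) → ∀ v,
      fderiv ℝ G z v = fderiv ℝ a z.2.2 v.2.2 * F (cornerMap φ₁ φ₂ g z) +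
        a z.2.2 * fderiv ℝ F (cornerMap φ₁ φ₂ g z) (fderiv ℝ (cornerMap φ₁ φ₂ g) z v) +
        fderiv ℝ b z.2.2 v.2.2 := by
  filter_upwards [h.eq_on_corner.eventually_nhds, hG.eventually_differentiableAt,
    tendsto_params.eventually h.smooth_a.eventually_differentiableAt,
    h.tendsto_cornerMap.eventually hF.eventually_differentiableAt,
    h.smooth_cornerMap.eventually_differentiableAt,
    tendsto_params.eventually h.smooth_b.eventually_differentiableAt]
    with z heq hGz haz hFz hΦz hbz hz v
  exact fderiv_apply_of_eventually_eq_on_corner heq hGz haz hFz hΦz hbz hz v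

theorem eventually_isVertical_fderiv_iff (h : PCEquivOver φ₁ φ₂ g a b F G)
    (σ : Finset (Fin 2)) : ∀ᶠ z in 𝓝 0, (∀ i ∈ σ, z.1 i = 0) → ∀ v,
      IsVertical σ (fderiv ℝ (cornerMap φ₁ φ₂ g) z v) ↔ IsVertical σ v := by
  filter_upwards [h.eventually_φ₁_pos, h.smooth_φ₁.eventually_differentiableAt,
    h.smooth_cornerMap.eventually_differentiableAt,
    tendsto_params.eventually h.smooth_g.eventually_differentiableAt,
    tendsto_params.eventually (eventually_bijective h.smooth_g.fderiv.continuousAt h.bijective_g)]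
    with z hpos hφ₁ hΦ hg hbij hface v
  refine and_congr (forall₂_congr fun i hi => ?_) ?_
  · rw [fderiv_cornerMap_fst hΦ hφ₁ (hface i hi), mul_eq_zero_iff_right (hpos i).ne']
  · rw [fderiv_cornerMap_params hΦ hg, map_eq_zero_iff _ hbij.1]

theorem eventually_mem_critSet_iff (h : PCEquivOver φ₁ φ₂ g a b F G) (hF : SmoothNear F 0)
    (hG : SmoothNear G 0) (σ : Finset (Fin 2)) :
    ∀ᶠ z in 𝓝 0, (z ∈ critSet G σ ↔ cornerMap φ₁ φ₂ g z ∈ critSet F σ) := by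
  filter_upwards [h.eventually_φ₁_pos, h.eventually_fderiv_apply hF hG,
    h.eventually_isVertical_fderiv_iff σ,
    eventually_bijective h.smooth_cornerMap.fderiv.continuousAt h.bijective,
    tendsto_params.eventually (h.smooth_a.continuousAt.eventually_ne h.a_ne)]
    with z hpos hderiv hvert hbij ha
  have hnonneg (i : Fin 2) : 0 ≤ (cornerMap φ₁ φ₂ g z).1 i ↔ 0 ≤ z.1 i :=
    mul_nonneg_iff_of_pos_right (hpos i)
  have hzero (i : Fin 2) : (cornerMap φ₁ φ₂ g z).1 i = 0 ↔ z.1 i = 0 :=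
    mul_eq_zero_iff_right (hpos i).ne'
  simp only [mem_critSet_iff, hnonneg, hzero]
  refine and_congr_right fun hface => and_congr_right fun hz => ?_
  have hvertical {v : Par k} (hv : IsVertical σ v) : fderiv ℝ G z v = a z.2.2 *
      fderiv ℝ F (cornerMap φ₁ φ₂ g z) (fderiv ℝ (cornerMap φ₁ φ₂ g) z v) := by
    simp [hderiv hz, hv.2]
  constructor
  · intro hcrit u hu
    obtain ⟨v, rfl⟩ := hbij.2 u
    have hv := (hvert hface v).1 hu
    exact (mul_eq_zero.1 ((hvertical hv).symm.trans (hcrit v hv))).resolve_left ha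
  · intro hcrit v hv
    rw [hvertical hv, hcrit _ ((hvert hface v).2 hv), mul_zero]

theorem eventually_lift_eq_transport (h : PCEquivOver φ₁ φ₂ g a b F G) (hF : SmoothNear F 0)
    (hG : SmoothNear G 0) (σ : Finset (Fin 2)) : ∀ᶠ z in 𝓝 0, z ∈ critSet G σ →
      lift G z = transport g a b z.2.2 (F (cornerMap φ₁ φ₂ g z))
        (lift F (cornerMap φ₁ φ₂ g z)).2 := by
  filter_upwards [h.eventually_mem_critSet_iff hF hG σ, h.eventually_fderiv_apply hF hG,
    h.smooth_φ₁.eventually_differentiableAt, h.smooth_cornerMap.eventually_differentiableAt,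
    tendsto_params.eventually h.smooth_g.eventually_differentiableAt]
    with z hmem hderiv hφ₁ hΦ hg hz
  obtain ⟨hface, hnonneg, -⟩ := mem_critSet_iff.1 hz
  refine Prod.ext rfl (funext fun m => ?_)
  have hcrit := (mem_critSet_iff.1 (hmem.1 hz)).2.2
    (fderiv ℝ (cornerMap φ₁ φ₂ g) z (0, 0, Pi.single m 1) -
      (0, 0, fderiv ℝ g z.2.2 (Pi.single m 1)))
    ⟨fun i hi => by simp [fderiv_cornerMap_fst hΦ hφ₁ (hface i hi)],
      by simp [fderiv_cornerMap_params hΦ hg]⟩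
  rw [map_sub, sub_eq_zero, fderiv_apply_base] at hcrit
  change fderiv ℝ G z (0, 0, Pi.single m 1) = _
  rw [hderiv hnonneg, hcrit]
  rfl

theorem offset_eq_zero {S R : Cot → Cot} (h : PCEquivOver φ₁ φ₂ g a b F G)
    (hF : IsGeneratingFamily F S) (hG : IsGeneratingFamily G R) : b 0 = 0 ∧ fderiv ℝ b 0 = 0 := by
  constructor
  · have h0 := h.eq_on_corner.self_of_nhds fun _ => le_rfl
    rw [hG.2.1, h.cornerMap_zero, hF.2.1] at h0
    simpa using h0.symm
  · refine ContinuousLinearMap.ext fun u => ?_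
    have h0 := (h.eventually_fderiv_apply hF.smooth hG.smooth).self_of_nhds (fun _ => le_rfl)
      (0, 0, u)
    rw [h.cornerMap_zero, hF.2.1, hF.2.2.1, hG.2.2.1] at h0
    simpa using h0.symm

variable {F' G' : Par k' → ℝ} {φ₁' : Par k' → Fin 2 → ℝ} {φ₂' : Par k' → Fin k' → ℝ}
  {S R R' T' : Cot → Cot} {α : ℝ}

-- `transport` involves the values of `F` and `F'`, which agree by `critical_value`.
theorem eventually_exists_lift_eq (hS : IsSymplecticGerm S) (hα : IsGeneratingFamily (Fa α) S)
    (hF : IsGeneratingFamily F S) (hF' : IsGeneratingFamily F' S) (hG : SmoothNear G 0)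
    (hG' : SmoothNear G' 0) (h : PCEquivOver φ₁ φ₂ g a b F G)
    (h' : PCEquivOver φ₁' φ₂' g a b F' G') (σ : Finset (Fin 2)) {p : Par k' → Prop}
    (hp : ∀ᶠ z in 𝓝 0, p z) : ∀ᶠ z in 𝓝 0, z ∈ critSet G σ →
      ∃ z', p z' ∧ z' ∈ critSet G' σ ∧ lift G' z' = lift G z := by
  obtain ⟨χ, hχ, hχ0, -, hright⟩ :=
    h'.smooth_cornerMap.exists_inverse h'.cornerMap_zero h'.bijective
  obtain ⟨γ, -, -, hγ, -⟩ := h.smooth_g.exists_inverse h.g_zero h.bijective_g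
  have htχ := hχ.tendsto hχ0
  have hU := hright.and <| (htχ.eventually (tendsto_params.eventually hγ)).and <|
    (hF'.critical_value hS hα σ).and <|
    (htχ.eventually (h'.eventually_mem_critSet_iff hF'.smooth hG' σ)).and <|
    (htχ.eventually (h'.eventually_lift_eq_transport hF'.smooth hG' σ)).and (htχ.eventually hp)
  filter_upwards [tendsto_params.eventually hγ,
    h.tendsto_cornerMap.eventually (hF.critical_value hS hα σ),
    h.eventually_mem_critSet_iff hF.smooth hG σ, h.eventually_lift_eq_transport hF.smooth hG σ,
    h.tendsto_cornerMap.eventually (hF.exists_critSet_of_critSet hS hF' σ hU)]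
    with z hγz hvalue hmem hlift hex hz
  obtain ⟨w, ⟨hχw, hγw, hvalue', hmem', hlift', hpw⟩, hw, hwz⟩ := hex (hmem.1 hz)
  rw [hχw] at hmem' hlift'
  have hχcrit := hmem'.2 hw
  have hval : F' w = F (cornerMap φ₁ φ₂ g z) := by rw [hvalue' hw, hvalue (hmem.1 hz), hwz]
  have hparams : (χ w).2.2 = z.2.2 := by
    have hbase : (cornerMap φ₁' φ₂' g (χ w)).2.2 = (cornerMap φ₁ φ₂ g z).2.2 := by
      rw [hχw]
      exact congrArg Prod.fst hwz
    rw [← hγw, ← hγz]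
    exact congrArg γ hbase
  exact ⟨χ w, hpw, hχcrit, by rw [hlift' hχcrit, hlift hz, hval, hwz, hparams]⟩

theorem eventually_mem_L0 (hS : IsSymplecticGerm S) (hα : IsGeneratingFamily (Fa α) S)
    (hF : IsGeneratingFamily F S) (hF' : IsGeneratingFamily F' S) (hG : IsGeneratingFamily G R)
    (hG' : IsGeneratingFamily G' R') (h : PCEquivOver φ₁ φ₂ g a b F G)
    (h' : PCEquivOver φ₁' φ₂' g a b F' G') (hT' : Tendsto T' (𝓝 0) (𝓝 0))
    (hRT : ∀ᶠ z in 𝓝 0, R' (T' z) = z) (σ : Finset (Fin 2)) :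
    ∀ᶠ ζ in 𝓝 0, ζ ∈ L0 σ → T' (R ζ) ∈ L0 σ := by
  filter_upwards [hG.exists_critSet σ (eventually_exists_lift_eq hS hα hF hF' hG.smooth hG'.smooth
    h h' σ (hG'.mem_of_critSet hT' hRT σ))] with ζ hex hζ
  obtain ⟨z, hz, hcrit, hlift⟩ := hex hζ
  obtain ⟨z', hmem, hcrit', hlift'⟩ := hz hcrit
  rw [← hlift, ← hlift']
  exact hmem hcrit'

end PCEquivOver

end Transport

section NormalForm

/-- The normal form `c(Q) (F_a(q₁, q₂, g(Q)) + q₃ g₃(Q)) + b(Q)`, equivalent to `F_a` by an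
equivalence that acts on the parameters by `g`. The term in `q₃`, which vanishes on `L_σ⁰`, makes
it a potential. -/
def NormalData.ofEquiv (a : ℝ) (g : Base → Base) (c b : Base → ℝ) : NormalData where
  c := c
  b := b
  e := fun Q => a + g Q 2
  g₁ := fun Q => g Q 0
  g₂ := fun Q => g Q 1
  φ₁ := fun _ => 1
  φ₂ := fun _ => 1
  B := fun w => c w.2 * g w.2 2

variable {a : ℝ} {g : Base → Base} {c b : Base → ℝ}

theorem NormalData.unfolding_ofEquiv (Q : Base) :
    (NormalData.ofEquiv a g c b).unfolding Q = g Q + ![0, 0, a] := by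
  funext i
  fin_cases i <;> simp [NormalData.unfolding, NormalData.ofEquiv, add_comm]

theorem NormalData.good_ofEquiv (ha : 1 / 4 < a) (hg : SmoothNear g 0) (hc : SmoothNear c 0)
    (hb : SmoothNear b 0) (hg0 : g 0 = 0) (hc0 : c 0 ≠ 0)
    (hbij : Function.Bijective (fderiv ℝ g 0)) : (NormalData.ofEquiv a g c b).Good where
  smooth :=
    { c := hc
      b := hb
      e := (smoothNear_const a).add (smoothNear_pi.1 hg 2)
      g₁ := smoothNear_pi.1 hg 0
      g₂ := smoothNear_pi.1 hg 1
      φ₁ := smoothNear_const 1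
      φ₂ := smoothNear_const 1
      B := hc.comp_snd.mul (smoothNear_pi.1 hg 2).comp_snd }
  c_ne := hc0
  e_gt := by simpa [NormalData.ofEquiv, hg0] using ha
  g₁_zero := by simp [NormalData.ofEquiv, hg0]
  g₂_zero := by simp [NormalData.ofEquiv, hg0]
  φ₁_pos := one_pos
  φ₂_pos := one_pos
  bijective := by
    rw [funext (NormalData.unfolding_ofEquiv (a := a) (g := g) (c := c) (b := b)),
      fderiv_add_const]
    exact hbij

theorem initialPoint_coordForm {α β B : Cot → ℝ} {Q : Base} (hα : SmoothNear α (0, Q))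
    (hβ : SmoothNear β (0, Q)) (hB : SmoothNear B (0, Q)) (hb : SmoothNear b Q) :
    initialPoint (coordForm α β B b) (0, Q) = (0, -![α (0, Q), β (0, Q), B (0, Q)]) := by
  refine Prod.ext rfl (congrArg Neg.neg (funext fun i => ?_))
  rw [grad_fst, fderiv_coordForm hα hβ hB hb]
  fin_cases i <;> simp

theorem NormalData.Smooth.eventually_initialPoint_ofEquiv
    (hD : (NormalData.ofEquiv a g c b).Smooth) :
    ∀ᶠ Q in 𝓝 0, initialPoint (NormalData.ofEquiv a g c b).fn (0, Q) = (0, -(c Q • g Q)) := by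
  have htendsto : Tendsto (fun Q : Base => ((0, Q) : Cot)) (𝓝 0) (𝓝 0) :=
    (Continuous.prodMk_right 0).tendsto 0
  filter_upwards [htendsto.eventually hD.coeff₁.eventually,
    htendsto.eventually hD.coeff₂.eventually, htendsto.eventually hD.B.eventually,
    hD.b.eventually] with Q hα hβ hB hb
  rw [NormalData.fn_eq_coordForm, initialPoint_coordForm hα hβ hB hb]
  refine Prod.ext rfl (congrArg Neg.neg (funext fun i => ?_))
  fin_cases i <;> simp [NormalData.coeff₁, NormalData.coeff₂, NormalData.ofEquiv]

theorem NormalData.Good.fderiv_initialPoint_ofEquiv (hD : (NormalData.ofEquiv a g c b).Good)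
    (hg : SmoothNear g 0) (hg0 : g 0 = 0) (u : Base) :
    fderiv ℝ (initialPoint (NormalData.ofEquiv a g c b).fn) 0 (0, u) =
      (0, -(c 0 • fderiv ℝ g 0 u)) := by
  have hslice : HasFDerivAt (fun Q : Base => initialPoint (NormalData.ofEquiv a g c b).fn (0, Q))
      (fderiv ℝ (initialPoint (NormalData.ofEquiv a g c b).fn) 0 ∘L .inr ℝ Base Base) 0 :=
    HasFDerivAt.comp (0 : Base) (f := ContinuousLinearMap.inr ℝ Base Base)
      (smoothNear_initialPoint hD.smooth.fn).differentiableAt.hasFDerivAt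
      (ContinuousLinearMap.inr ℝ Base Base).hasFDerivAt
  have hprod := (hasFDerivAt_const (0 : Base) (0 : Base)).prodMk
    (hD.smooth.c.differentiableAt.hasFDerivAt.smul hg.differentiableAt.hasFDerivAt).neg
  refine (DFunLike.congr_fun (hslice.unique (hprod.congr_of_eventuallyEq
    hD.smooth.eventually_initialPoint_ofEquiv)) u).trans (Prod.ext rfl ?_)
  simp [hg0, NormalData.ofEquiv]

theorem NormalData.Good.isPotential_ofEquiv (hD : (NormalData.ofEquiv a g c b).Good)
    (hg : SmoothNear g 0) (hg0 : g 0 = 0) (hb0 : b 0 = 0) (hb1 : fderiv ℝ b 0 = 0)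
    (hbij : Function.Bijective (fderiv ℝ g 0)) :
    IsPotential (NormalData.ofEquiv a g c b).fn := by
  have hinj : Function.Injective (fderiv ℝ (initialPoint (NormalData.ofEquiv a g c b).fn) 0) := by
    refine (injective_iff_map_eq_zero _).2 fun u hu => ?_
    have hfst : u.1 = 0 := by
      rw [fderiv_initialPoint hD.smooth.fn] at hu
      exact congrArg Prod.fst hu
    have hu0 : u = (0, u.2) := Prod.ext hfst rfl
    rw [hu0, hD.fderiv_initialPoint_ofEquiv hg hg0] at hu
    have hsmul : c 0 • fderiv ℝ g 0 u.2 = 0 := neg_eq_zero.1 (congrArg Prod.snd hu)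
    rw [hu0, (map_eq_zero_iff _ hbij.1).1 ((smul_eq_zero.1 hsmul).resolve_left hD.c_ne)]
    rfl
  exact ⟨hD.smooth.fn, by simp [NormalData.fn, NormalData.ofEquiv, hb0],
    hD.smooth.fderiv_fn_zero hD.g₁_zero hD.g₂_zero (by simp [NormalData.ofEquiv, hg0]) hb1,
    hinj, LinearMap.injective_iff_surjective.1 hinj⟩

theorem exists_normalData {S R : Cot → Cot} {k : ℕ} {F G : Par k → ℝ} (ha : 1 / 4 < a)
    (hS : IsSymplecticGerm S) (hα : IsGeneratingFamily (Fa a) S) (hF : IsGeneratingFamily F S)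
    (hG : IsGeneratingFamily G R) (hR : IsSymplecticGerm R) (h : PCEquiv F G) :
    ∃ D : NormalData, D.Good ∧ (D.φ₁ = fun _ => 1) ∧ (D.φ₂ = fun _ => 1) ∧ IsPotential D.fn ∧
      ∀ S₀, IsSymplecticGerm S₀ → IsGen D.fn S₀ →
        ∃ ψ, IsReticularDiffeo ψ ∧ ∀ᶠ z in 𝓝 0, R z = S₀ (ψ z) := by
  obtain ⟨φ₁, φ₂, g, c, b, h⟩ := pcEquiv_iff.1 h
  obtain ⟨hb0, hb1⟩ := h.offset_eq_zero hF hG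
  have hD : (NormalData.ofEquiv a g c b).Good :=
    NormalData.good_ofEquiv ha h.smooth_g h.smooth_a h.smooth_b h.g_zero h.a_ne h.bijective_g
  have hP := hD.isPotential_ofEquiv h.smooth_g h.g_zero hb0 hb1 h.bijective_g
  refine ⟨_, hD, rfl, rfl, hP, fun S₀ hS₀ hgen => ?_⟩
  have hD_equiv := hD.pcEquivOver
  have he : (NormalData.ofEquiv a g c b).e 0 = a := by simp [NormalData.ofEquiv, h.g_zero]
  simp only [he, NormalData.unfolding_ofEquiv, add_sub_cancel_right] at hD_equiv
  have hS₀family := hgen.isGeneratingFamily hP hS₀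
  obtain ⟨T, hT, -, hST⟩ := hS₀.exists_inverse
  obtain ⟨V, hV, hVR, hRV⟩ := hR.exists_inverse
  refine ⟨fun z => T (R z), ⟨hT.comp hR, fun σ => ?_⟩, ?_⟩
  · filter_upwards [hR.tendsto.eventually (hT.tendsto.eventually
      (hD_equiv.eventually_mem_L0 hS hα hα hF hS₀family hG h hV.tendsto hRV σ)),
      h.eventually_mem_L0 hS hα hF hα hG hS₀family hD_equiv hT.tendsto hST σ, hVR,
      hR.tendsto.eventually hST] with z hback hforth hVRz hSTz
    rw [hSTz, hVRz] at hback
    exact ⟨hback, hforth⟩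
  · exact (hR.tendsto.eventually hST).mono fun z hz => hz.symm

end NormalForm

/-! ### Lagrangian equivalence -/

section LagrangianEquivalence

variable {S T φ ψ Θ Θ' : Cot → Cot} {v : Cot}

theorem IsReticularDiffeo.comp (hφ : IsReticularDiffeo φ) (hψ : IsReticularDiffeo ψ) :
    IsReticularDiffeo (fun z => φ (ψ z)) := by
  refine ⟨hφ.1.comp hψ.1, fun σ => ?_⟩
  filter_upwards [hψ.1.tendsto.eventually (hφ.2 σ), hψ.2 σ] with z hφz hψz
  rw [hφz, hψz]

theorem IsReticularDiffeo.exists_inverse (hφ : IsReticularDiffeo φ) :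
    ∃ ψ, IsReticularDiffeo ψ ∧ (∀ᶠ z in 𝓝 0, ψ (φ z) = z) ∧ ∀ᶠ z in 𝓝 0, φ (ψ z) = z := by
  obtain ⟨ψ, hψ, hψφ, hφψ⟩ := hφ.1.exists_inverse
  refine ⟨ψ, ⟨hψ, fun σ => ?_⟩, hψφ, hφψ⟩
  filter_upwards [hφψ, hψ.tendsto.eventually (hφ.2 σ)] with z hz hmem
  rw [← hmem, hz]

theorem IsLagrangianDiffeo.comp (hΘ : IsLagrangianDiffeo Θ) (hΘ' : IsLagrangianDiffeo Θ') :
    IsLagrangianDiffeo (fun z => Θ (Θ' z)) := by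
  obtain ⟨hΘs, g, hg⟩ := hΘ
  obtain ⟨hΘs', g', hg'⟩ := hΘ'
  refine ⟨hΘs.comp hΘs', fun q => g (g' q), ?_⟩
  filter_upwards [hg', hΘs'.tendsto.eventually hg] with z hz' hz
  rw [hz, hz']

theorem LagrangianEquiv.trans {R : Cot → Cot} (hRS : LagrangianEquiv R S)
    (hST : LagrangianEquiv S T) : LagrangianEquiv R T := by
  obtain ⟨φ, Θ, hφ, hΘ, hSφ⟩ := hRS
  obtain ⟨ψ, Θ', hψ, hΘ', hTψ⟩ := hST
  refine ⟨_, _, hψ.comp hφ, hΘ'.comp hΘ, ?_⟩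
  filter_upwards [hφ.1.tendsto.eventually hTψ, hSφ] with z hz hz'
  rw [hz, hz']

theorem fderiv_fst_eq_zero {c : Base} (hS : DifferentiableAt ℝ S 0)
    (hfibre : ∀ᶠ p in 𝓝 (0 : Base), (S (0, p)).1 = c) (hv : v.1 = 0) :
    (fderiv ℝ S 0 v).1 = 0 := by
  have hderiv : HasFDerivAt (fun p : Base => (S (0, p)).1)
      ((ContinuousLinearMap.fst ℝ Base Base ∘L fderiv ℝ S 0) ∘L
        ContinuousLinearMap.inr ℝ Base Base) 0 :=
    HasFDerivAt.comp (0 : Base) (g := fun z => (S z).1) (f := ContinuousLinearMap.inr ℝ Base Base)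
      hS.hasFDerivAt.fst (ContinuousLinearMap.inr ℝ Base Base).hasFDerivAt
  have hzero := HasFDerivAt.unique hderiv
    ((hasFDerivAt_const c (0 : Base)).congr_of_eventuallyEq hfibre)
  rw [show v = (0, v.2) from Prod.ext hv rfl]
  exact DFunLike.congr_fun hzero v.2

theorem tendsto_fibre : Tendsto (fun p : Base => ((0, p) : Cot)) (𝓝 0) (𝓝 0) :=
  (ContinuousLinearMap.inr ℝ Base Base).continuous.tendsto' 0 0 (map_zero _)

theorem mem_L0_univ {z : Cot} : z ∈ L0 Finset.univ ↔ z.1 = 0 := by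
  simp only [L0, Finset.mem_univ, not_true_eq_false, Set.mem_ofPred_eq, forall_const,
    funext_iff, Fin.forall_fin_succ, Pi.zero_apply, IsEmpty.forall_iff]
  tauto

theorem IsReticularDiffeo.fderiv_fst (hφ : IsReticularDiffeo φ) (hv : v.1 = 0) :
    (fderiv ℝ φ 0 v).1 = 0 := by
  refine fderiv_fst_eq_zero (c := 0) hφ.1.smooth.differentiableAt ?_ hv
  filter_upwards [tendsto_fibre.eventually (hφ.2 Finset.univ)] with p hp
  exact mem_L0_univ.1 (hp.2 (mem_L0_univ.2 rfl))

/-- The vertical space at `0` is Lagrangian and `dΘ(0)` maps it into itself, so `ω` vanishes between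
`v` and the vertical space whenever `dΘ(0)v` is vertical. -/
theorem IsLagrangianDiffeo.fst_eq_zero (hΘ : IsLagrangianDiffeo Θ)
    (hv : (fderiv ℝ Θ 0 v).1 = 0) : v.1 = 0 := by
  obtain ⟨hs, g, hg⟩ := hΘ
  have hvertical (p : Base) : (fderiv ℝ Θ 0 (0, p)).1 = 0 :=
    fderiv_fst_eq_zero (c := g 0) hs.smooth.differentiableAt (tendsto_fibre.eventually hg) rfl
  funext i
  have homega := hs.2.2.self_of_nhds v (0, Pi.single i 1)
  simpa [omega, hv, hvertical, Pi.single_apply] using homega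

theorem fderiv_mixedPoint {z : Cot} (hS : DifferentiableAt ℝ S z) (v : Cot) :
    fderiv ℝ (mixedPoint S) z v = (v.1, (fderiv ℝ S z v).1) := by
  rw [show fderiv ℝ (mixedPoint S) z = _ from
    ((hasFDerivAt_fst (𝕜 := ℝ) (p := z)).prodMk hS.hasFDerivAt.fst).fderiv]
  rfl

theorem IsGen.bijective_mixedPoint {A : Cot → ℝ} (hA : IsPotential A) (hS : IsSymplecticGerm S)
    (h : IsGen A S) : Function.Bijective (fderiv ℝ (mixedPoint S) 0) := by
  have hmixed : HasFDerivAt (mixedPoint S) (fderiv ℝ (mixedPoint S) 0) (initialPoint A 0) := by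
    rw [initialPoint_zero hA.fderiv_zero]
    exact (smoothNear_mixedPoint hS.smooth).differentiableAt.hasFDerivAt
  have hcomp := HasFDerivAt.unique
    (hmixed.comp (0 : Cot) (smoothNear_initialPoint hA.smooth).differentiableAt.hasFDerivAt)
    ((hasFDerivAt_id (0 : Cot)).congr_of_eventuallyEq h.mixedPoint_initialPoint)
  have hsurj : Function.Surjective (fderiv ℝ (mixedPoint S) 0) := fun v =>
    ⟨_, DFunLike.congr_fun hcomp v⟩
  exact ⟨(LinearMap.injective_iff_surjective
    (f := (fderiv ℝ (mixedPoint S) 0 : Cot →ₗ[ℝ] Cot))).2 hsurj, hsurj⟩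

theorem LagrangianEquiv.bijective_mixedPoint (hS : IsSymplecticGerm S) (hT : IsSymplecticGerm T)
    (h : LagrangianEquiv S T) (hb : Function.Bijective (fderiv ℝ (mixedPoint S) 0)) :
    Function.Bijective (fderiv ℝ (mixedPoint T) 0) := by
  obtain ⟨η, Θ, hη, hΘ, hTη⟩ := h
  obtain ⟨χ, hχ, -, hηχ⟩ := hη.exists_inverse
  have hTeq : T =ᶠ[𝓝 0] fun z => Θ (S (χ z)) := by
    filter_upwards [hηχ, hχ.1.tendsto.eventually hTη] with z hz hz'
    rw [← hz', hz]
  have hderiv : fderiv ℝ T 0 = fderiv ℝ Θ 0 ∘L fderiv ℝ S 0 ∘L fderiv ℝ χ 0 := by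
    have hSχ : HasFDerivAt S (fderiv ℝ S 0) (χ 0) := by
      rw [hχ.1.zero]; exact hS.smooth.differentiableAt.hasFDerivAt
    have hΘS : HasFDerivAt Θ (fderiv ℝ Θ 0) (S (χ 0)) := by
      rw [hχ.1.zero, hS.zero]; exact hΘ.1.smooth.differentiableAt.hasFDerivAt
    rw [hTeq.fderiv_eq]
    exact (HasFDerivAt.comp (0 : Cot) (g := Θ) hΘS
      (hSχ.comp (0 : Cot) hχ.1.smooth.differentiableAt.hasFDerivAt)).fderiv
  have hinj : Function.Injective (fderiv ℝ (mixedPoint T) 0) := by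
    refine (injective_iff_map_eq_zero _).2 fun v hv => ?_
    rw [fderiv_mixedPoint hT.smooth.differentiableAt, hderiv] at hv
    have hχv : (fderiv ℝ χ 0 v).1 = 0 := hχ.fderiv_fst (congrArg Prod.fst hv)
    have hSχv : (fderiv ℝ S 0 (fderiv ℝ χ 0 v)).1 = 0 := hΘ.fst_eq_zero (congrArg Prod.snd hv)
    have hzero : fderiv ℝ χ 0 v = 0 := hb.1 <| by
      rw [fderiv_mixedPoint hS.smooth.differentiableAt, hχv, hSχv, map_zero]
      rfl
    exact hχ.1.bijective.1 (hzero.trans (map_zero _).symm)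
  exact ⟨hinj, (LinearMap.injective_iff_surjective
    (f := (fderiv ℝ (mixedPoint T) 0 : Cot →ₗ[ℝ] Cot))).1 hinj⟩

end LagrangianEquivalence

/-! ### Neighbourhoods in the space of symplectic jets -/

section JetNeighbourhoods

variable {l : ℕ} {S T φ Θ : Cot → Cot}

theorem jet_comp_congr (hΘ : IsSymplecticGerm Θ) (hφ : IsSymplecticGerm φ)
    (hS : IsSymplecticGerm S) (hT : SmoothNear T 0) (hST : jet l S = jet l T) :
    jet l (fun z => Θ (S (φ z))) = jet l (fun z => Θ (T (φ z))) := by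
  have hTφ : JetEq l (fun z => S (φ z)) (fun z => T (φ z)) 0 :=
    (jets_eq_iff.1 hST).comp (JetEq.refl l φ 0) hS.smooth hT hφ.smooth hφ.smooth hφ.zero
  exact jets_eq_iff.2 ((JetEq.refl l Θ 0).comp hTφ hΘ.smooth hΘ.smooth (hS.comp hφ).smooth
    (hT.comp_of_eq hφ.smooth hφ.zero) (hS.comp hφ).zero)

theorem jet_taylorPoly (hS : IsSymplecticGerm S) : jet l (taylorPoly (jet l S)) = jet l S :=
  jets_eq_iff.2 (jetEq_taylorPoly hS.smooth)

theorem smoothNear_uncurry_taylorPoly (p : JetSpace l × Cot) :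
    SmoothNear (Function.uncurry (taylorPoly : JetSpace l → Cot → Cot)) p :=
  smoothNear_of_contDiff contDiff_taylorPoly p

theorem tendsto_jet_comp (hΘ : IsSymplecticGerm Θ) (hφ : IsSymplecticGerm φ)
    (hS : IsSymplecticGerm S) :
    Tendsto (fun j : JetSpace l => jet l (fun z => Θ (taylorPoly j (φ z)))) (𝓝 (jet l S))
      (𝓝 (jet l (fun z => Θ (S (φ z))))) := by
  rw [jet_comp_congr hΘ hφ hS (smoothNear_taylorPoly (jet l S) 0) (jet_taylorPoly hS).symm]
  have hinner : SmoothNear (fun p : JetSpace l × Cot => taylorPoly p.1 (φ p.2)) (jet l S, 0) :=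
    (smoothNear_uncurry_taylorPoly _).comp (f := fun p : JetSpace l × Cot => (p.1, φ p.2))
      (smoothNear_id.fst.prodMk (hφ.smooth.comp_of_eq smoothNear_id.snd rfl))
  have hzero : taylorPoly (jet l S) (φ 0) = 0 := by
    rw [hφ.zero]
    exact (jetEq_taylorPoly hS.smooth).eq.trans hS.zero
  exact (smoothNear_jets (n := l)
    (G := fun (j : JetSpace l) z => Θ (taylorPoly j (φ z)))
    (hΘ.smooth.comp_of_eq hinner hzero)).continuousAt

theorem LagrangianEquiv.mem_nhdsWithin {𝒜 : Set (Cot → Cot)} (hS : IsSymplecticGerm S)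
    (hT : IsSymplecticGerm T) (hST : LagrangianEquiv S T)
    (h𝒜 : ∀ R ∈ 𝒜, IsSymplecticGerm R ∧ lagrangianClass R ⊆ 𝒜)
    (h : jet l '' 𝒜 ∈ 𝓝[symplecticJets l] jet l S) :
    jet l '' 𝒜 ∈ 𝓝[symplecticJets l] jet l T := by
  obtain ⟨η, Θ, hη, hΘ, hTη⟩ := hST
  obtain ⟨χ, hχ, hχη, hηχ⟩ := hη.exists_inverse
  obtain ⟨Ξ, hΞ, hΞΘ, hΘΞ⟩ := hΘ.1.exists_inverse
  have hΞTη : jet l (fun z => Ξ (T (η z))) = jet l S := by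
    refine jets_eq_iff.2 (JetEq.of_eventuallyEq ?_)
    filter_upwards [hTη, hS.tendsto.eventually hΞΘ] with z hz hz'
    rw [hz, hz']
  have hpull := tendsto_jet_comp (l := l) hΞ hη.1 hT
  rw [hΞTη] at hpull
  rw [mem_nhdsWithin_iff_eventually] at h ⊢
  filter_upwards [hpull.eventually h] with j hj
  rintro ⟨T', hT' : IsSymplecticGerm T', rfl⟩
  have hTaylor : jet l (fun z => Ξ (taylorPoly (jet l T') (η z))) = jet l fun z => Ξ (T' (η z)) :=
    (jet_comp_congr hΞ hη.1 hT' (smoothNear_taylorPoly _ 0) (jet_taylorPoly hT').symm).symm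
  rw [hTaylor] at hj
  obtain ⟨R, hR𝒜, hRj⟩ := hj ⟨_, hΞ.comp (hT'.comp hη.1), rfl⟩
  obtain ⟨hR, hRclass⟩ := h𝒜 R hR𝒜
  refine ⟨fun z => Θ (R (χ z)), hRclass ⟨hΘ.1.comp (hR.comp hχ.1), η, Θ, hη, hΘ, ?_⟩, ?_⟩
  · filter_upwards [hχη] with z hz
    rw [hz]
  · rw [jet_comp_congr hΘ.1 hχ.1 hR (hΞ.comp (hT'.comp hη.1)).smooth hRj]
    refine jets_eq_iff.2 (JetEq.of_eventuallyEq ?_)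
    filter_upwards [hηχ, hT'.tendsto.eventually hΘΞ] with z hz hz'
    rw [hz, hz']

theorem eventually_bijective_mixedPoint (hl : 1 ≤ l) (hS : IsSymplecticGerm S)
    (hb : Function.Bijective (fderiv ℝ (mixedPoint S) 0)) :
    ∀ᶠ j in 𝓝 (jet l S), ∀ T, IsSymplecticGerm T → jet l T = j →
      Function.Bijective (fderiv ℝ (mixedPoint T) 0) := by
  have hTaylor {T} (hT : IsSymplecticGerm T) :
      fderiv ℝ (mixedPoint (taylorPoly (jet l T))) 0 = fderiv ℝ (mixedPoint T) 0 :=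
    (((jetEq_taylorPoly hT.smooth).mono hl).mixedPoint (smoothNear_taylorPoly _ 0)
      hT.smooth).fderiv_eq (l := 0)
  have hmixed : SmoothNear (Function.uncurry fun (j : JetSpace l) z => mixedPoint (taylorPoly j) z)
      (jet l S, 0) :=
    smoothNear_id.snd.fst.prodMk (smoothNear_uncurry_taylorPoly _).fst
  filter_upwards [eventually_bijective hmixed.uncurry_fderiv.apply_right.continuousAt
    (by rwa [hTaylor hS])] with j hj
  rintro T hT rfl
  rwa [← hTaylor hT]

end JetNeighbourhoods

/-! ### Caustic-equivalence classes -/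

section CausticClass

variable {S T : Cot → Cot}

theorem isSymplecticGerm_id : IsSymplecticGerm fun z => z :=
  ⟨rfl, smoothNear_id, Eventually.of_forall fun z u v => by simp⟩

theorem LagrangianEquiv.refl (S : Cot → Cot) : LagrangianEquiv S S :=
  ⟨fun z => z, fun z => z, ⟨isSymplecticGerm_id, fun _ => .of_forall fun _ => Iff.rfl⟩,
    ⟨isSymplecticGerm_id, fun q => q, .of_forall fun _ => rfl⟩, .of_forall fun _ => rfl⟩

theorem isSymplecticGerm_of_mem_causticClass (hT : T ∈ causticClass S) : IsSymplecticGerm T := by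
  obtain ⟨R, -, -, hT, -⟩ := hT
  exact hT

theorem lagrangianClass_subset_causticClass (hT : T ∈ causticClass S) :
    lagrangianClass T ⊆ causticClass S := by
  obtain ⟨R, hR, hSR, -, hRT⟩ := hT
  exact fun T' ⟨hT', hTT'⟩ => ⟨R, hR, hSR, hT', hRT.trans hTT'⟩

theorem NormalData.Good.mem_causticClass {D : NormalData} (hD : D.Good) (hP : IsPotential D.fn)
    (hS : IsGeneratingFamily (Fa (D.e 0)) S) (hT : IsSymplecticGerm T) (hgen : IsGen D.fn T) :
    T ∈ causticClass S :=
  ⟨T, hT, ⟨0, _, _, hS, hgen.isGeneratingFamily hP hT,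
    pcEquiv_iff.2 ⟨_, _, _, _, _, hD.pcEquivOver⟩⟩, hT, .refl T⟩

theorem exists_normalData_of_mem_causticClass {a : ℝ} (ha : 1 / 4 < a) (hS : IsSymplecticGerm S)
    (hα : IsGeneratingFamily (Fa a) S) (hT : T ∈ causticClass S) :
    ∃ (D : NormalData) (S₀ : Cot → Cot), D.Good ∧ (D.φ₁ = fun _ => 1) ∧ (D.φ₂ = fun _ => 1) ∧
      IsPotential D.fn ∧ IsSymplecticGerm S₀ ∧ IsGen D.fn S₀ ∧ LagrangianEquiv S₀ T := by
  obtain ⟨R, hR, ⟨k, F, G, hF, hG, hFG⟩, -, φ, Θ, hφ, hΘ, hTφ⟩ := hT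
  obtain ⟨D, hD, hφ₁, hφ₂, hP, hRD⟩ := exists_normalData ha hS hα hF hG hR hFG
  obtain ⟨S₀, hsmooth, hzero, hgen⟩ := hP.exists_isGen
  have hS₀ := hgen.isSymplecticGerm hP hsmooth hzero
  obtain ⟨ψ, hψ, hRψ⟩ := hRD S₀ hS₀ hgen
  obtain ⟨χ, hχ, -, hψχ⟩ := hψ.exists_inverse
  refine ⟨D, S₀, hD, hφ₁, hφ₂, hP, hS₀, hgen, _, Θ, hφ.comp hχ, hΘ, ?_⟩
  filter_upwards [hχ.1.tendsto.eventually hTφ, hχ.1.tendsto.eventually hRψ, hψχ] with z hz hz' hz''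
  rw [hz, hz', hz'']

end CausticClass

/-! ### The weak caustic-equivalence class in the space of symplectic jets -/

section WeakCausticClass

variable {l : ℕ} {S' : ℝ → Cot → Cot}

/-- The union of the caustic-equivalence classes `[S'_a]_c`, `a > 1/4`, as a set of germs. -/
def weakCausticGerms (S' : ℝ → Cot → Cot) : Set (Cot → Cot) :=
  ⋃ a ∈ Set.Ioi (1 / 4 : ℝ), causticClass (S' a)

theorem mem_weakCausticGerms {T : Cot → Cot} :
    T ∈ weakCausticGerms S' ↔ ∃ a, 1 / 4 < a ∧ T ∈ causticClass (S' a) := by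
  simp only [weakCausticGerms, Set.mem_iUnion₂, Set.mem_Ioi, exists_prop]

theorem weakCausticClass_eq : weakCausticClass l S' = jet l '' weakCausticGerms S' :=
  (Set.image_iUnion₂ _ _).symm

theorem isSymplecticGerm_of_mem_weakCausticGerms {T : Cot → Cot} (hT : T ∈ weakCausticGerms S') :
    IsSymplecticGerm T := by
  obtain ⟨a, -, hT⟩ := mem_weakCausticGerms.1 hT
  exact isSymplecticGerm_of_mem_causticClass hT

theorem weakCausticClass_subset_symplecticJets : weakCausticClass l S' ⊆ symplecticJets l := by
  rw [weakCausticClass_eq]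
  exact Set.image_mono fun _ => isSymplecticGerm_of_mem_weakCausticGerms

theorem lagrangianClass_subset_weakCausticGerms {T : Cot → Cot} (hT : T ∈ weakCausticGerms S') :
    lagrangianClass T ⊆ weakCausticGerms S' := by
  obtain ⟨a, ha, hT⟩ := mem_weakCausticGerms.1 hT
  exact fun R hR => mem_weakCausticGerms.2 ⟨a, ha, lagrangianClass_subset_causticClass hT hR⟩

/-- A nearby symplectic germ has a potential whose jet is that of a normal form, by versality, and
a normal form generates an element of the class. -/
theorem NormalData.Good.weakCausticClass_mem_nhdsWithin (hl : 1 ≤ l)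
    (hS' : ∀ a : ℝ, 1 / 4 < a → IsGeneratingFamily (Fa a) (S' a)) {D : NormalData} (hD : D.Good)
    (hφ₁ : D.φ₁ = fun _ => 1) (hφ₂ : D.φ₂ = fun _ => 1) (hP : IsPotential D.fn)
    {S : Cot → Cot} (hS : IsSymplecticGerm S) (hgen : IsGen D.fn S) :
    weakCausticClass l S' ∈ 𝓝[symplecticJets l] jet l S := by
  have hb := hgen.bijective_mixedPoint hP hS
  obtain ⟨ρ, hρ, hρA⟩ := exists_smooth_potentialJet hl hS hb
  have hversal := hD.eventually_exists_good hφ₁ hφ₂ hP (n := l + 1) (by omega)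
  have hρS : ρ (jet l S) = (hP.toJet (l + 1)).1 :=
    hρA.self_of_nhds _ _ hP hS hgen rfl
  rw [nhds_subtype_eq_comap, eventually_comap, ← hρS] at hversal
  rw [mem_nhdsWithin_iff_eventually, weakCausticClass_eq]
  filter_upwards [eventually_bijective_mixedPoint hl hS hb, hρA,
    hρ.continuousAt.eventually hversal] with j hbij hpotential hnormal
  rintro ⟨V, hV : IsSymplecticGerm V, rfl⟩
  obtain ⟨A, hA, hAV⟩ := hV.exists_isGen (hbij V hV rfl)
  obtain ⟨D', hD', hP', hDA⟩ := hnormal (hA.toJet (l + 1)) (hpotential A V hA hV hAV rfl).symm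
  obtain ⟨R, hRsmooth, hR0, hDR⟩ := hP'.exists_isGen
  have hR := hDR.isSymplecticGerm hP' hRsmooth hR0
  exact ⟨R, mem_weakCausticGerms.2
    ⟨D'.e 0, hD'.e_gt, hD'.mem_causticClass hP' (hS' _ hD'.e_gt) hR hDR⟩,
    jets_eq_iff.2 (hDR.jetEq hAV hP' hA (jets_eq_iff.1 hDA))⟩

variable (hS' : ∀ a : ℝ, 1 / 4 < a →
  IsSymplecticGerm (S' a) ∧ IsGeneratingFamily (Fa a) (S' a))
include hS'

theorem bijective_mixedPoint_of_mem_weakCausticGerms {T : Cot → Cot}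
    (hT : T ∈ weakCausticGerms S') : Function.Bijective (fderiv ℝ (mixedPoint T) 0) := by
  obtain ⟨a, ha, hTa⟩ := mem_weakCausticGerms.1 hT
  obtain ⟨D, S₀, -, -, -, hP, hS₀, hgen, hequiv⟩ :=
    exists_normalData_of_mem_causticClass ha (hS' a ha).1 (hS' a ha).2 hTa
  exact hequiv.bijective_mixedPoint hS₀ (isSymplecticGerm_of_mem_causticClass hTa)
    (hgen.bijective_mixedPoint hP hS₀)

theorem weakCausticClass_mem_nhdsWithin (hl : 1 ≤ l) {j : JetSpace l}
    (hj : j ∈ weakCausticClass l S') : weakCausticClass l S' ∈ 𝓝[symplecticJets l] j := by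
  rw [weakCausticClass_eq] at hj ⊢
  obtain ⟨T, hT, rfl⟩ := hj
  obtain ⟨a, ha, hTa⟩ := mem_weakCausticGerms.1 hT
  obtain ⟨D, S₀, hD, hφ₁, hφ₂, hP, hS₀, hgen, hequiv⟩ :=
    exists_normalData_of_mem_causticClass ha (hS' a ha).1 (hS' a ha).2 hTa
  refine hequiv.mem_nhdsWithin hS₀ (isSymplecticGerm_of_mem_causticClass hTa)
    (fun R hR => ⟨isSymplecticGerm_of_mem_weakCausticGerms hR,
      lagrangianClass_subset_weakCausticGerms hR⟩) ?_
  rw [← weakCausticClass_eq]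
  exact hD.weakCausticClass_mem_nhdsWithin hl (fun a ha => (hS' a ha).2) hφ₁ hφ₂ hP hS₀ hgen

omit hS'

/-- The jets of potentials that generate germs with jets in the weak caustic-equivalence class; they
parametrise it through `genJet`. -/
def potentialClass (l : ℕ) (S' : ℝ → Cot → Cot) : Set (potentialJets (l + 1)) :=
  {θ | IsPotential (potential θ) ∧ genJet l θ ∈ weakCausticClass l S'}

theorem genJet_mem_symplecticJets {θ : potentialJets (l + 1)} (hθ : IsPotential (potential θ)) :
    genJet l θ ∈ symplecticJets l := by
  obtain ⟨S, hsmooth, hzero, hgen⟩ := hθ.exists_isGen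
  exact ⟨S, hgen.isSymplecticGerm hθ hsmooth hzero,
    (genJet_eq hθ hθ (jets_potential θ) hgen).symm⟩

include hS'

theorem genJet_image_potentialClass (hl : 1 ≤ l) :
    genJet l '' potentialClass l S' = weakCausticClass l S' := by
  refine Set.Subset.antisymm (Set.image_subset_iff.2 fun θ hθ => hθ.2) fun j hj => ?_
  obtain ⟨T, hT, rfl⟩ := weakCausticClass_eq.subset hj
  obtain ⟨A, hA, hAT⟩ := (isSymplecticGerm_of_mem_weakCausticGerms hT).exists_isGen
    (bijective_mixedPoint_of_mem_weakCausticGerms hS' hT)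
  have hjet := genJet_toJet hl hA hAT
  exact ⟨hA.toJet (l + 1), ⟨hA.isPotential_potential (by omega), hjet ▸ hj⟩, hjet⟩

theorem isOpen_potentialClass (hl : 1 ≤ l) : IsOpen (potentialClass l S') := by
  refine isOpen_iff_mem_nhds.2 fun θ ⟨hθ, hj⟩ => ?_
  have hpotential : ∀ᶠ s in 𝓝 θ, IsPotential (potential s) := by
    obtain ⟨S, -, hS⟩ := exists_smooth_family hθ (by omega : 1 ≤ l + 1)
    exact hS.mono fun s hs => hs.1
  have hnear := mem_nhdsWithin_iff_eventually.1 (weakCausticClass_mem_nhdsWithin hS' hl hj)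
  filter_upwards [hpotential, (smoothNear_genJet hθ).continuousAt.eventually hnear] with s hs hweak
  exact ⟨hs, hweak (genJet_mem_symplecticJets hs)⟩

end WeakCausticClass

/-! ### Immersed manifolds -/

section Immersion

variable {l : ℕ}

theorem injOn_genJet (hl : 1 ≤ l) :
    Set.InjOn (genJet l) {θ : potentialJets (l + 1) | IsPotential (potential θ)} := by
  intro θ hθ s hs h
  obtain ⟨S, hSsmooth, hS0, hS⟩ := hθ.exists_isGen
  obtain ⟨R, hRsmooth, hR0, hR⟩ := hs.exists_isGen
  have hS' := hS.isSymplecticGerm hθ hSsmooth hS0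
  rw [genJet_eq hθ hθ (jets_potential θ) hS, genJet_eq hs hs (jets_potential s) hR] at h
  obtain ⟨ρ, -, hρ⟩ := exists_smooth_potentialJet hl hS' (hS.bijective_mixedPoint hθ hS')
  have hρS := hρ.self_of_nhds
  refine Subtype.ext ?_
  rw [← jets_potential θ, ← jets_potential s, ← hρS _ S hθ hS' hS rfl]
  exact hρS _ R hs (hR.isSymplecticGerm hs hRsmooth hR0) hR h.symm

theorem exists_leftInverse_genJet (hl : 1 ≤ l) {θ : potentialJets (l + 1)}
    (hθ : IsPotential (potential θ)) :
    ∃ ρ : JetSpace l → potentialJets (l + 1), SmoothNear ρ (genJet l θ) ∧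
      ∀ᶠ s in 𝓝 θ, ρ (genJet l s) = s := by
  obtain ⟨S, -, hS⟩ := exists_smooth_family hθ (by omega : 1 ≤ l + 1)
  have hjet {s S} (hs : IsPotential (potential s)) (h : IsGen (potential s) S) :
      genJet l s = jet l S := genJet_eq hs hs (jets_potential s) h
  obtain ⟨-, hgen, hSθ⟩ := hS.self_of_nhds
  obtain ⟨ρ, hρ, hρA⟩ := exists_smooth_potentialJet hl hSθ (hgen.bijective_mixedPoint hθ hSθ)
  rw [← hjet hθ hgen] at hρ hρA
  obtain ⟨π, hπ⟩ := Submodule.ClosedComplemented.of_finiteDimensional (potentialJets (l + 1))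
  refine ⟨fun j => π (ρ j),
    SmoothNear.clm (F := Jets (l + 1) Cot ℝ) (G := potentialJets (l + 1)) π hρ, ?_⟩
  filter_upwards [hS, (smoothNear_genJet hθ).continuousAt.eventually hρA] with s ⟨hs, hsS, hSs⟩ hρs
  rw [hρs _ (S s) hs hSs hsS (hjet hs hsS).symm, jets_potential, hπ]

theorem injective_mfderiv_of_leftInverse {E E' H H' M M' : Type*} [NormedAddCommGroup E]
    [NormedSpace ℝ E] [NormedAddCommGroup E'] [NormedSpace ℝ E'] [TopologicalSpace H]
    [TopologicalSpace H'] {I : ModelWithCorners ℝ E H} {I' : ModelWithCorners ℝ E' H'}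
    [TopologicalSpace M] [ChartedSpace H M] [TopologicalSpace M'] [ChartedSpace H' M']
    {f : M → M'} {g : M' → M} {x : M} (hf : MDifferentiableAt I I' f x)
    (hg : MDifferentiableAt I' I g (f x)) (hgf : ∀ᶠ y in 𝓝 x, g (f y) = y) :
    Function.Injective (mfderiv I I' f x) := by
  have hid : mfderiv I I (g ∘ f) x = ContinuousLinearMap.id ℝ (TangentSpace I x) :=
    (EventuallyEq.mfderiv_eq (f := id) hgf).trans mfderiv_id
  rw [mfderiv_comp x hg hf] at hid
  exact Function.LeftInverse.injective fun v => DFunLike.congr_fun hid v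

theorem exists_retraction_opens {E H X : Type*} [NormedAddCommGroup E] [NormedSpace ℝ E]
    [TopologicalSpace H] {I : ModelWithCorners ℝ E H} [TopologicalSpace X] [ChartedSpace H X]
    {M : TopologicalSpace.Opens X} (x : M) :
    ∃ r : X → M, ContMDiffAt I I ∞ r x ∧ ∀ y : M, r y = y := by
  classical
  let r : X → M := fun y => if hy : y ∈ M then ⟨y, hy⟩ else x
  have hr (y : M) : r y = y := dif_pos y.2
  refine ⟨r, contMDiffAt_subtype_iff.1 ?_, hr⟩
  simp only [hr]
  exact contMDiffAt_id

theorem isImmersedManifoldIn_image_euclidean {d : ℕ} {W : Type} [NormedAddCommGroup W]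
    [NormedSpace ℝ W] {f : EuclideanSpace ℝ (Fin d) → W} {Ω : Set (EuclideanSpace ℝ (Fin d))}
    (hΩ : IsOpen Ω) (hf : ∀ x ∈ Ω, ContDiffAt ℝ ∞ f x) (hinj : Set.InjOn f Ω)
    (hleft : ∀ x ∈ Ω, ∃ ρ : W → EuclideanSpace ℝ (Fin d), DifferentiableAt ℝ ρ (f x) ∧
      ∀ᶠ y in 𝓝 x, ρ (f y) = y) {N : Set W} (hN : f '' Ω ⊆ N) :
    IsImmersedManifoldIn (f '' Ω) N := by
  let M : TopologicalSpace.Opens (EuclideanSpace ℝ (Fin d)) := ⟨Ω, hΩ⟩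
  have hsmooth : ContMDiff (𝓡 d) 𝓘(ℝ, W) ∞ (fun x : M => f x) := fun x =>
    contMDiffAt_subtype_iff.2 (hf x x.2).contMDiffAt
  refine ⟨hN, d, M, inferInstance, inferInstance, fun x => f x, inferInstance, inferInstance,
    inferInstance, hsmooth, fun x y hxy => Subtype.ext (hinj x.2 y.2 hxy), fun x => ?_,
    (Set.image_eq_range f Ω).symm⟩
  obtain ⟨ρ, hρ, hρf⟩ := hleft x x.2
  obtain ⟨r, hr, hrM⟩ := exists_retraction_opens (I := 𝓡 d) x
  have hr' : MDifferentiableAt (𝓡 d) (𝓡 d) r (ρ (f x)) := by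
    rw [hρf.self_of_nhds]
    exact hr.mdifferentiableAt (by simp)
  refine injective_mfderiv_of_leftInverse (g := fun j => r (ρ j))
    ((hsmooth x).mdifferentiableAt (by simp))
    (MDifferentiableAt.comp (f x) hr' hρ.mdifferentiableAt) ?_
  filter_upwards [(continuous_subtype_val.tendsto x).eventually hρf] with y hy
  rw [hy, hrM]

theorem isImmersedManifoldIn_image {V W : Type} [NormedAddCommGroup V] [NormedSpace ℝ V]
    [FiniteDimensional ℝ V] [NormedAddCommGroup W] [NormedSpace ℝ W] {f : V → W} {Ω : Set V}
    (hΩ : IsOpen Ω) (hf : ∀ x ∈ Ω, ContDiffAt ℝ ∞ f x) (hinj : Set.InjOn f Ω)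
    (hleft : ∀ x ∈ Ω, ∃ ρ : W → V, DifferentiableAt ℝ ρ (f x) ∧ ∀ᶠ y in 𝓝 x, ρ (f y) = y)
    {N : Set W} (hN : f '' Ω ⊆ N) : IsImmersedManifoldIn (f '' Ω) N := by
  let e : EuclideanSpace ℝ (Fin (Module.finrank ℝ V)) ≃L[ℝ] V := (toEuclidean (E := V)).symm
  have himage : f '' Ω = (fun x => f (e x)) '' (e ⁻¹' Ω) := by
    rw [show (fun x => f (e x)) = f ∘ e from rfl, Set.image_comp,
      Set.image_preimage_eq _ e.surjective]
  rw [himage] at hN ⊢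
  refine isImmersedManifoldIn_image_euclidean (hΩ.preimage e.continuous)
    (fun x hx => (hf _ hx).comp x e.contDiff.contDiffAt)
    (fun x hx y hy h => e.injective (hinj hx hy h)) (fun x hx => ?_) hN
  obtain ⟨ρ, hρ, hρf⟩ := hleft _ hx
  refine ⟨fun j => e.symm (ρ j), e.symm.differentiableAt.comp _ hρ, ?_⟩
  filter_upwards [(e.continuous.tendsto x).eventually hρf] with y hy
  rw [Function.comp_apply, hy, e.symm_apply_apply]

end Immersion

end RetLag

end

theorem corollary4p2 (l : ℕ) (hl : 1 ≤ l) (S' : ℝ → RetLag.Cot → RetLag.Cot)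
    (hS' : ∀ a : ℝ, 1 / 4 < a →
      RetLag.IsSymplecticGerm (S' a) ∧ RetLag.IsGeneratingFamily (RetLag.Fa a) (S' a)) :
    RetLag.IsImmersedManifoldIn (RetLag.weakCausticClass l S') (RetLag.symplecticJets l) := by
  have himage := RetLag.genJet_image_potentialClass hS' hl
  have hsubset := RetLag.weakCausticClass_subset_symplecticJets (l := l) (S' := S')
  rw [← himage] at hsubset ⊢
  refine RetLag.isImmersedManifoldIn_image (V := RetLag.potentialJets (l + 1))
    (RetLag.isOpen_potentialClass hS' hl)
    (fun θ hθ => (RetLag.smoothNear_genJet hθ.1).contDiffAt)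
    ((RetLag.injOn_genJet hl).mono fun θ hθ => hθ.1) (fun θ hθ => ?_) hsubset
  obtain ⟨ρ, hρ, hρgenJet⟩ := RetLag.exists_leftInverse_genJet hl hθ.1
  exact ⟨ρ, hρ.differentiableAt, hρgenJet⟩
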